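/- Let $m\ge 0$ and $n\ge 1$ be integers, $F\in\mathbb R^{m\times m}$, $G\in\mathbb R^{m}$ a column vector, $H\in\mathbb R^{1\times m}$ a row vector, and $P\ge 0$. Let $u_1,u_2,\dots$ be independent $\mathcal N(0,1)$ random variables and let the noise $z$ be given by $$s_1=0,\qquad s_{k+1}=Fs_k+Gu_k,\qquad z_k=Hs_k+u_k .$$ Let $W$ be a random variable (the message) independent of $u$. A feedback encoder is a sequence of measurable deterministic functions $f_1,\dots,f_n$; it sends $x_k=f_k(W,x^{k-1},y^{k-1})$ and the channel output is $y_k=x_k+z_k$, where $a^{k}=(a_1,\dots,a_k)$. The average feedback capacity over the horizon $n$ is $$C_n=\sup\ \frac1n\, I(W;y^n)\quad\text{(in bits)},$$ where the supremum is over all messages $W$ and all feedback encoders with $\frac1n\sum_{k=1}^n \mathbb E[x_k^2]\le P$. For row vectors $X_1,\dots,X_n\in\mathbb R^{1\times m}$ and numbers $V_1,\dots,V_n\ge 0$ put $\Sigma_1=0$ and, for $k\ge1$, $$Y_k=(X_k+H)\Sigma_k(X_k+H)^\intercal+V_k+1,\qquad \Gamma_k=\bigl(F\Sigma_k(X_k+H)^\intercal+G\bigr)Y_k^{-1},$$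 $$\Sigma_{k+1}=(F-\Gamma_k(X_k+H))\Sigma_k(F-\Gamma_k(X_k+H))^\intercal+(G-\Gamma_k)(G-\Gamma_k)^\intercal+\Gamma_kV_k\Gamma_k^\intercal .$$ Then also $\Sigma_{k+1}=F\Sigma_kF^\intercal+GG^\intercal-\Gamma_kY_k\Gamma_k^\intercal$, and $$C_n=\sup\Bigl\{\frac1{2n}\sum_{k=1}^n\log_2 Y_k \;:\; X_1,\dots,X_n,\ V_1,\dots,V_n\ge0,\ \ \frac1n\sum_{k=1}^n\bigl(X_k\Sigma_kX_k^\intercal+V_k\bigr)\le P\Bigr\}.$$ The value of $C_n$ does not change if only messages uniformly distributed on finite sets $\{1,\dots,N\}$, $N\ge1$, are allowed. Moreover, both suprema are attained: there are $X_k,V_k$ satisfying the constraint and attaining the right-hand side such that, with $v_1,\dots,v_n$ independent, $v_k\sim\mathcal N(0,V_k)$, and independent of $u$, the signal $$x_k=X_k\tilde s_k+v_k\ \text{ almost surely},\qquad \tilde s_k=s_k-\mathbb E[s_k\mid y^{k-1}],$$ is produced by a feedback encoder with message $W=v^n$, satisfies the power constraint, and has $\frac1n I(W;y^n)=C_n$.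 All of this holds as well with the power constraint imposed at every time: if $C_n$ is defined with $\mathbb E[x_k^2]\le P$ for every $k\le n$ instead of the average constraint, then the same conclusions hold with $P\ge X_k\Sigma_kX_k^\intercal+V_k$ for every $k\le n$ as the constraint on $X_k,V_k$. -/

import Mathlib

open MeasureTheory ProbabilityTheory InformationTheory Matrix
open scoped ENNReal NNReal

namespace FeedbackChannel

noncomputable section

/- Time is counted from `0`: index `k` of a sequence below is the time `k + 1` of the usual
one-based notation, so that the horizon of length `n` consists of the indices `k < n`.
Row vectors `H`, `X k` and column vectors `G` are functions `Fin m → ℝ`. -/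

/-- The states `s` of the noise model: `s` starts at `0` and `s (k+1) = F s_k + G u_k`. -/
def noiseState {m : ℕ} (F : Matrix (Fin m) (Fin m) ℝ) (G : Fin m → ℝ) (u : ℕ → ℝ) :
    ℕ → Fin m → ℝ
  | 0 => 0
  | k + 1 => F *ᵥ noiseState F G u k + u k • G

/-- The noise `z_k = H s_k + u_k`. -/
def noise {m : ℕ} (F : Matrix (Fin m) (Fin m) ℝ) (G H : Fin m → ℝ) (u : ℕ → ℝ) (k : ℕ) : ℝ :=
  H ⬝ᵥ noiseState F G u k + u k

/-- A feedback encoder for messages in `M`: measurable functions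
`f_k (w, (x_i)_{i<k}, (y_i)_{i<k})` giving the symbol transmitted at time `k`. -/
structure Encoder (M : Type) [MeasurableSpace M] where
  f : (k : ℕ) → M × (Fin k → ℝ) × (Fin k → ℝ) → ℝ
  measurable_f : ∀ k, Measurable (f k)

/-- The symbols `x_k = f_k (w, (x_i)_{i<k}, (y_i)_{i<k})`, with `y_i = x_i + z_i`, sent for the
message `w` when the noise is `z`. -/
def Encoder.input {M : Type} [MeasurableSpace M] (e : Encoder M) (w : M) (z : ℕ → ℝ) (k : ℕ) : ℝ :=
  e.f k (w, fun i : Fin k => e.input w z i, fun i : Fin k => e.input w z i + z i)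
termination_by k
decreasing_by all_goals exact i.2

/-- The law of the driving white noise: independent standard Gaussians `u_0, u_1, …`. -/
def whiteNoise : Measure (ℕ → ℝ) := Measure.infinitePi fun _ => gaussianReal 0 1

/-- The joint law of the message `W ∼ π` and the driving noise `u`, which are independent. -/
def jointLaw {M : Type} [MeasurableSpace M] (π : Measure M) : Measure (M × (ℕ → ℝ)) :=
  π.prod whiteNoise

section signals

variable {m : ℕ} (F : Matrix (Fin m) (Fin m) ℝ) (G H : Fin m → ℝ)
  {M : Type} [MeasurableSpace M] (e : Encoder M)

/-- The transmitted symbol `x_k` as a random variable on the space of pairs `(W, u)`. -/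
def sent (k : ℕ) (ω : M × (ℕ → ℝ)) : ℝ :=
  e.input ω.1 (noise F G H ω.2) k

/-- The channel output `y_k = x_k + z_k`. -/
def received (k : ℕ) (ω : M × (ℕ → ℝ)) : ℝ :=
  sent F G H e k ω + noise F G H ω.2 k

/-- The outputs `(y_i)_{i<k}` before time `k`. -/
def receivedBefore (k : ℕ) (ω : M × (ℕ → ℝ)) : Fin k → ℝ :=
  fun i => received F G H e i ω

/-- `E[x_k ^ 2]`, as an extended nonnegative number. -/
def power (π : Measure M) (k : ℕ) : ℝ≥0∞ :=
  ∫⁻ ω, ENNReal.ofReal (sent F G H e k ω ^ 2) ∂(jointLaw π)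

/-- The estimate `ŝ_k = E[s_k | (y_i)_{i<k}]` of the noise state from the past outputs. -/
def stateEstimate (π : Measure M) (k : ℕ) : M × (ℕ → ℝ) → Fin m → ℝ :=
  (jointLaw π)[fun ω => noiseState F G ω.2 k |
    MeasurableSpace.comap (receivedBefore F G H e k) inferInstance]

/-- The estimation error `s̃_k = s_k - ŝ_k`. -/
def estimationError (π : Measure M) (k : ℕ) (ω : M × (ℕ → ℝ)) : Fin m → ℝ :=
  noiseState F G ω.2 k - stateEstimate F G H e π k ω

end signals

/-- The mutual information, in bits, of two random variables: the Kullback-Leibler divergence of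
their joint law from the product of their marginal laws. -/
def mutualInfo {Ω α β : Type} [MeasurableSpace Ω] [MeasurableSpace α] [MeasurableSpace β]
    (μ : Measure Ω) (A : Ω → α) (B : Ω → β) : ℝ≥0∞ :=
  klDiv (μ.map fun ω => (A ω, B ω)) ((μ.map A).prod (μ.map B)) / ENNReal.ofReal (Real.log 2)

/-- The rate `(1/n) I(W; y_0, …, y_{n-1})`, in bits. -/
def rate {m : ℕ} (F : Matrix (Fin m) (Fin m) ℝ) (G H : Fin m → ℝ) (n : ℕ)
    {M : Type} [MeasurableSpace M] (π : Measure M) (e : Encoder M) : ℝ≥0∞ :=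
  mutualInfo (jointLaw π) Prod.fst (receivedBefore F G H e n) / n

/-- The average power constraint `(1/n) ∑_{k<n} p_k ≤ P` on a sequence of powers `p_k`. -/
def AveragePower (n : ℕ) (P : ℝ) (p : ℕ → ℝ≥0∞) : Prop :=
  (∑ k ∈ Finset.range n, p k) / n ≤ ENNReal.ofReal P

/-- The power constraint at every time, `p_k ≤ P` for all `k < n`. -/
def SymbolPower (n : ℕ) (P : ℝ) (p : ℕ → ℝ≥0∞) : Prop :=
  ∀ k < n, p k ≤ ENNReal.ofReal P

/-- The feedback capacity over the horizon `n` under the constraint `A` on the powers `E[x_k ^ 2]`: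
the supremum of `(1/n) I(W; y_0, …, y_{n-1})` over all messages `W` independent of the noise and
all feedback encoders that satisfy the constraint. -/
def capacity {m : ℕ} (F : Matrix (Fin m) (Fin m) ℝ) (G H : Fin m → ℝ) (n : ℕ)
    (A : (ℕ → ℝ≥0∞) → Prop) : ℝ≥0∞ :=
  ⨆ (M : Type) (_ : MeasurableSpace M) (π : Measure M) (_ : IsProbabilityMeasure π)
    (e : Encoder M) (_ : A (power F G H e π)), rate F G H n π e

/-- The uniform law on the messages `{1, …, N}`, here `Fin N`. -/
def uniformMessage (N : ℕ) : Measure (Fin N) := uniformOn Set.univ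

/-- The same supremum over the messages that are uniformly distributed on a finite nonempty set
`{1, …, N}`, of any size. -/
def uniformCapacity {m : ℕ} (F : Matrix (Fin m) (Fin m) ℝ) (G H : Fin m → ℝ) (n : ℕ)
    (A : (ℕ → ℝ≥0∞) → Prop) : ℝ≥0∞ :=
  ⨆ (N : ℕ) (_ : 0 < N) (e : Encoder (Fin N)) (_ : A (power F G H e (uniformMessage N))),
    rate F G H n (uniformMessage N) e

section recursion

variable {m : ℕ} (F : Matrix (Fin m) (Fin m) ℝ) (G H : Fin m → ℝ)

/-- `Y = (X + H) Σ (X + H)ᵀ + V + 1`. -/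
def outputVar (S : Matrix (Fin m) (Fin m) ℝ) (X : Fin m → ℝ) (V : ℝ) : ℝ :=
  (X + H) ⬝ᵥ (S *ᵥ (X + H)) + V + 1

/-- `Γ = (F Σ (X + H)ᵀ + G) Y⁻¹`. -/
def gain (S : Matrix (Fin m) (Fin m) ℝ) (X : Fin m → ℝ) (V : ℝ) : Fin m → ℝ :=
  (outputVar H S X V)⁻¹ • (F *ᵥ (S *ᵥ (X + H)) + G)

/-- The matrices `Σ_k`: `Σ` starts at `0` and
`Σ_{k+1} = (F - Γ_k (X_k + H)) Σ_k (F - Γ_k (X_k + H))ᵀ + (G - Γ_k) (G - Γ_k)ᵀ + Γ_k V_k Γ_kᵀ`. -/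
def Sig (X : ℕ → Fin m → ℝ) (V : ℕ → ℝ≥0) : ℕ → Matrix (Fin m) (Fin m) ℝ
  | 0 => 0
  | k + 1 =>
    let S := Sig X V k
    let Γ := gain F G H S (X k) (V k)
    (F - vecMulVec Γ (X k + H)) * S * (F - vecMulVec Γ (X k + H))ᵀ
      + vecMulVec (G - Γ) (G - Γ) + (V k : ℝ) • vecMulVec Γ Γ

/-- `Y_k` along the recursion. -/
def Yseq (X : ℕ → Fin m → ℝ) (V : ℕ → ℝ≥0) (k : ℕ) : ℝ :=
  outputVar H (Sig F G H X V k) (X k) (V k)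

/-- `Γ_k` along the recursion. -/
def Gam (X : ℕ → Fin m → ℝ) (V : ℕ → ℝ≥0) (k : ℕ) : Fin m → ℝ :=
  gain F G H (Sig F G H X V k) (X k) (V k)

/-- `X_k Σ_k X_kᵀ + V_k`, the power allotted to time `k` (it is nonnegative). -/
def inputPower (X : ℕ → Fin m → ℝ) (V : ℕ → ℝ≥0) (k : ℕ) : ℝ≥0∞ :=
  ENNReal.ofReal (X k ⬝ᵥ (Sig F G H X V k *ᵥ X k) + V k)

/-- The objective `(1/2n) ∑_{k<n} log₂ Y_k` (it is nonnegative, since `Y_k ≥ 1`). -/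
def objective (n : ℕ) (X : ℕ → Fin m → ℝ) (V : ℕ → ℝ≥0) : ℝ≥0∞ :=
  ENNReal.ofReal (1 / (2 * n) * ∑ k ∈ Finset.range n, Real.logb 2 (Yseq F G H X V k))

end recursion

end

end FeedbackChannel

open FeedbackChannel

-- Given the message and the past outputs, `y_k` is a known quantity plus the fresh noise `u_k`: the
-- noise filter is causally invertible, so `x^k` and `s_k` can be reconstructed. The map from
-- outputs to these innovations is a triangular shear, so the pair `(W, y^n)` has, with respect to
-- the law of `W` times Lebesgue measure, the standard Gaussian density evaluated at the innovations
-- (`map_message_outputs`). This density lies in `(0, 1]`, which makes every information integral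
-- below meaningful for an arbitrary message.
--
-- Converse. Mutual information is at most the divergence of the joint law from `π × q`, for every
-- output density `q`. Let `q` be the density under which the errors of the best linear predictor of
-- `y_k` are independent Gaussians with their true second moments `D_k`. The divergence is then
-- exactly `1/2 ∑ log D_k` in nats, with no Gaussian assumption on the input (`info_le`). The `D_k`
-- are computed in `L²`: project `s_k` and `x_k` off the span of the past outputs, leaving residuals
-- `σ_k` and `ξ_k`. Only the orthogonality of `u_k` to the past is needed to see that the Gram
-- matrix of `σ_k` follows the Riccati recursion driven by `c_k = ⟨σ_k, ξ_k⟩` and `q_k = ‖ξ_k‖² ≤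
-- E[x_k²]` (`exists_prediction`).
--
-- Optimization. The bordered matrix of `(σ_k, ξ_k)` is positive semidefinite. By the Schur
-- complement this says precisely that `c_k = Σ_k X_k` and `q_k = X_k Σ_k X_kᵀ + V_k` for some `X_k`
-- and some `V_k ≥ 0` (`BlockNonneg.exists_eq`), so the converse is a bound by the stated problem.
-- The vectors `X_k` may be unbounded when `Σ_k` degenerates, but the pairs `(c_k, q_k)` range over
-- a compact set on which the objective is continuous. Hence the maximum is attained
-- (`exists_optimal`).
--
-- Achievability. For an optimal `X`, `V`, the encoder with Gaussian message `v` is linear, so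
-- estimation errors and innovations are jointly Gaussian. The gain `Γ_k` is the regression
-- coefficient on the innovation, so the innovations are uncorrelated, hence independent, with
-- variances `Y_k`; the Gaussian density `q` is then the true output density and the bound is an
-- equality (`info_linearEncoder`). The same independence identifies the recursive estimate with the
-- conditional expectation (`stateEstimate_linearEncoder`).
--
-- Uniform messages. Contract the Gaussian message by `t < 1`, draw independent samples and use the
-- uniform law on the indices. By the law of large numbers the power constraint eventually holds,
-- thanks to the slack left by `t`, and the output densities converge. Information is lower
-- semicontinuous by Fatou's lemma, so letting the number of samples grow and then `t → 1` loses
-- nothing (`info_linearEncoder_le`).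
--
-- Both power constraints share the properties collected in `IsConstraint`, and the argument uses
-- nothing else about them.

namespace FeedbackChannel

open Filter Topology

/-! ### The covariance recursion -/

section covariance

variable {m : ℕ} (F : Matrix (Fin m) (Fin m) ℝ) (G H : Fin m → ℝ)

/-- The bordered matrix `[[S, c], [cᵀ, q]]` is positive semidefinite. -/
def BlockNonneg (S : Matrix (Fin m) (Fin m) ℝ) (c : Fin m → ℝ) (q : ℝ) : Prop :=
  ∀ (w : Fin m → ℝ) (t : ℝ), 0 ≤ w ⬝ᵥ (S *ᵥ w) + 2 * t * (w ⬝ᵥ c) + t ^ 2 * q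

/-- The innovation variance in terms of the state covariance `S`, the cross covariance `c` and the
input power `q`. The truncation at `1` makes it continuous to divide by it. -/
noncomputable def innovVar (S : Matrix (Fin m) (Fin m) ℝ) (c : Fin m → ℝ) (q : ℝ) : ℝ :=
  max 1 (q + 2 * (H ⬝ᵥ c) + H ⬝ᵥ (S *ᵥ H) + 1)

/-- One step of the covariance recursion in the coordinates `c`, `q`. -/
noncomputable def covStep (S : Matrix (Fin m) (Fin m) ℝ) (c : Fin m → ℝ) (q : ℝ) :
    Matrix (Fin m) (Fin m) ℝ :=
  F * S * Fᵀ + vecMulVec G G -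
    (innovVar H S c q)⁻¹ • vecMulVec (F *ᵥ (c + S *ᵥ H) + G) (F *ᵥ (c + S *ᵥ H) + G)

/-- The covariance matrices generated by a sequence of pairs `(c_k, q_k)`. -/
noncomputable def covSeq (p : ℕ → (Fin m → ℝ) × ℝ) : ℕ → Matrix (Fin m) (Fin m) ℝ
  | 0 => 0
  | k + 1 => covStep F G H (covSeq p k) (p k).1 (p k).2

/-- The innovation variance along the recursion. -/
noncomputable def covY (p : ℕ → (Fin m → ℝ) × ℝ) (k : ℕ) : ℝ :=
  innovVar H (covSeq F G H p k) (p k).1 (p k).2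

variable {F G H}

theorem one_le_innovVar (S : Matrix (Fin m) (Fin m) ℝ) (c : Fin m → ℝ) (q : ℝ) :
    1 ≤ innovVar H S c q := le_max_left _ _

/-- The test vector `(H, 1)` shows that the variance of `ξ + Hσ` is nonnegative, so the truncation
is inactive at feasible points. -/
theorem BlockNonneg.innovVar_eq {S : Matrix (Fin m) (Fin m) ℝ} {c : Fin m → ℝ} {q : ℝ}
    (h : BlockNonneg S c q) :
    innovVar H S c q = q + 2 * (H ⬝ᵥ c) + H ⬝ᵥ (S *ᵥ H) + 1 := by
  refine max_eq_right ?_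
  have := h H 1
  linarith

theorem BlockNonneg.nonneg {S : Matrix (Fin m) (Fin m) ℝ} {c : Fin m → ℝ} {q : ℝ}
    (h : BlockNonneg S c q) : 0 ≤ q := by
  simpa using h 0 1

theorem BlockNonneg.quad_nonneg {S : Matrix (Fin m) (Fin m) ℝ} {c : Fin m → ℝ} {q : ℝ}
    (h : BlockNonneg S c q) (w : Fin m → ℝ) : 0 ≤ w ⬝ᵥ (S *ᵥ w) := by
  simpa using h w 0

/-- Schwarz inequality: the form is a quadratic polynomial in `t` without sign change. -/
theorem BlockNonneg.sq_le {S : Matrix (Fin m) (Fin m) ℝ} {c : Fin m → ℝ} {q : ℝ}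
    (h : BlockNonneg S c q) (w : Fin m → ℝ) : (w ⬝ᵥ c) ^ 2 ≤ w ⬝ᵥ (S *ᵥ w) * q := by
  have h0 : ∀ t : ℝ, 0 ≤ q * (t * t) + (2 * (w ⬝ᵥ c)) * t + w ⬝ᵥ (S *ᵥ w) := fun t => by
    have := h w t
    nlinarith
  have := discrim_le_zero h0
  unfold discrim at this
  nlinarith

theorem BlockNonneg.dotProduct_eq_zero {S : Matrix (Fin m) (Fin m) ℝ} {c : Fin m → ℝ} {q : ℝ}
    (h : BlockNonneg S c q) {w : Fin m → ℝ} (hw : S *ᵥ w = 0) : w ⬝ᵥ c = 0 := by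
  have := h.sq_le w
  rw [hw, dotProduct_zero, zero_mul] at this
  exact pow_eq_zero_iff two_ne_zero |>.1 (le_antisymm this (sq_nonneg _))

/-- Fredholm alternative for a symmetric matrix. If `c` were outside the range, some functional `w
⬝ᵥ ·` would vanish on the range but not at `c`; by symmetry such a `w` lies in the kernel, which
contradicts the hypothesis. -/
theorem exists_mulVec_eq {S : Matrix (Fin m) (Fin m) ℝ} (hS : Sᵀ = S) {c : Fin m → ℝ}
    (h : ∀ w, S *ᵥ w = 0 → w ⬝ᵥ c = 0) : ∃ X, S *ᵥ X = c := by
  by_contra hc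
  have hc' : c ∉ LinearMap.range S.mulVecLin := fun ⟨X, hX⟩ => hc ⟨X, hX⟩
  obtain ⟨f, hf, hker⟩ := Submodule.exists_le_ker_of_notMem hc'
  set w : Fin m → ℝ := fun i => f fun j => if i = j then 1 else 0
  have hfw : ∀ x, f x = w ⬝ᵥ x := fun x => by
    rw [LinearMap.pi_apply_eq_sum_univ f x]
    simp [dotProduct, w, mul_comm]
  refine hf ((hfw c).trans (h w ?_))
  rw [← hS, mulVec_transpose]
  refine dotProduct_eq_zero_iff.1 fun v => ?_
  rw [← dotProduct_mulVec, ← hfw]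
  exact hker ⟨v, rfl⟩

/-- Schur complement for a possibly singular `S`: the Schwarz inequality makes `c` orthogonal to the
kernel, so `c = S X`, and the test vector `(X, -1)` shows that the remainder `V = q - X S Xᵀ` is
nonnegative. -/
theorem BlockNonneg.exists_eq {S : Matrix (Fin m) (Fin m) ℝ} (hS : Sᵀ = S) {c : Fin m → ℝ} {q : ℝ}
    (h : BlockNonneg S c q) :
    ∃ (X : Fin m → ℝ) (V : ℝ≥0), S *ᵥ X = c ∧ X ⬝ᵥ (S *ᵥ X) + V = q := by
  obtain ⟨X, rfl⟩ := exists_mulVec_eq hS fun w hw => h.dotProduct_eq_zero hw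
  refine ⟨X, ⟨q - X ⬝ᵥ (S *ᵥ X), ?_⟩, rfl, ?_⟩
  · have := h X (-1)
    linarith
  · change X ⬝ᵥ (S *ᵥ X) + (q - X ⬝ᵥ (S *ᵥ X)) = q
    ring

theorem dotProduct_mulVec_symm {S : Matrix (Fin m) (Fin m) ℝ} (hS : Sᵀ = S) (v w : Fin m → ℝ) :
    v ⬝ᵥ (S *ᵥ w) = w ⬝ᵥ (S *ᵥ v) := by
  rw [dotProduct_mulVec, ← mulVec_transpose, hS, dotProduct_comm]

/-- Completing the square, the form equals `(w + tX) S (w + tX)ᵀ + t² V`. -/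
theorem blockNonneg_mulVec {S : Matrix (Fin m) (Fin m) ℝ} (hS : S.PosSemidef) (X : Fin m → ℝ)
    (V : ℝ≥0) : BlockNonneg S (S *ᵥ X) (X ⬝ᵥ (S *ᵥ X) + V) := fun w t => by
  have h := hS.dotProduct_mulVec_nonneg (w + t • X)
  have hsym : Sᵀ = S := hS.isHermitian
  simp only [star_trivial, mulVec_add, mulVec_smul, dotProduct_add, add_dotProduct,
    dotProduct_smul, smul_dotProduct, smul_eq_mul, dotProduct_mulVec_symm hsym X w] at h
  have := mul_nonneg (sq_nonneg t) V.2
  simp only [NNReal.val_eq_coe] at this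
  nlinarith

theorem innovVar_mulVec {S : Matrix (Fin m) (Fin m) ℝ} (hS : S.PosSemidef) (X : Fin m → ℝ)
    (V : ℝ≥0) :
    innovVar H S (S *ᵥ X) (X ⬝ᵥ (S *ᵥ X) + V) = outputVar H S X V := by
  have hsym : Sᵀ = S := hS.isHermitian
  rw [(blockNonneg_mulVec hS X V).innovVar_eq, outputVar]
  simp only [mulVec_add, dotProduct_add, add_dotProduct, dotProduct_mulVec_symm hsym X H]
  ring

theorem one_le_outputVar {S : Matrix (Fin m) (Fin m) ℝ} (hS : S.PosSemidef) (X : Fin m → ℝ)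
    (V : ℝ≥0) : 1 ≤ outputVar H S X V := by
  rw [← innovVar_mulVec hS]
  exact one_le_innovVar _ _ _

theorem posSemidef_vecMulVec (v : Fin m → ℝ) : (vecMulVec v v).PosSemidef := by
  simpa using posSemidef_vecMulVec_self_star v

theorem posSemidef_Sig (X : ℕ → Fin m → ℝ) (V : ℕ → ℝ≥0) (k : ℕ) :
    (Sig F G H X V k).PosSemidef := by
  induction k with
  | zero => exact PosSemidef.zero
  | succ k ih =>
    rw [Sig]
    have h := ih.mul_mul_conjTranspose_same
      (F - vecMulVec (gain F G H (Sig F G H X V k) (X k) (V k)) (X k + H))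
    rw [conjTranspose_eq_transpose_of_trivial] at h
    exact (h.add (posSemidef_vecMulVec _)).add ((posSemidef_vecMulVec _).smul (V k).2)

theorem one_le_Yseq (X : ℕ → Fin m → ℝ) (V : ℕ → ℝ≥0) (k : ℕ) : 1 ≤ Yseq F G H X V k :=
  one_le_outputVar (posSemidef_Sig X V k) _ _

theorem Yseq_smul_Gam (X : ℕ → Fin m → ℝ) (V : ℕ → ℝ≥0) (k : ℕ) :
    Yseq F G H X V k • Gam F G H X V k = F *ᵥ (Sig F G H X V k *ᵥ (X k + H)) + G :=
  smul_inv_smul₀ (ne_of_gt (zero_lt_one.trans_le (one_le_Yseq X V k))) _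

/-- The Riccati form of the recursion for `Σ`. -/
theorem Sig_succ (X : ℕ → Fin m → ℝ) (V : ℕ → ℝ≥0) (k : ℕ) :
    Sig F G H X V (k + 1) = F * Sig F G H X V k * Fᵀ + vecMulVec G G
      - Yseq F G H X V k • vecMulVec (Gam F G H X V k) (Gam F G H X V k) := by
  have hsym : (Sig F G H X V k)ᵀ = Sig F G H X V k := (posSemidef_Sig X V k).isHermitian
  have hY : Yseq F G H X V k = (X k + H) ⬝ᵥ (Sig F G H X V k *ᵥ (X k + H)) + V k + 1 := rfl
  have hΓ := Yseq_smul_Gam (F := F) (G := G) (H := H) X V k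
  have hrec : Sig F G H X V (k + 1) =
      (F - vecMulVec (Gam F G H X V k) (X k + H)) * Sig F G H X V k *
        (F - vecMulVec (Gam F G H X V k) (X k + H))ᵀ
      + vecMulVec (G - Gam F G H X V k) (G - Gam F G H X V k)
      + (V k : ℝ) • vecMulVec (Gam F G H X V k) (Gam F G H X V k) := rfl
  rw [hrec]
  generalize Gam F G H X V k = Γ at *
  generalize Yseq F G H X V k = Y at *
  generalize Sig F G H X V k = S at *
  generalize X k + H = h at *
  have e1 : F * S * (vecMulVec Γ h)ᵀ = vecMulVec (F *ᵥ (S *ᵥ h)) Γ := by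
    rw [transpose_vecMulVec, mul_vecMulVec, mulVec_mulVec]
  have e2 : vecMulVec Γ h * S * Fᵀ = vecMulVec Γ (F *ᵥ (S *ᵥ h)) := by
    rw [vecMulVec_mul, vecMulVec_mul, vecMul_transpose, ← mulVec_transpose, hsym]
  have e3 : vecMulVec Γ h * S * (vecMulVec Γ h)ᵀ = (h ⬝ᵥ (S *ᵥ h)) • vecMulVec Γ Γ := by
    rw [transpose_vecMulVec, vecMulVec_mul, vecMulVec_mul_vecMulVec, dotProduct_mulVec]
    ext i j
    simp [vecMulVec_apply]
    ring
  rw [transpose_sub, mul_sub, sub_mul, sub_mul, sub_mul, e1, e2, e3]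
  -- After this substitution every term other than `F S Fᵀ` is a combination of `GGᵀ`, `GΓᵀ`, `ΓGᵀ`
  -- and `ΓΓᵀ`. The mixed terms cancel, and the coefficient of `ΓΓᵀ` is `-2Y + (hShᵀ + V + 1) = -Y`.
  have hF : F *ᵥ (S *ᵥ h) = Y • Γ - G := by rw [hΓ, add_sub_cancel_right]
  rw [hF]
  ext i j
  simp only [Matrix.add_apply, Matrix.sub_apply, vecMulVec_apply, Pi.sub_apply, Pi.smul_apply, Matrix.smul_apply,
    smul_eq_mul, hY]
  ring

/-- The coordinates `(c_k, q_k) = (Σ_k X_kᵀ, X_k Σ_k X_kᵀ + V_k)` of a choice of `X`, `V`. -/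
noncomputable def toCov (F : Matrix (Fin m) (Fin m) ℝ) (G H : Fin m → ℝ) (X : ℕ → Fin m → ℝ)
    (V : ℕ → ℝ≥0) (k : ℕ) : (Fin m → ℝ) × ℝ :=
  (Sig F G H X V k *ᵥ X k, X k ⬝ᵥ (Sig F G H X V k *ᵥ X k) + V k)

theorem innovVar_toCov (X : ℕ → Fin m → ℝ) (V : ℕ → ℝ≥0) (k : ℕ) :
    innovVar H (Sig F G H X V k) (toCov F G H X V k).1 (toCov F G H X V k).2 = Yseq F G H X V k :=
  innovVar_mulVec (posSemidef_Sig X V k) _ _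

theorem Sig_succ_eq_covStep (X : ℕ → Fin m → ℝ) (V : ℕ → ℝ≥0) (k : ℕ) :
    Sig F G H X V (k + 1) =
      covStep F G H (Sig F G H X V k) (toCov F G H X V k).1 (toCov F G H X V k).2 := by
  rw [Sig_succ, covStep, innovVar_toCov, toCov, ← mulVec_add, ← Yseq_smul_Gam X V k]
  have hY : Yseq F G H X V k ≠ 0 := ne_of_gt (zero_lt_one.trans_le (one_le_Yseq X V k))
  congr 1
  ext i j
  simp [vecMulVec_apply]
  field_simp

theorem covSeq_toCov (X : ℕ → Fin m → ℝ) (V : ℕ → ℝ≥0) (k : ℕ) :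
    covSeq F G H (toCov F G H X V) k = Sig F G H X V k := by
  induction k with
  | zero => rfl
  | succ k ih => rw [covSeq, ih, Sig_succ_eq_covStep]

theorem covY_toCov (X : ℕ → Fin m → ℝ) (V : ℕ → ℝ≥0) (k : ℕ) :
    covY F G H (toCov F G H X V) k = Yseq F G H X V k := by
  rw [covY, covSeq_toCov, innovVar_toCov]

theorem covSeq_transpose (p : ℕ → (Fin m → ℝ) × ℝ) (k : ℕ) :
    (covSeq F G H p k)ᵀ = covSeq F G H p k := by
  induction k with
  | zero => simp [covSeq]
  | succ k ih =>
    simp [covSeq, covStep, transpose_vecMulVec, transpose_mul, ih, Matrix.mul_assoc]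

/-- Feasible sequences of pairs `(c_k, q_k)` come from sequences `X`, `V`. -/
theorem exists_toCov_eq {p : ℕ → (Fin m → ℝ) × ℝ}
    (hp : ∀ k, BlockNonneg (covSeq F G H p k) (p k).1 (p k).2) :
    ∃ (X : ℕ → Fin m → ℝ) (V : ℕ → ℝ≥0), toCov F G H X V = p := by
  -- The Schur complement is taken against `covSeq F G H p k`, which depends on `p` alone, so all
  -- times can be chosen at once; that these matrices are the `Σ_k` of the chosen `X`, `V` follows
  -- by induction.
  choose X V hc hq using fun k => (hp k).exists_eq (covSeq_transpose p k)
  have key : ∀ k, Sig F G H X V k = covSeq F G H p k := fun k => by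
    induction k with
    | zero => rfl
    | succ k ih => rw [Sig_succ_eq_covStep, covSeq, toCov, ih, hc k, ← hq k, hc k]
  refine ⟨X, V, funext fun k => ?_⟩
  rw [toCov, key, hq k, hc k]

theorem blockNonneg_toCov (X : ℕ → Fin m → ℝ) (V : ℕ → ℝ≥0) (k : ℕ) :
    BlockNonneg (covSeq F G H (toCov F G H X V) k) (toCov F G H X V k).1 (toCov F G H X V k).2 := by
  rw [covSeq_toCov]
  exact blockNonneg_mulVec (posSemidef_Sig X V k) _ _

theorem Sig_congr {X X' : ℕ → Fin m → ℝ} {V V' : ℕ → ℝ≥0} {k : ℕ}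
    (hX : ∀ j < k, X j = X' j) (hV : ∀ j < k, V j = V' j) :
    Sig F G H X V k = Sig F G H X' V' k := by
  induction k with
  | zero => rfl
  | succ k ih =>
    rw [Sig, Sig, ih (fun j hj => hX j (hj.trans k.lt_succ_self))
      (fun j hj => hV j (hj.trans k.lt_succ_self)), hX k k.lt_succ_self, hV k k.lt_succ_self]

end covariance

end FeedbackChannel

namespace FeedbackChannel

open Filter Topology

/-! ### Existence of an optimal choice -/

/-- The properties of a power constraint over the horizon `n` that the coding theorem uses. -/
structure IsConstraint (n : ℕ) (R : ℝ) (A : (ℕ → ℝ≥0∞) → Prop) : Prop where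
  mono : ∀ p p' : ℕ → ℝ≥0∞, (∀ k < n, p k ≤ p' k) → A p' → A p
  closed : IsClosed {q : ℕ → ℝ | A fun k => ENNReal.ofReal (q k)}
  le : ∀ p, A p → ∀ k < n, p k ≤ ENNReal.ofReal R
  zero : A 0

theorem isConstraint_averagePower {n : ℕ} (hn : 0 < n) {P : ℝ} :
    -- A single power is bounded only by the whole budget, hence the constant `n * P`.
    IsConstraint n (n * P) (AveragePower n P) where
  mono p p' h hp := by
    refine le_trans ?_ hp
    exact ENNReal.div_le_div_right (Finset.sum_le_sum fun k hk => h k (Finset.mem_range.1 hk)) _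
  closed := by
    refine isClosed_le (f := fun q : ℕ → ℝ =>
      (∑ k ∈ Finset.range n, ENNReal.ofReal (q k)) / (n : ℝ≥0∞)) ?_ continuous_const
    refine (ENNReal.continuous_div_const _ (by simpa using hn.ne')).comp ?_
    exact continuous_finsetSum _ fun k _ => ENNReal.continuous_ofReal.comp (continuous_apply k)
  le p hp k hk := by
    have h : (∑ k ∈ Finset.range n, p k) ≤ ENNReal.ofReal P * n :=
      (ENNReal.div_le_iff (by simpa using hn.ne') (by simp)).1 hp
    rw [mul_comm, ENNReal.ofReal_mul' (Nat.cast_nonneg n), ENNReal.ofReal_natCast]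
    exact (Finset.single_le_sum (f := p) (fun _ _ => zero_le) (Finset.mem_range.2 hk)).trans h
  zero := by simp [AveragePower]

theorem isConstraint_symbolPower {n : ℕ} {P : ℝ} :
    IsConstraint n P (SymbolPower n P) where
  mono p p' h hp k hk := (h k hk).trans (hp k hk)
  closed := by
    simp only [SymbolPower, Set.ofPred_forall]
    exact isClosed_iInter fun k => isClosed_iInter fun _ =>
      isClosed_le (ENNReal.continuous_ofReal.comp (continuous_apply k)) continuous_const
  le p hp k hk := hp k hk
  zero k _ := zero_le

-- Compactness of the feasible set of covariances

section compactness

variable {m : ℕ} (F : Matrix (Fin m) (Fin m) ℝ) (G H : Fin m → ℝ)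

/-- The feasible sequences of pairs `(c_k, q_k)`. -/
def feasible (R : ℝ) (A : (ℕ → ℝ≥0∞) → Prop) : Set (ℕ → (Fin m → ℝ) × ℝ) :=
  {p | (∀ k, BlockNonneg (covSeq F G H p k) (p k).1 (p k).2) ∧ (∀ k, (p k).2 ≤ R) ∧
    A fun k => ENNReal.ofReal (p k).2}

variable {F G H}

theorem continuous_covSeq (k : ℕ) : Continuous fun p => covSeq F G H p k := by
  induction k with
  | zero => exact continuous_const
  | succ k ih =>
    have hc : Continuous fun p : ℕ → (Fin m → ℝ) × ℝ => (p k).1 :=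
      continuous_fst.comp (continuous_apply k)
    have hq : Continuous fun p : ℕ → (Fin m → ℝ) × ℝ => (p k).2 :=
      continuous_snd.comp (continuous_apply k)
    have hY : Continuous fun p => innovVar H (covSeq F G H p k) (p k).1 (p k).2 := by
      unfold innovVar
      fun_prop
    have hY' : Continuous fun p => (innovVar H (covSeq F G H p k) (p k).1 (p k).2)⁻¹ :=
      hY.inv₀ fun p => ne_of_gt (zero_lt_one.trans_le (one_le_innovVar _ _ _))
    have hv : Continuous fun p => F *ᵥ ((p k).1 + covSeq F G H p k *ᵥ H) + G := by fun_prop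
    simp only [covSeq, covStep]
    exact ((((continuous_const.matrix_mul ih).matrix_mul continuous_const).add
      continuous_const).sub (hY'.smul (hv.matrix_vecMulVec hv)))

theorem continuous_covY (k : ℕ) : Continuous fun p => covY F G H p k := by
  have hc : Continuous fun p : ℕ → (Fin m → ℝ) × ℝ => (p k).1 :=
    continuous_fst.comp (continuous_apply k)
  have hq : Continuous fun p : ℕ → (Fin m → ℝ) × ℝ => (p k).2 :=
    continuous_snd.comp (continuous_apply k)
  have := continuous_covSeq (F := F) (G := G) (H := H) k
  unfold covY innovVar
  fun_prop

/-- The Riccati step subtracts a nonnegative rank-one term, so the quadratic forms are dominated by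
those of the uncontrolled recursion `Σ ↦ F Σ Fᵀ + G Gᵀ`. The bound is therefore uniform over all
`p`, feasible or not. -/
theorem covSeq_bounded (k : ℕ) : ∀ w : Fin m → ℝ, ∃ B : ℝ, ∀ p,
    w ⬝ᵥ (covSeq F G H p k *ᵥ w) ≤ B := by
  induction k with
  | zero => exact fun w => ⟨0, fun p => by simp [covSeq]⟩
  | succ k ih =>
    intro w
    obtain ⟨B, hB⟩ := ih (Fᵀ *ᵥ w)
    refine ⟨B + (w ⬝ᵥ G) * (w ⬝ᵥ G), fun p => ?_⟩
    set v := F *ᵥ ((p k).1 + covSeq F G H p k *ᵥ H) + G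
    have h1 : w ⬝ᵥ ((F * covSeq F G H p k * Fᵀ) *ᵥ w) =
        (Fᵀ *ᵥ w) ⬝ᵥ (covSeq F G H p k *ᵥ (Fᵀ *ᵥ w)) := by
      rw [← mulVec_mulVec, ← mulVec_mulVec, dotProduct_mulVec, mulVec_transpose F w]
    have h2 : ∀ v : Fin m → ℝ, w ⬝ᵥ (vecMulVec v v *ᵥ w) = (w ⬝ᵥ v) * (w ⬝ᵥ v) := fun v => by
      rw [vecMulVec_mulVec]
      simp [dotProduct_comm v w]
    have h3 : 0 ≤ (innovVar H (covSeq F G H p k) (p k).1 (p k).2)⁻¹ * ((w ⬝ᵥ v) * (w ⬝ᵥ v)) :=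
      mul_nonneg (inv_nonneg.2 (zero_le_one.trans (one_le_innovVar _ _ _))) (mul_self_nonneg _)
    have h4 := hB p
    simp only [v, dotProduct_add] at h3
    simp only [covSeq, covStep, sub_mulVec, add_mulVec, smul_mulVec, dotProduct_sub,
      dotProduct_add, dotProduct_smul, h1, h2, smul_eq_mul]
    linarith

theorem isClosed_feasible {n : ℕ} {R : ℝ} {A : (ℕ → ℝ≥0∞) → Prop} (hA : IsConstraint n R A) :
    IsClosed (feasible F G H R A) := by
  have hc : ∀ k, Continuous fun p : ℕ → (Fin m → ℝ) × ℝ => (p k).1 := fun k =>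
    continuous_fst.comp (continuous_apply k)
  have hq : ∀ k, Continuous fun p : ℕ → (Fin m → ℝ) × ℝ => (p k).2 := fun k =>
    continuous_snd.comp (continuous_apply k)
  have h1 : IsClosed {p | ∀ k, BlockNonneg (covSeq F G H p k) (p k).1 (p k).2} := by
    simp only [BlockNonneg, Set.ofPred_forall]
    refine isClosed_iInter fun k => isClosed_iInter fun w => isClosed_iInter fun t =>
      isClosed_le continuous_const ?_
    have := continuous_covSeq (F := F) (G := G) (H := H) k
    have := hc k
    have := hq k
    fun_prop
  have h2 : IsClosed {p : ℕ → (Fin m → ℝ) × ℝ | ∀ k, (p k).2 ≤ R} := by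
    simp only [Set.ofPred_forall]
    exact isClosed_iInter fun k => isClosed_le (hq k) continuous_const
  exact h1.inter (h2.inter (hA.closed.preimage (continuous_pi hq)))

/-- A closed subset of a product of boxes: `q_k` lies in `[0, R]`, and the Schwarz inequality bounds
`c_k` entrywise through the diagonal of the uniformly bounded covariance. -/
theorem isCompact_feasible {n : ℕ} {R : ℝ} {A : (ℕ → ℝ≥0∞) → Prop} (hA : IsConstraint n R A) :
    IsCompact (feasible F G H R A) := by
  choose B hB using fun k w => covSeq_bounded (F := F) (G := G) (H := H) k w
  have hbox : IsCompact (Set.univ.pi fun k : ℕ =>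
      (Set.univ.pi fun i : Fin m =>
        Set.Icc (-(B k (Pi.single i 1) * R + 1)) (B k (Pi.single i 1) * R + 1)) ×ˢ Set.Icc 0 R) :=
    isCompact_univ_pi fun k => (isCompact_univ_pi fun i => isCompact_Icc).prod isCompact_Icc
  refine hbox.of_isClosed_subset (isClosed_feasible hA) ?_
  rintro p ⟨h1, h2, -⟩ k -
  refine ⟨fun i _ => ?_, (h1 k).nonneg, h2 k⟩
  have h3 := (h1 k).sq_le (Pi.single i 1)
  rw [single_one_dotProduct] at h3
  have h4 : (p k).1 i ^ 2 ≤ B k (Pi.single i 1) * R :=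
    h3.trans (mul_le_mul (hB k _ p) (h2 k) (h1 k).nonneg
      (((h1 k).quad_nonneg _).trans (hB k _ p)))
  -- The box has half-width `B R + 1` because `|c| ≤ c² + 1`.
  constructor <;> nlinarith

theorem inputPower_eq (X : ℕ → Fin m → ℝ) (V : ℕ → ℝ≥0) :
    inputPower F G H X V = fun k => ENNReal.ofReal (toCov F G H X V k).2 := rfl

/-- Some feasible `X`, `V` maximize the sum of the logarithms of the innovation variances over all
feasible sequences of pairs `(c_k, q_k)`. -/
theorem exists_optimal (F : Matrix (Fin m) (Fin m) ℝ) (G H : Fin m → ℝ) {n : ℕ} {R : ℝ}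
    (hR : 0 ≤ R) {A : (ℕ → ℝ≥0∞) → Prop} (hA : IsConstraint n R A) :
    ∃ (X : ℕ → Fin m → ℝ) (V : ℕ → ℝ≥0), A (inputPower F G H X V) ∧
      ∀ p ∈ feasible F G H R A, ∑ k ∈ Finset.range n, Real.log (covY F G H p k) ≤
        ∑ k ∈ Finset.range n, Real.log (Yseq F G H X V k) := by
  have hne : (feasible F G H R A).Nonempty := by
    -- Silence is feasible.
    refine ⟨toCov F G H (fun _ => 0) (fun _ => 0), blockNonneg_toCov _ _, fun k => ?_, ?_⟩
    · simpa [toCov] using hR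
    · convert hA.zero
      simp [toCov]
  have hcont : Continuous fun p => ∑ k ∈ Finset.range n, Real.log (covY F G H p k) :=
    continuous_finsetSum _ fun k _ => (continuous_covY k).log fun p =>
      ne_of_gt (zero_lt_one.trans_le (one_le_innovVar _ _ _))
  obtain ⟨p, hp, hmax⟩ := (isCompact_feasible hA).exists_isMaxOn hne hcont.continuousOn
  obtain ⟨X, V, hXV⟩ := exists_toCov_eq hp.1
  refine ⟨X, V, ?_, fun p' hp' => (hmax hp').trans_eq ?_⟩
  · rw [inputPower_eq, hXV]
    exact hp.2.2
  · simp only [← covY_toCov, hXV]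

/-- Feasible sequences obey `q_k ≤ R` at all times, whereas the constraint says nothing after the
horizon. Setting `X` and `V` to zero there repairs this without touching the terms `k < n`. -/
theorem sum_log_Yseq_le {n : ℕ} {R B : ℝ} (hR : 0 ≤ R) {A : (ℕ → ℝ≥0∞) → Prop}
    (hA : IsConstraint n R A)
    (hB : ∀ p ∈ feasible F G H R A, ∑ k ∈ Finset.range n, Real.log (covY F G H p k) ≤ B)
    {X : ℕ → Fin m → ℝ} {V : ℕ → ℝ≥0} (h : A (inputPower F G H X V)) :
    ∑ k ∈ Finset.range n, Real.log (Yseq F G H X V k) ≤ B := by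
  let X' : ℕ → Fin m → ℝ := fun k => if k < n then X k else 0
  let V' : ℕ → ℝ≥0 := fun k => if k < n then V k else 0
  have hX : ∀ k < n, X' k = X k := fun k hk => if_pos hk
  have hV : ∀ k < n, V' k = V k := fun k hk => if_pos hk
  have hS : ∀ k < n, Sig F G H X' V' k = Sig F G H X V k := fun k hk =>
    Sig_congr (fun j hj => hX j (hj.trans hk)) fun j hj => hV j (hj.trans hk)
  have hle : ∀ k < n, inputPower F G H X' V' k ≤ inputPower F G H X V k := fun k hk => by
    rw [inputPower, inputPower, hS k hk, hX k hk, hV k hk]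
  have hA' : A (inputPower F G H X' V') := hA.mono _ _ hle h
  refine le_of_eq_of_le (Finset.sum_congr rfl fun k hk => ?_)
    (hB (toCov F G H X' V') ⟨blockNonneg_toCov _ _, fun k => ?_, hA'⟩)
  · have hk := Finset.mem_range.1 hk
    rw [covY_toCov, Yseq, Yseq, hS k hk, hX k hk, hV k hk]
  · by_cases hk : k < n
    · exact (ENNReal.ofReal_le_ofReal_iff hR).1 (hA.le _ hA' k hk)
    · simpa [toCov, X', V', hk] using hR

end compactness

end FeedbackChannel

namespace FeedbackChannel

open Filter Topology

/-! ### Mutual information of a pair with a bounded density -/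

section density

variable {M B : Type*} [MeasurableSpace M] [MeasurableSpace B]

/-- `∫ f log f dπ - (∫ f dπ) log (∫ f dπ)` at the output `y`, whose integral over `y` is the
mutual information of a pair with density `f`. -/
noncomputable def infoDensity (π : Measure M) (f : M × B → ℝ) (y : B) : ℝ :=
  ∫ w, f (w, y) * Real.log (f (w, y)) ∂π -
    (∫ w, f (w, y) ∂π) * Real.log (∫ w, f (w, y) ∂π)

theorem abs_mul_log_le_one {x : ℝ} (h0 : 0 < x) (h1 : x ≤ 1) : |x * Real.log x| ≤ 1 := by
  rw [mul_comm]
  exact (Real.abs_log_mul_self_lt x h0 h1).le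

variable {π : Measure M} [IsProbabilityMeasure π] {lam : Measure B} [SFinite lam] {f : M × B → ℝ}

theorem integrable_section (hf : Measurable f) (h0 : ∀ z, 0 < f z) (h1 : ∀ z, f z ≤ 1) (y : B) :
    Integrable (fun w => f (w, y)) π := by
  refine Integrable.of_bound (C := 1) (hf.comp measurable_prodMk_right).aestronglyMeasurable
    (ae_of_all _ fun w => ?_)
  rw [Real.norm_eq_abs, abs_of_pos (h0 _)]
  exact h1 _

theorem integrable_section_mul_log (hf : Measurable f) (h0 : ∀ z, 0 < f z) (h1 : ∀ z, f z ≤ 1)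
    (y : B) : Integrable (fun w => f (w, y) * Real.log (f (w, y))) π := by
  have h : Measurable fun w => f (w, y) := hf.comp measurable_prodMk_right
  exact Integrable.of_bound (C := 1) (h.mul h.log).aestronglyMeasurable
    (ae_of_all _ fun w => abs_mul_log_le_one (h0 _) (h1 _))

theorem integral_section_pos (hf : Measurable f) (h0 : ∀ z, 0 < f z) (h1 : ∀ z, f z ≤ 1) (y : B) :
    0 < ∫ w, f (w, y) ∂π := by
  rw [integral_pos_iff_support_of_nonneg (fun w => (h0 _).le) (integrable_section hf h0 h1 y)]
  have : (Function.support fun w => f (w, y)) = Set.univ :=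
    Set.eq_univ_of_forall fun w => (h0 _).ne'
  simp [this]

theorem measurable_integral_section (hf : Measurable f) :
    Measurable fun y => ∫ w, f (w, y) ∂π :=
  (StronglyMeasurable.integral_prod_left' (μ := π) hf.stronglyMeasurable).measurable

theorem measurable_infoDensity (hf : Measurable f) : Measurable (infoDensity π f) :=
  (measurable_integral_section (f := fun z => f z * Real.log (f z)) (hf.mul hf.log)).sub
    ((measurable_integral_section hf).mul (measurable_integral_section hf).log)

theorem map_snd_withDensity (hf : Measurable f) (h0 : ∀ z, 0 < f z) (h1 : ∀ z, f z ≤ 1) :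
    ((π.prod lam).withDensity fun z => ENNReal.ofReal (f z)).map Prod.snd =
      lam.withDensity fun y => ENNReal.ofReal (∫ w, f (w, y) ∂π) := by
  ext s hs
  rw [Measure.map_apply measurable_snd hs, withDensity_apply _ (measurable_snd hs),
    withDensity_apply _ hs, ← lintegral_indicator (measurable_snd hs),
    ← lintegral_indicator hs, lintegral_prod_symm _
      ((hf.ennreal_ofReal.indicator (measurable_snd hs)).aemeasurable)]
  refine lintegral_congr fun y => ?_
  by_cases hy : y ∈ s
  · simp only [Set.indicator, Set.mem_preimage, hy, if_true]
    rw [ofReal_integral_eq_lintegral_ofReal (integrable_section hf h0 h1 y)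
      (ae_of_all _ fun w => (h0 _).le)]
  · simp [Set.indicator, hy]

/-- The mutual information of a pair whose law has a density with values in `(0, 1]` with respect
to the product of the law of the first component and a reference measure. -/
theorem klDiv_prod_map_snd (hf : Measurable f) (h0 : ∀ z, 0 < f z) (h1 : ∀ z, f z ≤ 1)
    {μ : Measure (M × B)} [IsProbabilityMeasure μ]
    (hμ : μ = (π.prod lam).withDensity fun z => ENNReal.ofReal (f z)) :
    klDiv μ (π.prod (μ.map Prod.snd)) = ∫⁻ y, ENNReal.ofReal (infoDensity π f y) ∂lam := by
  set g : B → ℝ := fun y => ∫ w, f (w, y) ∂π with hg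
  have hgm : Measurable g := measurable_integral_section hf
  have hg0 : ∀ y, 0 < g y := integral_section_pos hf h0 h1
  have hsnd : μ.map Prod.snd = lam.withDensity fun y => ENNReal.ofReal (g y) := by
    rw [hμ, map_snd_withDensity hf h0 h1]
  have hprobsnd : IsProbabilityMeasure (μ.map Prod.snd) :=
    Measure.isProbabilityMeasure_map measurable_snd.aemeasurable
  have hν : π.prod (μ.map Prod.snd) =
      (π.prod lam).withDensity fun z => ENNReal.ofReal (g z.2) := by
    have : SFinite (lam.withDensity fun y => ENNReal.ofReal (g y)) := by
      rw [← hsnd]; infer_instance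
    rw [hsnd, prod_withDensity_right hgm.ennreal_ofReal]
  have hgm2 : Measurable fun z : M × B => g z.2 := hgm.comp measurable_snd
  have hrm : Measurable fun z : M × B => f z / g z.2 := hf.div hgm2
  have hμν : μ = (π.prod (μ.map Prod.snd)).withDensity fun z =>
      ENNReal.ofReal (f z / g z.2) := by
    rw [hν, ← withDensity_mul _ hgm2.ennreal_ofReal hrm.ennreal_ofReal]
    conv_lhs => rw [hμ]
    congr 1
    ext z
    rw [Pi.mul_apply, ← ENNReal.ofReal_mul (hg0 _).le, mul_div_cancel₀ _ (hg0 _).ne']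
  have hac : μ ≪ π.prod (μ.map Prod.snd) := by
    conv_lhs => rw [hμν]
    exact withDensity_absolutelyContinuous _ _
  have hrn : μ.rnDeriv (π.prod (μ.map Prod.snd)) =ᵐ[π.prod (μ.map Prod.snd)]
      fun z => ENNReal.ofReal (f z / g z.2) := by
    have := Measure.rnDeriv_withDensity (π.prod (μ.map Prod.snd)) hrm.ennreal_ofReal
    rwa [← hμν] at this
  -- The form of the divergence with the nonnegative integrand `klFun` allows Tonelli without
  -- knowing that the divergence is finite.
  rw [klDiv_eq_lintegral_klFun_of_ac hac]
  have hcongr : ∫⁻ z, ENNReal.ofReal (klFun (μ.rnDeriv (π.prod (μ.map Prod.snd)) z).toReal)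
      ∂(π.prod (μ.map Prod.snd)) =
      ∫⁻ z, ENNReal.ofReal (klFun (f z / g z.2)) ∂(π.prod (μ.map Prod.snd)) := by
    refine lintegral_congr_ae (hrn.mono fun z hz => ?_)
    simp only [hz]
    rw [ENNReal.toReal_ofReal (div_nonneg (h0 _).le (hg0 _).le)]
  have hkm : Measurable fun z : M × B => ENNReal.ofReal (klFun (f z / g z.2)) :=
    (measurable_klFun.comp hrm).ennreal_ofReal
  rw [hcongr, hν, lintegral_withDensity_eq_lintegral_mul _ hgm2.ennreal_ofReal hkm,
    lintegral_prod_symm _ (hgm2.ennreal_ofReal.mul hkm).aemeasurable]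
  refine lintegral_congr fun y => ?_
  have hi1 := integrable_section (π := π) hf h0 h1 y
  have hi2 := integrable_section_mul_log (π := π) hf h0 h1 y
  -- The correction `g y - f (w, y)` integrates to zero over `w`, since `g y` is the mean of `f (·,
  -- y)`. What is left is the information density.
  have hpt : ∀ w, ENNReal.ofReal (g y) * ENNReal.ofReal (klFun (f (w, y) / g y)) =
      ENNReal.ofReal (f (w, y) * Real.log (f (w, y)) - f (w, y) * Real.log (g y)
        + (g y - f (w, y))) := fun w => by
    rw [← ENNReal.ofReal_mul (hg0 y).le, klFun_apply, Real.log_div (h0 _).ne' (hg0 y).ne']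
    congr 1
    have := (hg0 y).ne'
    field_simp
    ring
  have hnn : 0 ≤ᵐ[π] fun w => f (w, y) * Real.log (f (w, y)) - f (w, y) * Real.log (g y)
        + (g y - f (w, y)) := ae_of_all _ fun w => by
    have h := mul_nonneg (hg0 y).le (klFun_nonneg (div_nonneg (h0 (w, y)).le (hg0 y).le))
    rw [klFun_apply, Real.log_div (h0 _).ne' (hg0 y).ne'] at h
    have := (hg0 y).ne'
    refine h.trans_eq ?_
    field_simp
    ring
  simp only [Pi.mul_apply, hpt]
  rw [← ofReal_integral_eq_lintegral_ofReal _ hnn]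
  · congr 1
    have hi3 : Integrable (fun w => f (w, y) * Real.log (g y)) π := hi1.mul_const _
    have hi4 : Integrable (fun w => g y - f (w, y)) π := (integrable_const _).sub hi1
    have hi5 : Integrable (fun w => f (w, y) * Real.log (f (w, y)) - f (w, y) * Real.log (g y)) π :=
      hi2.sub hi3
    rw [integral_add hi5 hi4, integral_sub hi2 hi3, integral_sub (integrable_const _) hi1,
      integral_mul_const]
    simp [infoDensity, hg]
  · exact (hi2.sub (hi1.mul_const _)).add ((integrable_const _).sub hi1)

variable {q : B → ℝ}

/-- The quantity is `b * klFun (a / b)`. -/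
theorem mul_log_div_sub_add_nonneg {a b : ℝ} (ha : 0 < a) (hb : 0 < b) :
    0 ≤ a * Real.log (a / b) + (b - a) := by
  have h := mul_nonneg hb.le (klFun_nonneg (div_nonneg ha.le hb.le))
  rw [klFun_apply] at h
  refine h.trans_eq ?_
  field_simp
  ring

theorem lintegral_section_divergence (hf : Measurable f) (h0 : ∀ z, 0 < f z) (h1 : ∀ z, f z ≤ 1)
    (hq0 : ∀ y, 0 < q y) (y : B) :
    ∫⁻ w, ENNReal.ofReal (f (w, y) * Real.log (f (w, y) / q y) + (q y - f (w, y))) ∂π =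
      ENNReal.ofReal (∫ w, f (w, y) * Real.log (f (w, y)) ∂π -
        (∫ w, f (w, y) ∂π) * Real.log (q y) + (q y - ∫ w, f (w, y) ∂π)) := by
  have hi1 := integrable_section (π := π) hf h0 h1 y
  have hi2 := integrable_section_mul_log (π := π) hf h0 h1 y
  have hi3 : Integrable (fun w => f (w, y) * Real.log (q y)) π := hi1.mul_const _
  have hi4 : Integrable (fun w => q y - f (w, y)) π := (integrable_const _).sub hi1
  have hi5 : Integrable (fun w => f (w, y) * Real.log (f (w, y)) - f (w, y) * Real.log (q y)) π :=
    hi2.sub hi3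
  have hfun : (fun w => f (w, y) * Real.log (f (w, y) / q y) + (q y - f (w, y))) =
      fun w => f (w, y) * Real.log (f (w, y)) - f (w, y) * Real.log (q y) + (q y - f (w, y)) := by
    ext w
    rw [Real.log_div (h0 _).ne' (hq0 y).ne']
    ring
  rw [← ofReal_integral_eq_lintegral_ofReal]
  · rw [hfun, integral_add hi5 hi4, integral_sub hi2 hi3, integral_sub (integrable_const _) hi1,
      integral_mul_const]
    simp
  · rw [hfun]
    exact hi5.add hi4
  · exact ae_of_all _ fun w => mul_log_div_sub_add_nonneg (h0 _) (hq0 y)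

/-- For fixed `y`, passing from the true output density `g` to `q` changes the section integral by
`g log (g / q) + q - g ≥ 0`. This is the variational bound of information by the divergence from any
product law; it needs no normalization of `q`. -/
theorem lintegral_infoDensity_le (hf : Measurable f) (h0 : ∀ z, 0 < f z) (h1 : ∀ z, f z ≤ 1)
    (hq : Measurable q) (hq0 : ∀ y, 0 < q y) :
    ∫⁻ y, ENNReal.ofReal (infoDensity π f y) ∂lam ≤
      ∫⁻ z, ENNReal.ofReal (f z * Real.log (f z / q z.2) + (q z.2 - f z)) ∂(π.prod lam) := by
  have hq2 : Measurable fun z : M × B => q z.2 := hq.comp measurable_snd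
  rw [lintegral_prod_symm _ (by fun_prop)]
  refine lintegral_mono fun y => ?_
  simp only
  rw [lintegral_section_divergence hf h0 h1 hq0]
  refine ENNReal.ofReal_le_ofReal ?_
  have hg := integral_section_pos (π := π) hf h0 h1 y
  have := mul_log_div_sub_add_nonneg hg (hq0 y)
  rw [Real.log_div hg.ne' (hq0 y).ne'] at this
  unfold infoDensity
  linarith

theorem lintegral_infoDensity_eq (hf : Measurable f) (h0 : ∀ z, 0 < f z) (h1 : ∀ z, f z ≤ 1)
    (hq : Measurable q) (hq0 : ∀ y, 0 < q y) (hqg : ∀ᵐ y ∂lam, ∫ w, f (w, y) ∂π = q y) :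
    ∫⁻ y, ENNReal.ofReal (infoDensity π f y) ∂lam =
      ∫⁻ z, ENNReal.ofReal (f z * Real.log (f z / q z.2) + (q z.2 - f z)) ∂(π.prod lam) := by
  have hq2 : Measurable fun z : M × B => q z.2 := hq.comp measurable_snd
  rw [lintegral_prod_symm _ (by fun_prop)]
  refine lintegral_congr_ae (hqg.mono fun y hy => ?_)
  simp only
  rw [lintegral_section_divergence hf h0 h1 hq0, infoDensity, hy]
  simp

/-- The term `q - f` keeps the integrand nonnegative and has integral zero, because both densities
have total mass one. -/
theorem lintegral_divergence_eq (hf : Measurable f) (h0 : ∀ z, 0 < f z)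
    (hq : Measurable q) (hq0 : ∀ y, 0 < q y) (hq1 : ∫⁻ y, ENNReal.ofReal (q y) ∂lam = 1)
    {μ : Measure (M × B)} [IsProbabilityMeasure μ]
    (hμ : μ = (π.prod lam).withDensity fun z => ENNReal.ofReal (f z))
    (hint : Integrable (fun z => Real.log (f z / q z.2)) μ) :
    ∫⁻ z, ENNReal.ofReal (f z * Real.log (f z / q z.2) + (q z.2 - f z)) ∂(π.prod lam) =
      ENNReal.ofReal (∫ z, Real.log (f z / q z.2) ∂μ) := by
  have hq2 : Measurable fun z : M × B => q z.2 := hq.comp measurable_snd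
  have hfi : ∫⁻ z, ENNReal.ofReal (f z) ∂(π.prod lam) = 1 := by
    rw [← setLIntegral_univ, ← withDensity_apply _ MeasurableSet.univ, ← hμ, measure_univ]
  have hqi : ∫⁻ z, ENNReal.ofReal (q z.2) ∂(π.prod lam) = 1 := by
    rw [lintegral_prod _ (by fun_prop)]
    simp [hq1]
  have hf1 : Integrable f (π.prod lam) :=
    (lintegral_ofReal_ne_top_iff_integrable hf.aestronglyMeasurable
      (ae_of_all _ fun z => (h0 z).le)).1 (by simp [hfi])
  have hq1 : Integrable (fun z : M × B => q z.2) (π.prod lam) :=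
    (lintegral_ofReal_ne_top_iff_integrable hq2.aestronglyMeasurable
      (ae_of_all _ fun z => (hq0 z.2).le)).1 (by simp [hqi])
  have hd : (fun z => ENNReal.ofReal (f z)) = fun z => ((f z).toNNReal : ℝ≥0∞) := rfl
  have hi : Integrable (fun z => f z * Real.log (f z / q z.2)) (π.prod lam) := by
    rw [hμ, hd, integrable_withDensity_iff_integrable_smul hf.real_toNNReal] at hint
    refine hint.congr (ae_of_all _ fun z => ?_)
    simp only [NNReal.smul_def, Real.coe_toNNReal _ (h0 z).le, smul_eq_mul]
  have he : ∫ z, Real.log (f z / q z.2) ∂μ = ∫ z, f z * Real.log (f z / q z.2) ∂(π.prod lam) := by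
    rw [hμ, hd, integral_withDensity_eq_integral_smul hf.real_toNNReal]
    refine integral_congr_ae (ae_of_all _ fun z => ?_)
    simp only [NNReal.smul_def, Real.coe_toNNReal _ (h0 z).le, smul_eq_mul]
  have hF : ∫ z, f z ∂(π.prod lam) = 1 := by
    rw [integral_eq_lintegral_of_nonneg_ae (ae_of_all _ fun z => (h0 z).le)
      hf.aestronglyMeasurable, hfi, ENNReal.toReal_one]
  have hQ : ∫ z, q z.2 ∂(π.prod lam) = 1 := by
    rw [integral_eq_lintegral_of_nonneg_ae (f := fun z : M × B => q z.2)
      (ae_of_all _ fun z => (hq0 z.2).le) hq2.aestronglyMeasurable, hqi, ENNReal.toReal_one]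
  have h2 : Integrable (fun z : M × B => q z.2 - f z) (π.prod lam) := hq1.sub hf1
  have h3 : Integrable (fun z : M × B => f z * Real.log (f z / q z.2) + (q z.2 - f z))
    (π.prod lam) := hi.add h2
  rw [← ofReal_integral_eq_lintegral_ofReal h3
    (ae_of_all _ fun z => mul_log_div_sub_add_nonneg (h0 z) (hq0 z.2))]
  congr 1
  rw [integral_add hi h2, integral_sub hq1 hf1, he, hF, hQ]
  ring

omit [SFinite lam] in
/-- Lower semicontinuity: the information is at most the limit inferior of the informations along
a sequence of message laws for which the section integrals converge. -/
theorem lintegral_infoDensity_le_liminf {M' : ℕ → Type*} [∀ j, MeasurableSpace (M' j)]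
    {π' : ∀ j, Measure (M' j)} [∀ j, IsProbabilityMeasure (π' j)] {f' : ∀ j, M' j × B → ℝ}
    (hf' : ∀ j, Measurable (f' j)) (hf : Measurable f) (h0 : ∀ z, 0 < f z) (h1 : ∀ z, f z ≤ 1)
    (hlim : ∀ᵐ y ∂lam, Tendsto (fun j => ∫ w, f' j (w, y) ∂(π' j)) atTop (𝓝 (∫ w, f (w, y) ∂π)))
    (hlim' : ∀ᵐ y ∂lam, Tendsto (fun j => ∫ w, f' j (w, y) * Real.log (f' j (w, y)) ∂(π' j)) atTop
      (𝓝 (∫ w, f (w, y) * Real.log (f (w, y)) ∂π))) :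
    ∫⁻ y, ENNReal.ofReal (infoDensity π f y) ∂lam ≤
      liminf (fun j => ∫⁻ y, ENNReal.ofReal (infoDensity (π' j) (f' j) y) ∂lam) atTop := by
  -- Fatou's lemma, which needs no dominating function over the outputs. Pointwise convergence of
  -- the information density uses the continuity of `log` at the positive limit.
  refine le_trans (lintegral_mono_ae ?_)
    (lintegral_liminf_le fun j => (measurable_infoDensity (hf' j)).ennreal_ofReal)
  filter_upwards [hlim, hlim'] with y hy hy'
  refine le_of_eq (Tendsto.liminf_eq ?_).symm
  refine (ENNReal.continuous_ofReal.tendsto _).comp (hy'.sub (hy.mul (hy.log ?_)))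
  exact (integral_section_pos hf h0 h1 y).ne'

end density

end FeedbackChannel

namespace FeedbackChannel

open Filter Topology

/-! ### Causal changes of variables -/

section causal

variable {M : Type*} [MeasurableSpace M]

/-- The innovations `y_k - h_k (w, (y_i)_{i<k})` of a sequence `y`. -/
def innov (h : ∀ k : ℕ, M × (Fin k → ℝ) → ℝ) (n : ℕ) (z : M × (Fin n → ℝ)) (k : Fin n) : ℝ :=
  z.2 k - h k (z.1, fun i : Fin k => z.2 (Fin.castLE k.2.le i))

variable {h : ∀ k : ℕ, M × (Fin k → ℝ) → ℝ}

theorem measurable_innov (hh : ∀ k, Measurable (h k)) (n : ℕ) : Measurable (innov h n) := by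
  refine measurable_pi_lambda _ fun k => ?_
  have h1 : Measurable fun z : M × (Fin n → ℝ) =>
      (z.1, fun i : Fin k => z.2 (Fin.castLE k.2.le i)) := by fun_prop
  have h2 : Measurable fun z : M × (Fin n → ℝ) => z.2 k := by fun_prop
  exact h2.sub ((hh k).comp h1)

/-- A triangular map with unit diagonal: the last coordinate is translated by a function of the
message and the earlier coordinates, and Lebesgue measure is translation invariant. The induction
adds one such skew product at a time. -/
theorem measurePreserving_innov {π : Measure M} [SFinite π] (hh : ∀ k, Measurable (h k)) (n : ℕ) :
    MeasurePreserving (fun z : M × (Fin n → ℝ) => (z.1, innov h n z))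
      (π.prod volume) (π.prod volume) := by
  induction n with
  | zero =>
    convert MeasurePreserving.id (π.prod (volume : Measure (Fin 0 → ℝ))) using 2
    exact Prod.ext rfl (Subsingleton.elim _ _)
  | succ n ih =>
    let e : (Fin (n + 1) → ℝ) ≃ᵐ (Fin n → ℝ) × ℝ :=
      (MeasurableEquiv.piFinSuccAbove (fun _ => ℝ) (Fin.last n)).trans MeasurableEquiv.prodComm
    have he : MeasurePreserving e volume (volume.prod volume) :=
      Measure.measurePreserving_swap.comp
        (volume_preserving_piFinSuccAbove (fun _ => ℝ) (Fin.last n))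
    let E : M × (Fin (n + 1) → ℝ) ≃ᵐ (M × (Fin n → ℝ)) × ℝ :=
      ((MeasurableEquiv.refl M).prodCongr e).trans MeasurableEquiv.prodAssoc.symm
    have hE : MeasurePreserving E (π.prod volume) ((π.prod volume).prod volume) :=
      (measurePreserving_prodAssoc π volume volume).symm.comp ((MeasurePreserving.id π).prod he)
    have hS : MeasurePreserving
        (fun p : (M × (Fin n → ℝ)) × ℝ => ((p.1.1, innov h n p.1), p.2 - h n p.1))
        ((π.prod volume).prod volume) ((π.prod volume).prod volume) :=
      ih.skew_product (g := fun z a => a - h n z)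
        (measurable_snd.sub ((hh n).comp measurable_fst))
        (ae_of_all _ fun z => (measurePreserving_sub_right volume (h n z)).map_eq)
    have hcomp := (hE.symm E).comp (hS.comp hE)
    convert hcomp using 1
    ext1 z
    refine (E.symm_apply_eq.2 ?_).symm
    refine Prod.ext (Prod.ext rfl ?_) ?_
    · ext i
      simp [E, e, innov, MeasurableEquiv.prodAssoc, MeasurableEquiv.prodCongr,
        MeasurableEquiv.prodComm, MeasurableEquiv.piFinSuccAbove]
      rfl
    · simp [E, e, innov, MeasurableEquiv.prodAssoc, MeasurableEquiv.prodCongr,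
        MeasurableEquiv.prodComm, MeasurableEquiv.piFinSuccAbove]
      rfl

/-- The outputs are recovered one after the other, adding to each innovation the prediction computed
from the outputs already found. -/
theorem exists_leftInverse_innov (hh : ∀ k, Measurable (h k)) (n : ℕ) :
    ∃ S : M × (Fin n → ℝ) → Fin n → ℝ, Measurable S ∧
      ∀ (w : M) (y : Fin n → ℝ), S (w, innov h n (w, y)) = y := by
  induction n with
  | zero => exact ⟨fun _ => 0, measurable_const, fun w y => Subsingleton.elim _ _⟩
  | succ n ih =>
    obtain ⟨S, hS, hSi⟩ := ih
    have h1 : Measurable fun z : M × (Fin (n + 1) → ℝ) =>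
        (z.1, S (z.1, fun i : Fin n => z.2 i.castSucc)) := by fun_prop
    have h2 : Measurable fun z : M × (Fin (n + 1) → ℝ) =>
        z.2 (Fin.last n) + h n (z.1, S (z.1, fun i : Fin n => z.2 i.castSucc)) :=
      Measurable.add (by fun_prop) ((hh n).comp h1)
    refine ⟨fun z => Fin.snoc (α := fun _ => ℝ) (S (z.1, fun i : Fin n => z.2 i.castSucc))
      (z.2 (Fin.last n) + h n (z.1, S (z.1, fun i : Fin n => z.2 i.castSucc))), ?_, ?_⟩
    · refine measurable_pi_lambda _ fun i => ?_
      refine Fin.lastCases ?_ (fun i => ?_) i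
      · simpa using h2
      · simp only [Fin.snoc_castSucc]
        exact (measurable_pi_apply i).comp (hS.comp (by fun_prop))
    · intro w y
      have h3 : S (w, fun i : Fin n => innov h (n + 1) (w, y) i.castSucc) =
          fun i : Fin n => y i.castSucc := by
        rw [← hSi w fun i : Fin n => y i.castSucc]
        rfl
      ext i
      refine Fin.lastCases ?_ (fun i => ?_) i
      · simp only [Fin.snoc_last, h3]
        exact sub_add_cancel _ _
      · simp only [Fin.snoc_castSucc, h3]

/-- A law is determined by the law of the innovations. -/
theorem eq_withDensity_of_map_innov {π : Measure M} [SFinite π] (hh : ∀ k, Measurable (h k))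
    {n : ℕ} {μ : Measure (M × (Fin n → ℝ))} {g : M × (Fin n → ℝ) → ℝ≥0∞} (hg : Measurable g)
    (hμ : μ.map (fun z => (z.1, innov h n z)) = (π.prod volume).withDensity g) :
    μ = (π.prod volume).withDensity fun z => g (z.1, innov h n z) := by
  obtain ⟨S, hS, hSi⟩ := exists_leftInverse_innov hh n
  have hR : Measurable fun z : M × (Fin n → ℝ) => (z.1, innov h n z) :=
    measurable_fst.prodMk (measurable_innov hh n)
  have hS' : Measurable fun z : M × (Fin n → ℝ) => (z.1, S z) := measurable_fst.prodMk hS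
  have hinv : ∀ ν : Measure (M × (Fin n → ℝ)),
      (ν.map fun z => (z.1, innov h n z)).map (fun z => (z.1, S z)) = ν := fun ν => by
    rw [Measure.map_map hS' hR]
    convert Measure.map_id
    ext1 z
    exact Prod.ext rfl (hSi z.1 z.2)
  -- Both laws are images of their innovation laws under the decoding map, so it suffices to compare
  -- the innovation laws.
  rw [← hinv μ, ← hinv ((π.prod volume).withDensity _), hμ]
  congr 1
  have hmp := measurePreserving_innov (π := π) hh n
  ext s hs
  rw [Measure.map_apply hR hs, withDensity_apply _ hs, withDensity_apply _ (hR hs)]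
  exact (hmp.setLIntegral_comp_preimage hs hg).symm

end causal

-- Densities of independent centered Gaussians

section gaussianDensity

/-- The density of independent centered Gaussians with variances `D`. -/
noncomputable def gaussDensity {n : ℕ} (D : Fin n → ℝ≥0) (u : Fin n → ℝ) : ℝ :=
  ∏ k, gaussianPDFReal 0 (D k) (u k)

variable {n : ℕ} {D : Fin n → ℝ≥0}

theorem measurable_gaussDensity : Measurable (gaussDensity D) :=
  Finset.measurable_prod _ fun k _ => (measurable_gaussianPDFReal 0 (D k)).comp (measurable_pi_apply k)

theorem gaussDensity_pos (hD : ∀ k, D k ≠ 0) (u : Fin n → ℝ) : 0 < gaussDensity D u :=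
  Finset.prod_pos fun k _ => gaussianPDFReal_pos 0 (D k) (u k) (hD k)

theorem pi_gaussianReal_eq_withDensity (hD : ∀ k, D k ≠ 0) :
    Measure.pi (fun k => gaussianReal 0 (D k)) =
      volume.withDensity fun u => ENNReal.ofReal (gaussDensity D u) := by
  refine Measure.pi_eq fun s hs => ?_
  rw [withDensity_apply _ (MeasurableSet.univ_pi hs), volume_pi, Measure.restrict_pi_pi]
  have hi : ∀ k, Integrable (gaussianPDFReal 0 (D k)) (volume.restrict (s k)) := fun k =>
    (integrable_gaussianPDFReal 0 (D k)).restrict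
  have hi' : Integrable (gaussDensity D) (Measure.pi fun k => volume.restrict (s k)) :=
    Integrable.fintype_prod hi
  rw [← ofReal_integral_eq_lintegral_ofReal hi' (ae_of_all _ fun u => (gaussDensity_pos hD u).le)]
  have h2 := integral_fintype_prod_eq_prod (𝕜 := ℝ) (fun k => gaussianPDFReal 0 (D k))
    (μ := fun k => volume.restrict (s k))
  have h3 : ∫ u, gaussDensity D u ∂(Measure.pi fun k => volume.restrict (s k)) =
    ∏ k, ∫ x, gaussianPDFReal 0 (D k) x ∂(volume.restrict (s k)) := h2
  rw [h3, ENNReal.ofReal_prod_of_nonneg fun k _ =>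
    integral_nonneg fun x => gaussianPDFReal_nonneg 0 (D k) x]
  exact Finset.prod_congr rfl fun k _ => (gaussianReal_apply_eq_integral 0 (hD k) (s k)).symm

theorem log_gaussDensity (hD : ∀ k, D k ≠ 0) (u : Fin n → ℝ) :
    Real.log (gaussDensity D u) =
      ∑ k, (-(1 / 2) * Real.log (2 * Real.pi) - 1 / 2 * Real.log (D k)
        - u k ^ 2 / (2 * D k)) := by
  rw [gaussDensity, Real.log_prod fun k _ => (gaussianPDFReal_pos 0 (D k) (u k) (hD k)).ne']
  refine Finset.sum_congr rfl fun k _ => ?_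
  have hDk : 0 < (D k : ℝ) := NNReal.coe_pos.2 (pos_iff_ne_zero.2 (hD k))
  have hpi : 0 < 2 * Real.pi := by positivity
  rw [gaussianPDFReal, Real.log_mul (by positivity) (Real.exp_ne_zero _), Real.log_exp,
    Real.log_inv, Real.log_sqrt (by positivity), Real.log_mul hpi.ne' hDk.ne']
  simp only [sub_zero]
  ring

/-- Unit variance suffices because `2π ≥ 1`. This bound gives `|f log f| ≤ 1` and so the
integrability in the message of all section functions. -/
theorem gaussDensity_one_le_one (u : Fin n → ℝ) : gaussDensity (fun _ => 1) u ≤ 1 := by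
  refine Finset.prod_le_one (fun k _ => gaussianPDFReal_nonneg _ _ _) fun k _ => ?_
  rw [gaussianPDFReal]
  have h1 : (√(2 * Real.pi * ((1 : ℝ≥0) : ℝ)))⁻¹ ≤ 1 := by
    refine inv_le_one_of_one_le₀ (Real.one_le_sqrt.2 ?_)
    have := Real.pi_gt_three
    simp only [NNReal.coe_one]
    linarith
  have h2 : Real.exp (-(u k - 0) ^ 2 / (2 * ((1 : ℝ≥0) : ℝ))) ≤ 1 := by
    refine Real.exp_le_one_iff.2 ?_
    have := sq_nonneg (u k - 0)
    simp only [NNReal.coe_one]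
    linarith
  exact mul_le_one₀ h1 (Real.exp_pos _).le h2

end gaussianDensity

end FeedbackChannel

namespace FeedbackChannel

open Filter Topology

/-! ### The channel as a causal change of variables -/

instance isProbabilityMeasure_whiteNoise : IsProbabilityMeasure whiteNoise := by
  unfold whiteNoise
  infer_instance

instance isProbabilityMeasure_jointLaw {M : Type} [MeasurableSpace M] (π : Measure M)
    [IsProbabilityMeasure π] : IsProbabilityMeasure (jointLaw π) := by
  unfold jointLaw
  infer_instance

section decode

variable {m : ℕ} {F : Matrix (Fin m) (Fin m) ℝ} {G H : Fin m → ℝ}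

theorem noiseState_congr {u u' : ℕ → ℝ} {k : ℕ} (h : ∀ j < k, u j = u' j) :
    noiseState F G u k = noiseState F G u' k := by
  induction k with
  | zero => rfl
  | succ k ih =>
    rw [noiseState, noiseState, ih fun j hj => h j (hj.trans k.lt_succ_self), h k k.lt_succ_self]

theorem measurable_noiseState {α : Type*} [MeasurableSpace α] {u : α → ℕ → ℝ} {k : ℕ}
    (hu : ∀ j < k, Measurable fun a => u a j) : Measurable fun a => noiseState F G (u a) k := by
  induction k with
  | zero => exact measurable_const
  | succ k ih =>
    have h1 := ih fun j hj => hu j (hj.trans k.lt_succ_self)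
    have h2 := hu k k.lt_succ_self
    have h3 : Measurable fun a => F *ᵥ noiseState F G (u a) k :=
      (Continuous.measurable (by fun_prop : Continuous fun s : Fin m → ℝ => F *ᵥ s)).comp h1
    exact h3.add (h2.smul_const G)

theorem continuous_noiseState {α : Type*} [TopologicalSpace α] {u : α → ℕ → ℝ} {k : ℕ}
    (hu : ∀ j < k, Continuous fun a => u a j) : Continuous fun a => noiseState F G (u a) k := by
  induction k with
  | zero => exact continuous_const
  | succ k ih =>
    have h1 := ih fun j hj => hu j (hj.trans k.lt_succ_self)
    have h2 := hu k k.lt_succ_self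
    simp only [noiseState]
    fun_prop

variable {M : Type} [MeasurableSpace M] (e : Encoder M)

/-- The transmitted symbols, computed from the message and the outputs. -/
def decodedInput (w : M) (y : ℕ → ℝ) (k : ℕ) : ℝ :=
  e.f k (w, fun i : Fin k => decodedInput w y i, fun i : Fin k => y i)
termination_by k
decreasing_by exact i.2

theorem decodedInput_congr (w : M) {y y' : ℕ → ℝ} {k : ℕ} (h : ∀ j < k, y j = y' j) :
    decodedInput e w y k = decodedInput e w y' k := by
  induction k using Nat.strong_induction_on with
  | _ k ih =>
    rw [decodedInput, decodedInput]
    congr 3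
    · ext i
      exact ih i i.2 fun j hj => h j (hj.trans i.2)
    · ext i
      exact h i i.2

theorem measurable_decodedInput {α : Type*} [MeasurableSpace α] {w : α → M} {y : α → ℕ → ℝ}
    (hw : Measurable w) {k : ℕ} (hy : ∀ j < k, Measurable fun a => y a j) :
    Measurable fun a => decodedInput e (w a) (y a) k := by
  induction k using Nat.strong_induction_on with
  | _ k ih =>
    simp only [decodedInput.eq_def e _ _ k]
    refine (e.measurable_f k).comp (hw.prodMk (Measurable.prodMk ?_ ?_))
    · exact measurable_pi_lambda _ fun i : Fin k => ih i i.2 fun j hj => hy j (hj.trans i.2)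
    · exact measurable_pi_lambda _ fun i : Fin k => hy i i.2

theorem continuous_decodedInput [TopologicalSpace M] (he : ∀ k, Continuous (e.f k))
    (y : ℕ → ℝ) (k : ℕ) : Continuous fun w => decodedInput e w y k := by
  induction k using Nat.strong_induction_on with
  | _ k ih =>
    simp only [decodedInput.eq_def e _ _ k]
    exact (he k).comp (continuous_id.prodMk
      ((continuous_pi fun i : Fin k => ih i i.2).prodMk continuous_const))

variable (F G H)

theorem sent_eq (k : ℕ) (ω : M × (ℕ → ℝ)) : sent F G H e k ω =
    e.f k (ω.1, fun i : Fin k => sent F G H e i ω, fun i : Fin k => received F G H e i ω) := by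
  unfold received sent
  rw [Encoder.input]

theorem decodedInput_received (k : ℕ) (ω : M × (ℕ → ℝ)) :
    decodedInput e ω.1 (fun j => received F G H e j ω) k = sent F G H e k ω := by
  induction k using Nat.strong_induction_on with
  | _ k ih =>
    rw [decodedInput, sent_eq]
    congr 3
    ext i
    exact ih i i.2

/-- The noise filter is inverted by `u_k = z_k - H s_k`, which turns the state equation into
`s_{k+1} = (F - G H) s_k + G z_k` with `z = y - x`. -/
theorem noiseState_received (k : ℕ) (ω : M × (ℕ → ℝ)) :
    noiseState (F - vecMulVec G H) G
      (fun j => received F G H e j ω - decodedInput e ω.1 (fun j => received F G H e j ω) j) k =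
      noiseState F G ω.2 k := by
  induction k with
  | zero => rfl
  | succ k ih =>
    rw [noiseState, noiseState, ih, decodedInput_received, received, noise, sub_mulVec,
      vecMulVec_mulVec, op_smul_eq_smul, add_sub_cancel_left, add_smul]
    abel

/-- Extension of a finite sequence by zero. -/
def extendZero {k : ℕ} (y : Fin k → ℝ) (j : ℕ) : ℝ := if h : j < k then y ⟨j, h⟩ else 0

theorem measurable_extendZero {k : ℕ} (j : ℕ) :
    Measurable fun y : Fin k → ℝ => extendZero y j := by
  unfold extendZero
  split_ifs
  · exact measurable_pi_apply _
  · exact measurable_const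

/-- The part `x_k + H s_k` of the output `y_k`, computed from the message and the past outputs. -/
def channelShift (k : ℕ) (z : M × (Fin k → ℝ)) : ℝ :=
  decodedInput e z.1 (extendZero z.2) k + H ⬝ᵥ noiseState (F - vecMulVec G H) G
    (fun j => extendZero z.2 j - decodedInput e z.1 (extendZero z.2) j) k

theorem measurable_channelShift (k : ℕ) : Measurable (channelShift F G H e k) := by
  have h1 : ∀ j, Measurable fun z : M × (Fin k → ℝ) => extendZero z.2 j := fun j =>
    (measurable_extendZero j).comp measurable_snd
  have h2 : ∀ j, Measurable fun z : M × (Fin k → ℝ) => decodedInput e z.1 (extendZero z.2) j :=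
    fun j => measurable_decodedInput e measurable_fst fun j _ => h1 j
  have h3 := measurable_noiseState (F := F - vecMulVec G H) (G := G) (k := k)
    fun j _ => (h1 j).sub (h2 j)
  refine (h2 k).add ?_
  exact (Continuous.measurable (by fun_prop : Continuous fun s : Fin m → ℝ => H ⬝ᵥ s)).comp h3

theorem continuous_channelShift [TopologicalSpace M] (he : ∀ k, Continuous (e.f k)) (k : ℕ)
    (y : Fin k → ℝ) : Continuous fun w => channelShift F G H e k (w, y) := by
  have h2 := continuous_decodedInput e he (extendZero y)
  have h3 := continuous_noiseState (F := F - vecMulVec G H) (G := G) (k := k)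
    (u := fun w j => extendZero y j - decodedInput e w (extendZero y) j)
    fun j _ => continuous_const.sub (h2 j)
  exact (h2 k).add ((by fun_prop : Continuous fun s : Fin m → ℝ => H ⬝ᵥ s).comp h3)

/-- Extending the past outputs by zero is harmless: the symbol and the noise state at time `k`
depend only on indices below `k`. -/
theorem received_eq (k : ℕ) (ω : M × (ℕ → ℝ)) :
    received F G H e k ω =
      channelShift F G H e k (ω.1, receivedBefore F G H e k ω) + ω.2 k := by
  have hext : ∀ j < k, extendZero (receivedBefore F G H e k ω) j = received F G H e j ω :=
    fun j hj => by simp [extendZero, hj, receivedBefore]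
  have h1 : ∀ j ≤ k, decodedInput e ω.1 (extendZero (receivedBefore F G H e k ω)) j =
      sent F G H e j ω := fun j hj => by
    rw [← decodedInput_received]
    exact decodedInput_congr e ω.1 fun i hi => hext i (hi.trans_le hj)
  have h2 : noiseState (F - vecMulVec G H) G
      (fun j => extendZero (receivedBefore F G H e k ω) j -
        decodedInput e ω.1 (extendZero (receivedBefore F G H e k ω)) j) k =
      noiseState F G ω.2 k := by
    rw [← noiseState_received F G H e k ω]
    refine noiseState_congr fun j hj => ?_
    rw [hext j hj, h1 j hj.le, decodedInput_received]
  rw [channelShift, h1 k le_rfl, h2, received, noise]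
  ring

theorem innov_channelShift (n : ℕ) (ω : M × (ℕ → ℝ)) :
    innov (channelShift F G H e) n (ω.1, receivedBefore F G H e n ω) = fun k : Fin n => ω.2 k := by
  ext k
  exact sub_eq_of_eq_add' (received_eq F G H e k ω)

theorem measurable_noise (k : ℕ) : Measurable fun u : ℕ → ℝ => noise F G H u k := by
  have h := measurable_noiseState (F := F) (G := G) (u := fun u : ℕ → ℝ => u) (k := k)
    fun j _ => measurable_pi_apply j
  exact ((Continuous.measurable (by fun_prop : Continuous fun s : Fin m → ℝ => H ⬝ᵥ s)).comp
    h).add (measurable_pi_apply k)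

theorem measurable_sent (k : ℕ) : Measurable (sent F G H e k) := by
  induction k using Nat.strong_induction_on with
  | _ k ih =>
    have : sent F G H e k = fun ω => e.f k (ω.1, fun i : Fin k => sent F G H e i ω,
      fun i : Fin k => received F G H e i ω) := funext fun ω => sent_eq F G H e k ω
    rw [this]
    refine (e.measurable_f k).comp (measurable_fst.prodMk (Measurable.prodMk ?_ ?_))
    · exact measurable_pi_lambda _ fun i => ih i i.2
    · exact measurable_pi_lambda _ fun i =>
        (ih i i.2).add ((measurable_noise F G H i).comp measurable_snd)

theorem measurable_received (k : ℕ) : Measurable (received F G H e k) :=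
  (measurable_sent F G H e k).add ((measurable_noise F G H k).comp measurable_snd)

theorem measurable_receivedBefore (k : ℕ) : Measurable (receivedBefore F G H e k) :=
  measurable_pi_lambda _ fun i => measurable_received F G H e i

theorem map_whiteNoise_restrict (n : ℕ) :
    whiteNoise.map (fun u (k : Fin n) => u k) = Measure.pi fun _ : Fin n => gaussianReal 0 1 := by
  have h := Measure.map_infinitePi_infinitePi_of_inj (P := fun _ : ℕ => gaussianReal 0 1)
    (f := fun k : Fin n => (k : ℕ)) Fin.val_injective
  rw [← Measure.infinitePi_eq_pi]
  exact h

/-- The joint density of the message and the outputs. -/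
noncomputable def channelDensity (n : ℕ) (z : M × (Fin n → ℝ)) : ℝ :=
  gaussDensity (fun _ => 1) (innov (channelShift F G H e) n z)

theorem measurable_channelDensity (n : ℕ) : Measurable (channelDensity F G H e n) :=
  measurable_gaussDensity.comp (measurable_innov (measurable_channelShift F G H e) n)

theorem channelDensity_pos (n : ℕ) (z : M × (Fin n → ℝ)) : 0 < channelDensity F G H e n z :=
  gaussDensity_pos (fun _ => one_ne_zero) _

theorem channelDensity_le_one (n : ℕ) (z : M × (Fin n → ℝ)) : channelDensity F G H e n z ≤ 1 :=
  gaussDensity_one_le_one _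

theorem map_fst_jointLaw (π : Measure M) : (jointLaw π).map Prod.fst = π := by
  rw [jointLaw, Measure.map_fst_prod]
  simp

variable (π : Measure M) [IsProbabilityMeasure π]

/-- The innovations with respect to `channelShift` are the driving noise itself, which is
independent of the message. Their joint law is thus a product with an explicit density, and the
shear carries it over to the outputs. -/
theorem map_message_outputs (n : ℕ) :
    (jointLaw π).map (fun ω => (ω.1, receivedBefore F G H e n ω)) =
      (π.prod volume).withDensity fun z => ENNReal.ofReal (channelDensity F G H e n z) := by
  have hm := measurable_channelShift F G H e
  refine eq_withDensity_of_map_innov (h := channelShift F G H e) hm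
    (g := fun z => ENNReal.ofReal (gaussDensity (fun _ => 1) z.2))
    (measurable_gaussDensity.comp measurable_snd).ennreal_ofReal ?_
  rw [Measure.map_map (measurable_fst.prodMk (measurable_innov hm n))
    (measurable_fst.prodMk (measurable_receivedBefore F G H e n))]
  have : (fun z : M × (Fin n → ℝ) => (z.1, innov (channelShift F G H e) n z)) ∘
      (fun ω => (ω.1, receivedBefore F G H e n ω)) =
      Prod.map id (fun (u : ℕ → ℝ) (k : Fin n) => u k) := by
    ext1 ω
    exact Prod.ext rfl (innov_channelShift F G H e n ω)
  rw [this, jointLaw, ← Measure.map_prod_map _ _ measurable_id (by fun_prop), Measure.map_id,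
    map_whiteNoise_restrict, pi_gaussianReal_eq_withDensity fun _ => one_ne_zero,
    prod_withDensity_right measurable_gaussDensity.ennreal_ofReal]

/-- The mutual information between the message and the outputs, in nats. -/
noncomputable def info (n : ℕ) : ℝ≥0∞ :=
  ∫⁻ y, ENNReal.ofReal (infoDensity π (channelDensity F G H e n) y)

theorem mutualInfo_eq_info (n : ℕ) :
    mutualInfo (jointLaw π) Prod.fst (receivedBefore F G H e n) =
      info F G H e π n / ENNReal.ofReal (Real.log 2) := by
  have hm : Measurable fun ω : M × (ℕ → ℝ) => (ω.1, receivedBefore F G H e n ω) :=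
    measurable_fst.prodMk (measurable_receivedBefore F G H e n)
  have : IsProbabilityMeasure
      ((jointLaw π).map fun ω => (ω.1, receivedBefore F G H e n ω)) :=
    Measure.isProbabilityMeasure_map hm.aemeasurable
  have hsnd : ((jointLaw π).map fun ω => (ω.1, receivedBefore F G H e n ω)).map Prod.snd =
      (jointLaw π).map (receivedBefore F G H e n) := Measure.map_map measurable_snd hm
  rw [mutualInfo, map_fst_jointLaw, ← hsnd,
    klDiv_prod_map_snd (measurable_channelDensity F G H e n) (channelDensity_pos F G H e n)
      (channelDensity_le_one F G H e n) (map_message_outputs F G H e π n)]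
  rfl

theorem rate_eq_info (n : ℕ) :
    rate F G H n π e = info F G H e π n / ENNReal.ofReal (Real.log 2) / n := by
  rw [rate, mutualInfo_eq_info]

end decode

end FeedbackChannel

namespace FeedbackChannel

open Filter Topology

/-! ### Innovations in an inner product space -/

section gram

variable {E : Type*} [NormedAddCommGroup E] [InnerProductSpace ℝ E] {m : ℕ}

/-- The linear combination `∑ w_i σ_i`. -/
def comb (w : Fin m → ℝ) (σ : Fin m → E) : E := ∑ i, w i • σ i

/-- The matrix of inner products of the vectors `σ`. -/
def gramMatrix (σ : Fin m → E) : Matrix (Fin m) (Fin m) ℝ :=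
  Matrix.of fun i j => inner ℝ (σ i) (σ j)

theorem gramMatrix_apply (σ : Fin m → E) (i j : Fin m) :
    gramMatrix σ i j = inner ℝ (σ i) (σ j) := rfl

theorem inner_comb_left (w : Fin m → ℝ) (σ : Fin m → E) (v : E) :
    inner ℝ (comb w σ) v = w ⬝ᵥ fun i => inner ℝ (σ i) v := by
  simp [comb, sum_inner, real_inner_smul_left, dotProduct]

theorem inner_comb_right (w : Fin m → ℝ) (σ : Fin m → E) (v : E) :
    inner ℝ v (comb w σ) = w ⬝ᵥ fun i => inner ℝ (σ i) v := by
  rw [real_inner_comm, inner_comb_left]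

theorem inner_comb_comb (w w' : Fin m → ℝ) (σ : Fin m → E) :
    inner ℝ (comb w σ) (comb w' σ) = w ⬝ᵥ (gramMatrix σ *ᵥ w') := by
  rw [inner_comb_left]
  congr 1
  ext i
  rw [inner_comb_right, dotProduct_comm]
  simp only [mulVec, gramMatrix, of_apply]
  simp only [real_inner_comm]

/-- The form is the squared norm of `∑ w_i σ_i + t ξ`. -/
theorem blockNonneg_gramMatrix (σ : Fin m → E) (ξ : E) :
    BlockNonneg (gramMatrix σ) (fun i => inner ℝ (σ i) ξ) (inner ℝ ξ ξ) := fun w t => by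
  have h : 0 ≤ inner ℝ (comb w σ + t • ξ) (comb w σ + t • ξ) := real_inner_self_nonneg
  rw [inner_add_add_self, inner_comb_comb, real_inner_comm, real_inner_smul_left,
    real_inner_smul_left, real_inner_smul_right, inner_comb_right] at h
  linarith

variable {F : Matrix (Fin m) (Fin m) ℝ} {G H : Fin m → ℝ} {σ : Fin m → E} {ξ u : E}

-- One step of the covariance recursion for Gram matrices

section step

variable (hu : inner ℝ u u = 1) (hσu : ∀ i, inner ℝ (σ i) u = 0) (hξu : inner ℝ ξ u = 0)

include hu hσu hξu

theorem inner_innovation_self :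
    inner ℝ (ξ + comb H σ + u) (ξ + comb H σ + u) =
      innovVar H (gramMatrix σ) (fun i => inner ℝ (σ i) ξ) (inner ℝ ξ ξ) := by
  have h1 : inner ℝ (comb H σ) u = 0 := by
    rw [inner_comb_left]
    simp [dotProduct, hσu]
  rw [(blockNonneg_gramMatrix σ ξ).innovVar_eq, inner_add_add_self, inner_add_add_self,
    inner_comb_comb, inner_add_left, inner_add_right, real_inner_comm ξ u, real_inner_comm _ u,
    hξu, h1, hu, inner_comb_left, inner_comb_right]
  ring

theorem inner_prediction_innovation (i : Fin m) :
    inner ℝ (comb (F i) σ + G i • u) (ξ + comb H σ + u) =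
      (F *ᵥ ((fun i => inner ℝ (σ i) ξ) + gramMatrix σ *ᵥ H) + G) i := by
  have h1 : ∀ w : Fin m → ℝ, inner ℝ (comb w σ) u = 0 := fun w => by
    rw [inner_comb_left]
    simp [dotProduct, hσu]
  have h2 : inner ℝ (comb (F i) σ) (comb H σ) = (F *ᵥ (gramMatrix σ *ᵥ H)) i :=
    inner_comb_comb _ _ _
  have h3 : inner ℝ (comb (F i) σ) ξ = (F *ᵥ fun i => inner ℝ (σ i) ξ) i := inner_comb_left _ _ _
  simp only [inner_add_left, inner_add_right, real_inner_smul_left, h1, hu, h2, h3,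
    real_inner_comm ξ u, real_inner_comm (comb H σ) u, hξu, Pi.add_apply, mulVec_add]
  ring

/-- The new errors are the residuals of `F σ + G u` after projection on the innovation `ξ + Hσ + u`.
Projecting off one vector subtracts a rank-one matrix from the Gram matrix, and its entries are the
inner products found in `inner_prediction_innovation`. -/
theorem gramMatrix_step :
    gramMatrix (fun i => comb (F i) σ + G i • u -
      (inner ℝ (ξ + comb H σ + u) (comb (F i) σ + G i • u) /
        inner ℝ (ξ + comb H σ + u) (ξ + comb H σ + u)) • (ξ + comb H σ + u)) =
      covStep F G H (gramMatrix σ) (fun i => inner ℝ (σ i) ξ) (inner ℝ ξ ξ) := by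
  have h1 : ∀ w : Fin m → ℝ, inner ℝ (comb w σ) u = 0 := fun w => by
    rw [inner_comb_left]
    simp [dotProduct, hσu]
  have hY := inner_innovation_self (H := H) hu hσu hξu
  have hτ := fun i => inner_prediction_innovation (F := F) (G := G) (H := H) hu hσu hξu i
  have hY1 := one_le_innovVar (H := H) (gramMatrix σ) (fun i => inner ℝ (σ i) ξ) (inner ℝ ξ ξ)
  ext i j
  have hττ : inner ℝ (comb (F i) σ + G i • u) (comb (F j) σ + G j • u) =
      (F * gramMatrix σ * Fᵀ + vecMulVec G G) i j := by
    simp only [inner_add_left, inner_add_right, real_inner_smul_left, real_inner_smul_right,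
      inner_comb_comb, h1, hu, real_inner_comm (comb (F j) σ) u]
    rw [Matrix.add_apply, vecMulVec_apply, mul_apply_eq_vecMul, dotProduct_mulVec]
    simp [vecMul_transpose, mul_apply_eq_vecMul, mulVec, dotProduct_comm, mul_comm (G i)]
  generalize ξ + comb H σ + u = ε at *
  rw [gramMatrix_apply, covStep, Matrix.sub_apply, Matrix.smul_apply, vecMulVec_apply]
  rw [← hY] at hY1 ⊢
  rw [← hττ, ← hτ i, ← hτ j]
  generalize comb (F i) σ + G i • u = a at *
  generalize comb (F j) σ + G j • u = b at *
  have hε : inner ℝ ε ε ≠ 0 := ne_of_gt (zero_lt_one.trans_le hY1)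
  simp only [inner_sub_left, inner_sub_right, real_inner_smul_left, real_inner_smul_right,
    real_inner_comm ε, smul_eq_mul]
  simp only [real_inner_comm a ε, real_inner_comm b ε]
  field_simp
  ring

end step

/-! ### Linear prediction -/

section prediction

variable {x u y : ℕ → E} {S : ℕ → Fin m → E}

/-- The projection of `v` to the span of `y_0, …, y_{k-1}`. -/
noncomputable def pastProj (y : ℕ → E) (k : ℕ) (v : E) : E :=
  ∑ j ∈ Finset.range k, (inner ℝ (InnerProductSpace.gramSchmidt ℝ y j) v /
    inner ℝ (InnerProductSpace.gramSchmidt ℝ y j) (InnerProductSpace.gramSchmidt ℝ y j)) •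
      InnerProductSpace.gramSchmidt ℝ y j

theorem pastProj_succ (k : ℕ) (v : E) : pastProj y (k + 1) v = pastProj y k v +
    (inner ℝ (InnerProductSpace.gramSchmidt ℝ y k) v /
      inner ℝ (InnerProductSpace.gramSchmidt ℝ y k) (InnerProductSpace.gramSchmidt ℝ y k)) •
        InnerProductSpace.gramSchmidt ℝ y k := Finset.sum_range_succ _ _

theorem pastProj_add (k : ℕ) (v w : E) :
    pastProj y k (v + w) = pastProj y k v + pastProj y k w := by
  simp only [pastProj, inner_add_right, add_div, add_smul, Finset.sum_add_distrib]

theorem pastProj_smul (k : ℕ) (a : ℝ) (v : E) : pastProj y k (a • v) = a • pastProj y k v := by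
  simp only [pastProj, inner_smul_right, mul_div_assoc, mul_smul, Finset.smul_sum]

theorem pastProj_comb (k : ℕ) (w : Fin m → ℝ) (σ : Fin m → E) :
    pastProj y k (comb w σ) = comb w fun i => pastProj y k (σ i) := by
  simp only [comb, pastProj, inner_sum, Finset.sum_div, Finset.sum_smul, Finset.smul_sum,
    inner_smul_right, mul_div_assoc, mul_smul]
  exact Finset.sum_comm

theorem gramSchmidt_eq_sub_pastProj (k : ℕ) :
    InnerProductSpace.gramSchmidt ℝ y k = y k - pastProj y k (y k) := by
  rw [eq_sub_iff_add_eq]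
  conv_rhs => rw [InnerProductSpace.gramSchmidt_def'' ℝ y k]
  congr 1
  rw [pastProj, Nat.Iio_eq_range]
  refine Finset.sum_congr rfl fun j _ => ?_
  simp

theorem inner_gramSchmidt_pastProj (k : ℕ) (v : E) :
    inner ℝ (InnerProductSpace.gramSchmidt ℝ y k) (pastProj y k v) = 0 := by
  rw [pastProj, inner_sum]
  refine Finset.sum_eq_zero fun j hj => ?_
  rw [inner_smul_right, InnerProductSpace.gramSchmidt_orthogonal ℝ y
    (Finset.mem_range.1 hj).ne', mul_zero]

theorem inner_pastProj_self (k : ℕ) (v : E) :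
    inner ℝ (v - pastProj y k v) (pastProj y k v) = 0 := by
  induction k with
  | zero => simp [pastProj]
  | succ k ih =>
    have h1 := inner_gramSchmidt_pastProj (y := y) k v
    rw [pastProj_succ]
    generalize InnerProductSpace.gramSchmidt ℝ y k = e at *
    generalize pastProj y k v = p at *
    -- The outputs need not be linearly independent here: a vanishing Gram-Schmidt vector
    -- contributes nothing to the projection.
    by_cases he : e = 0
    · simpa [he] using ih
    · have he' : inner ℝ e e ≠ 0 := inner_self_ne_zero.2 he
      rw [inner_sub_left] at ih
      simp only [inner_add_right, inner_add_left, inner_sub_left, inner_smul_right,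
        real_inner_smul_left, real_inner_comm e p, real_inner_comm e v, h1]
      simp only [real_inner_comm v e]
      field_simp
      linear_combination (inner ℝ e e) * ih

/-- Pythagoras. Removing the part of the input that is predictable from the past outputs can only
save power. -/
theorem norm_sub_pastProj_le (k : ℕ) (v : E) :
    inner ℝ (v - pastProj y k v) (v - pastProj y k v) ≤ (inner ℝ v v : ℝ) := by
  have h1 := inner_pastProj_self (y := y) k v
  have h2 : inner ℝ v v = inner ℝ (v - pastProj y k v + pastProj y k v)
    (v - pastProj y k v + pastProj y k v) := by rw [sub_add_cancel]
  have h3 := h1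
  rw [real_inner_comm] at h3
  rw [h2, inner_add_add_self, h1, h3]
  have := real_inner_self_nonneg (x := pastProj y k v)
  linarith

theorem pastProj_mem_span (k : ℕ) (v : E) : pastProj y k v ∈ Submodule.span ℝ (y '' Set.Iio k) := by
  refine Submodule.sum_mem _ fun j hj => Submodule.smul_mem _ _ ?_
  rw [← InnerProductSpace.span_gramSchmidt_Iio]
  exact Submodule.subset_span ⟨j, Finset.mem_range.1 hj, rfl⟩

theorem exists_pastProj_eq_sum (k : ℕ) (v : E) :
    ∃ a : Fin k → ℝ, pastProj y k v = ∑ j, a j • y j := by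
  have h := pastProj_mem_span (y := y) k v
  have : y '' Set.Iio k = Set.range fun j : Fin k => y j := by
    ext v
    constructor
    · rintro ⟨j, hj, rfl⟩
      exact ⟨⟨j, hj⟩, rfl⟩
    · rintro ⟨j, rfl⟩
      exact ⟨j, j.2, rfl⟩
  rw [this, Submodule.mem_span_range_iff_exists_fun] at h
  obtain ⟨a, ha⟩ := h
  exact ⟨a, ha.symm⟩

variable (hS0 : S 0 = 0) (hS : ∀ k i, S (k + 1) i = comb (F i) (S k) + G i • u k)
  (hy : ∀ k, y k = x k + comb H (S k) + u k)
  (hu : ∀ k, inner ℝ (u k) (u k) = (1 : ℝ)) (huu : ∀ k, ∀ j < k, inner ℝ (u j) (u k) = (0 : ℝ))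
  (hxu : ∀ k, ∀ j ≤ k, inner ℝ (x j) (u k) = (0 : ℝ))

include hS0 hS huu

theorem inner_state_noise (k : ℕ) : ∀ j ≤ k, ∀ i, inner ℝ (S j i) (u k) = (0 : ℝ) := by
  intro j
  induction j with
  | zero => simp [hS0]
  | succ j ih =>
    intro hj i
    rw [hS, inner_add_left, inner_comb_left, real_inner_smul_left, huu k j hj]
    simp [dotProduct, ih (Nat.le_of_succ_le hj)]

include hy hxu

/-- Each past output is built from inputs, states and noises that are all orthogonal to the fresh
noise `u_k`. This is the only place where causality of the input enters the linear theory. -/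
theorem inner_span_noise (k : ℕ) {v : E} (hv : v ∈ Submodule.span ℝ (y '' Set.Iio k)) :
    inner ℝ v (u k) = (0 : ℝ) := by
  induction hv using Submodule.span_induction with
  | mem a ha =>
    obtain ⟨j, hj, rfl⟩ := ha
    rw [hy, inner_add_left, inner_add_left, hxu k j (le_of_lt hj), huu k j hj, inner_comb_left]
    simp [dotProduct, inner_state_noise hS0 hS huu k j (le_of_lt hj)]
  | zero => simp
  | add a b _ _ ha hb => rw [inner_add_left, ha, hb, add_zero]
  | smul c a _ ha => rw [real_inner_smul_left, ha, mul_zero]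

theorem inner_pastProj_noise (k : ℕ) (v : E) : inner ℝ (pastProj y k v) (u k) = (0 : ℝ) :=
  inner_span_noise hS0 hS hy huu hxu k (pastProj_mem_span k v)

theorem pastProj_noise (k : ℕ) : pastProj y k (u k) = 0 := by
  refine Finset.sum_eq_zero fun j hj => ?_
  have h2 : InnerProductSpace.gramSchmidt ℝ y j ∈ Submodule.span ℝ (y '' Set.Iio k) := by
    rw [← InnerProductSpace.span_gramSchmidt_Iio]
    exact Submodule.subset_span ⟨j, Finset.mem_range.1 hj, rfl⟩
  rw [inner_span_noise hS0 hS hy huu hxu k h2, zero_div, zero_smul]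

include hu

/-- The covariances of the prediction errors of any input signal satisfy the recursion. -/
theorem exists_prediction : ∃ p : ℕ → (Fin m → ℝ) × ℝ,
    (∀ k, BlockNonneg (covSeq F G H p k) (p k).1 (p k).2) ∧
    (∀ k, (p k).2 ≤ inner ℝ (x k) (x k)) ∧
    ∀ k, ∃ a : Fin k → ℝ,
      inner ℝ (y k - ∑ j, a j • y j) (y k - ∑ j, a j • y j) = covY F G H p k := by
  -- The residuals of the state and of the input given the past outputs; their inner products are
  -- the coordinates `(c_k, q_k)`.
  let σ : ℕ → Fin m → E := fun k i => S k i - pastProj y k (S k i)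
  let ξ : ℕ → E := fun k => x k - pastProj y k (x k)
  let p : ℕ → (Fin m → ℝ) × ℝ := fun k => (fun i => inner ℝ (σ k i) (ξ k), inner ℝ (ξ k) (ξ k))
  have hcomb : ∀ k w, comb w (S k) - pastProj y k (comb w (S k)) = comb w (σ k) := fun k w => by
    rw [pastProj_comb]
    simp only [comb, σ, smul_sub, Finset.sum_sub_distrib]
  have hσu : ∀ k i, inner ℝ (σ k i) (u k) = (0 : ℝ) := fun k i => by
    rw [inner_sub_left, inner_state_noise hS0 hS huu k k le_rfl,
      inner_pastProj_noise hS0 hS hy huu hxu, sub_zero]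
  have hξu : ∀ k, inner ℝ (ξ k) (u k) = (0 : ℝ) := fun k => by
    rw [inner_sub_left, hxu k k le_rfl, inner_pastProj_noise hS0 hS hy huu hxu, sub_zero]
  have hnoise := pastProj_noise hS0 hS hy huu hxu
  -- Since `u_k` has no projection on the past, the Gram-Schmidt vector of `y_k` is the innovation
  -- of `gramMatrix_step`.
  have he : ∀ k, InnerProductSpace.gramSchmidt ℝ y k = ξ k + comb H (σ k) + u k := fun k => by
    rw [gramSchmidt_eq_sub_pastProj, hy k, pastProj_add, pastProj_add, hnoise, ← hcomb]
    simp only [ξ]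
    abel
  have hgram : ∀ k, gramMatrix (σ k) = covSeq F G H p k := fun k => by
    induction k with
    | zero =>
      ext i j
      simp [σ, gramMatrix_apply, covSeq, hS0, pastProj]
    | succ k ih =>
      rw [covSeq, ← ih, ← gramMatrix_step (hu k) (hσu k) (hξu k)]
      congr 1
      ext1 i
      -- The regression coefficient may be computed with the residual of the state in place of the
      -- state, because the Gram-Schmidt vector is orthogonal to past projections.
      have h1 : inner ℝ (InnerProductSpace.gramSchmidt ℝ y k) (S (k + 1) i) =
          (inner ℝ (InnerProductSpace.gramSchmidt ℝ y k) (comb (F i) (σ k) + G i • u k) : ℝ) := by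
        rw [hS, ← hcomb, inner_add_right, inner_add_right, inner_sub_right,
          inner_gramSchmidt_pastProj, sub_zero]
      rw [← he, ← h1]
      simp only [σ]
      rw [pastProj_succ, hS, pastProj_add, pastProj_smul, hnoise, smul_zero, add_zero]
      have h2 := hcomb k (F i)
      simp only [σ] at h2
      rw [← h2]
      abel
  refine ⟨p, fun k => ?_, fun k => norm_sub_pastProj_le k (x k), fun k => ?_⟩
  · rw [← hgram]
    exact blockNonneg_gramMatrix _ _
  · obtain ⟨a, ha⟩ := exists_pastProj_eq_sum (y := y) k (y k)
    refine ⟨a, ?_⟩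
    rw [← ha, ← gramSchmidt_eq_sub_pastProj, he,
      inner_innovation_self (hu k) (hσu k) (hξu k), hgram]
    rfl

end prediction

end gram

end FeedbackChannel

namespace FeedbackChannel

open Filter Topology

/-! ### Information and prediction errors -/

section noiseLaw

variable {M : Type} [MeasurableSpace M] (π : Measure M) [IsProbabilityMeasure π]

theorem map_noise_jointLaw (k : ℕ) :
    (jointLaw π).map (fun ω => ω.2 k) = gaussianReal 0 1 := by
  have h : (fun ω : M × (ℕ → ℝ) => ω.2 k) = (fun u : ℕ → ℝ => u k) ∘ Prod.snd := rfl
  rw [h, ← Measure.map_map (measurable_pi_apply k) measurable_snd, jointLaw,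
    Measure.map_snd_prod, measure_univ, one_smul]
  exact Measure.infinitePi_map_eval (fun _ => gaussianReal 0 1) k

theorem measurable_noise_coord (k : ℕ) : Measurable fun ω : M × (ℕ → ℝ) => ω.2 k :=
  (measurable_pi_apply k).comp measurable_snd

theorem hasLaw_noise (k : ℕ) :
    HasLaw (fun ω : M × (ℕ → ℝ) => ω.2 k) (gaussianReal 0 1) (jointLaw π) :=
  ⟨(measurable_noise_coord k).aemeasurable, map_noise_jointLaw π k⟩

theorem memLp_noise (k : ℕ) : MemLp (fun ω : M × (ℕ → ℝ) => ω.2 k) 2 (jointLaw π) := by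
  have h := memLp_id_gaussianReal' (μ := 0) (v := 1) 2 (by simp)
  rw [← map_noise_jointLaw π k] at h
  exact (memLp_map_measure_iff aestronglyMeasurable_id
    (measurable_noise_coord k).aemeasurable).1 h

theorem integral_noise (k : ℕ) : ∫ ω : M × (ℕ → ℝ), ω.2 k ∂(jointLaw π) = 0 := by
  have h := (hasLaw_noise π k).integral_eq
  rw [h]
  exact integral_id_gaussianReal

theorem integral_sq_gaussianReal (v : ℝ≥0) : ∫ x, x ^ 2 ∂(gaussianReal 0 v) = v := by
  have h1 := variance_of_integral_eq_zero (μ := gaussianReal 0 v) (X := fun x => x)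
    measurable_id.aemeasurable integral_id_gaussianReal
  rw [variance_fun_id_gaussianReal] at h1
  exact h1.symm

theorem integral_noise_sq (k : ℕ) : ∫ ω : M × (ℕ → ℝ), ω.2 k ^ 2 ∂(jointLaw π) = 1 := by
  have h := integral_map (measurable_noise_coord (M := M) k).aemeasurable (μ := jointLaw π)
    (f := fun x : ℝ => x ^ 2) (by fun_prop)
  rw [← h, map_noise_jointLaw, integral_sq_gaussianReal]
  rfl

/-- The noise at time `k` is independent of the message and the past noise. -/
theorem indepFun_noise (k : ℕ) :
    IndepFun (fun ω : M × (ℕ → ℝ) => (ω.1, fun i : Fin k => ω.2 i)) (fun ω => ω.2 k)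
      (jointLaw π) := by
  have hm1 : Measurable fun ω : M × (ℕ → ℝ) => (ω.1, fun i : Fin k => ω.2 i) := by fun_prop
  rw [indepFun_iff_map_prod_eq_prod_map_map hm1.aemeasurable
    (measurable_noise_coord k).aemeasurable, map_noise_jointLaw]
  have h1 : (jointLaw π).map (fun ω => (ω.1, fun i : Fin k => ω.2 i)) =
      π.prod (Measure.pi fun _ : Fin k => gaussianReal 0 1) := by
    have : (fun ω : M × (ℕ → ℝ) => (ω.1, fun i : Fin k => ω.2 i)) =
      Prod.map id fun (u : ℕ → ℝ) (i : Fin k) => u i := rfl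
    rw [this, jointLaw, ← Measure.map_prod_map _ _ measurable_id (by fun_prop), Measure.map_id,
      map_whiteNoise_restrict]
  have h2 : whiteNoise.map (fun u : ℕ → ℝ => (fun i : Fin k => u i, u k)) =
      (Measure.pi fun _ : Fin k => gaussianReal 0 1).prod (gaussianReal 0 1) := by
    have hp := (Measure.measurePreserving_swap.comp
      (measurePreserving_piFinSuccAbove (fun _ : Fin (k + 1) => gaussianReal 0 1)
        (Fin.last k))).map_eq
    rw [← map_whiteNoise_restrict, Measure.map_map
      (measurable_swap.comp (MeasurableEquiv.measurable _)) (by fun_prop)] at hp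
    rw [← hp]
    congr 1
    ext1 u
    refine Prod.ext ?_ ?_
    · ext i
      simp [MeasurableEquiv.piFinSuccAbove]
      rfl
    · simp [MeasurableEquiv.piFinSuccAbove]
  rw [h1]
  have h3 : (fun ω : M × (ℕ → ℝ) => ((ω.1, fun i : Fin k => ω.2 i), ω.2 k)) =
      MeasurableEquiv.prodAssoc.symm ∘
        Prod.map id fun u : ℕ → ℝ => (fun i : Fin k => u i, u k) := rfl
  rw [h3, ← Measure.map_map (MeasurableEquiv.measurable _) (by fun_prop), jointLaw,
    ← Measure.map_prod_map _ _ measurable_id (by fun_prop), Measure.map_id, h2]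
  exact ((measurePreserving_prodAssoc π (Measure.pi fun _ : Fin k => gaussianReal 0 1)
    (gaussianReal 0 1)).symm _).map_eq

/-- Independence factors the integral and the noise has mean zero. The product formula holds without
integrability of `φ`. -/
theorem integral_mul_noise (k : ℕ) {φ : M × (Fin k → ℝ) → ℝ} (hφ : Measurable φ) :
    ∫ ω : M × (ℕ → ℝ), φ (ω.1, fun i : Fin k => ω.2 i) * ω.2 k ∂(jointLaw π) = 0 := by
  have h := (indepFun_noise π k).comp hφ measurable_id
  have hm : Measurable fun ω : M × (ℕ → ℝ) => (ω.1, fun i : Fin k => ω.2 i) := by fun_prop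
  have h2 := h.integral_fun_mul_eq_mul_integral (hφ.comp hm).aestronglyMeasurable
    (measurable_noise_coord k).aestronglyMeasurable
  refine h2.trans ?_
  have := integral_noise π k
  simp only [Function.comp_def, id] at this ⊢
  rw [this, mul_zero]

end noiseLaw

-- Information bounds from predictors of the outputs

section predict

/-- The density of outputs whose innovations with respect to the predictor `h` are independent
Gaussians. -/
noncomputable def predictDensity (h : ∀ k : ℕ, Unit × (Fin k → ℝ) → ℝ) {n : ℕ} (D : Fin n → ℝ≥0)
    (y : Fin n → ℝ) : ℝ :=
  gaussDensity D (innov h n ((), y))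

variable {h : ∀ k : ℕ, Unit × (Fin k → ℝ) → ℝ} {n : ℕ} {D : Fin n → ℝ≥0}

theorem measurable_predictDensity (hh : ∀ k, Measurable (h k)) :
    Measurable (predictDensity h D) :=
  measurable_gaussDensity.comp ((measurable_innov hh n).comp (by fun_prop))

/-- The innovation map preserves volume. The message space is a single point, so that the results on
causal maps apply to a predictor that sees only outputs. -/
theorem lintegral_predictDensity (hh : ∀ k, Measurable (h k)) (hD : ∀ k, D k ≠ 0) :
    ∫⁻ y, ENNReal.ofReal (predictDensity h D y) = 1 := by
  have hmp := measurePreserving_innov (π := Measure.dirac ()) hh n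
  have hg : Measurable fun z : Unit × (Fin n → ℝ) => ENNReal.ofReal (gaussDensity D z.2) :=
    (measurable_gaussDensity.comp measurable_snd).ennreal_ofReal
  have h1 : ∫⁻ z, ENNReal.ofReal (gaussDensity D (innov h n z)) ∂((Measure.dirac ()).prod volume) =
      ∫⁻ z, ENNReal.ofReal (gaussDensity D z.2) ∂((Measure.dirac ()).prod volume) :=
    hmp.lintegral_comp hg
  have hg' : Measurable fun z => ENNReal.ofReal (gaussDensity D (innov h n z)) :=
    (measurable_gaussDensity.comp (measurable_innov hh n)).ennreal_ofReal
  rw [Measure.dirac_prod, lintegral_map hg (by fun_prop), lintegral_map hg' (by fun_prop)] at h1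
  refine h1.trans ?_
  rw [← setLIntegral_univ, ← withDensity_apply _ MeasurableSet.univ,
    ← pi_gaussianReal_eq_withDensity hD, measure_univ]

theorem predictDensity_pos (hD : ∀ k, D k ≠ 0) (y : Fin n → ℝ) : 0 < predictDensity h D y :=
  gaussDensity_pos hD _

variable {m : ℕ} (F : Matrix (Fin m) (Fin m) ℝ) (G H : Fin m → ℝ)
  {M : Type} [MeasurableSpace M] (e : Encoder M) (π : Measure M) [IsProbabilityMeasure π]

/-- The divergence from the density of a predictor whose errors have second moments `D`. -/
theorem lintegral_divergence_predictDensity (hh : ∀ k, Measurable (h k)) (hD : ∀ k, D k ≠ 0)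
    (hint : ∀ k, Integrable
      (fun ω => innov h n ((), receivedBefore F G H e n ω) k ^ 2) (jointLaw π))
    (hval : ∀ k, ∫ ω, innov h n ((), receivedBefore F G H e n ω) k ^ 2 ∂(jointLaw π) = D k) :
    ∫⁻ z, ENNReal.ofReal (channelDensity F G H e n z *
        Real.log (channelDensity F G H e n z / predictDensity h D z.2) +
        (predictDensity h D z.2 - channelDensity F G H e n z)) ∂(π.prod volume) =
      ENNReal.ofReal (1 / 2 * ∑ k, Real.log (D k)) := by
  have hm : Measurable fun ω : M × (ℕ → ℝ) => (ω.1, receivedBefore F G H e n ω) :=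
    measurable_fst.prodMk (measurable_receivedBefore F G H e n)
  have hprob : IsProbabilityMeasure
      ((jointLaw π).map fun ω => (ω.1, receivedBefore F G H e n ω)) :=
    Measure.isProbabilityMeasure_map hm.aemeasurable
  have hf := measurable_channelDensity F G H e n
  have hq : Measurable (predictDensity h D) := measurable_predictDensity hh
  -- The constants with `2π` cancel. In the mean the two quadratic terms cancel as well, both
  -- `E[ε_k²] / (2 D_k)` and `E[u_k²] / 2` being one half, which leaves `1/2 log D_k`.
  have hlog : ∀ ω : M × (ℕ → ℝ), Real.log (channelDensity F G H e n
      (ω.1, receivedBefore F G H e n ω) / predictDensity h D (receivedBefore F G H e n ω)) =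
      ∑ k : Fin n, (1 / 2 * Real.log (D k) +
        (innov h n ((), receivedBefore F G H e n ω) k ^ 2 * (1 / (2 * D k)) -
          ω.2 k ^ 2 * (1 / 2))) := fun ω => by
    rw [Real.log_div (channelDensity_pos _ _ _ _ _ _).ne' (predictDensity_pos hD _).ne',
      channelDensity, predictDensity, innov_channelShift, log_gaussDensity fun _ => one_ne_zero,
      log_gaussDensity hD, ← Finset.sum_sub_distrib]
    refine Finset.sum_congr rfl fun k _ => ?_
    simp only [NNReal.coe_one, Real.log_one]
    ring
  have hi1 : ∀ k : Fin n, Integrable (fun ω : M × (ℕ → ℝ) =>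
      innov h n ((), receivedBefore F G H e n ω) k ^ 2 * (1 / (2 * D k))) (jointLaw π) :=
    fun k => (hint k).mul_const _
  have hi2 : ∀ k : Fin n, Integrable (fun ω : M × (ℕ → ℝ) => ω.2 k ^ 2 * (1 / 2)) (jointLaw π) :=
    fun k => (memLp_noise π k).integrable_sq.mul_const _
  have hi3 : ∀ k : Fin n, Integrable (fun ω : M × (ℕ → ℝ) =>
      innov h n ((), receivedBefore F G H e n ω) k ^ 2 * (1 / (2 * D k)) -
          ω.2 k ^ 2 * (1 / 2)) (jointLaw π) := fun k => (hi1 k).sub (hi2 k)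
  have hi4 : ∀ k : Fin n, Integrable (fun ω : M × (ℕ → ℝ) => 1 / 2 * Real.log (D k) +
      (innov h n ((), receivedBefore F G H e n ω) k ^ 2 * (1 / (2 * D k)) -
          ω.2 k ^ 2 * (1 / 2))) (jointLaw π) := fun k => (integrable_const _).add (hi3 k)
  have hmeas : Measurable fun z : M × (Fin n → ℝ) =>
      Real.log (channelDensity F G H e n z / predictDensity h D z.2) :=
    (hf.div (hq.comp measurable_snd)).log
  have hintμ : Integrable (fun z : M × (Fin n → ℝ) =>
      Real.log (channelDensity F G H e n z / predictDensity h D z.2))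
      ((jointLaw π).map fun ω => (ω.1, receivedBefore F G H e n ω)) := by
    rw [integrable_map_measure hmeas.aestronglyMeasurable hm.aemeasurable]
    simp only [Function.comp_def, hlog]
    exact integrable_finsetSum _ fun k _ => hi4 k
  rw [lintegral_divergence_eq hf (channelDensity_pos F G H e n) hq
    (predictDensity_pos hD) (lintegral_predictDensity hh hD)
    (map_message_outputs F G H e π n) hintμ,
    integral_map hm.aemeasurable hmeas.aestronglyMeasurable]
  simp only [hlog]
  rw [integral_finsetSum _ fun k _ => hi4 k, Finset.mul_sum]
  congr 1
  refine Finset.sum_congr rfl fun k _ => ?_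
  rw [integral_add (integrable_const _) (hi3 k), integral_sub (hi1 k) (hi2 k),
    integral_mul_const (μ := jointLaw π) _ fun ω : M × (ℕ → ℝ) => ω.2 k ^ 2,
    integral_noise_sq, integral_mul_const (μ := jointLaw π) _
      fun ω : M × (ℕ → ℝ) => innov h n ((), receivedBefore F G H e n ω) k ^ 2, hval]
  have : (D k : ℝ) ≠ 0 := NNReal.coe_ne_zero.2 (hD k)
  simp
  field_simp
  ring

/-- Only the second moments of the prediction errors enter, so the bound covers nonlinear encoders
and non-Gaussian messages. -/
theorem info_le (hh : ∀ k, Measurable (h k)) (hD : ∀ k, D k ≠ 0)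
    (hint : ∀ k, Integrable
      (fun ω => innov h n ((), receivedBefore F G H e n ω) k ^ 2) (jointLaw π))
    (hval : ∀ k, ∫ ω, innov h n ((), receivedBefore F G H e n ω) k ^ 2 ∂(jointLaw π) = D k) :
    info F G H e π n ≤ ENNReal.ofReal (1 / 2 * ∑ k, Real.log (D k)) := by
  rw [← lintegral_divergence_predictDensity F G H e π hh hD hint hval]
  exact lintegral_infoDensity_le (measurable_channelDensity F G H e n)
    (channelDensity_pos F G H e n) (channelDensity_le_one F G H e n)
    (measurable_predictDensity hh) (predictDensity_pos hD)

/-- When the prediction errors really are independent Gaussians, the predictor density agrees almost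
everywhere with the true output density, and the variational bound is an equality. -/
theorem info_eq (hh : ∀ k, Measurable (h k)) (hD : ∀ k, D k ≠ 0)
    (hint : ∀ k, Integrable
      (fun ω => innov h n ((), receivedBefore F G H e n ω) k ^ 2) (jointLaw π))
    (hval : ∀ k, ∫ ω, innov h n ((), receivedBefore F G H e n ω) k ^ 2 ∂(jointLaw π) = D k)
    (hlaw : (jointLaw π).map (fun ω => innov h n ((), receivedBefore F G H e n ω)) =
      Measure.pi fun k => gaussianReal 0 (D k)) :
    info F G H e π n = ENNReal.ofReal (1 / 2 * ∑ k, Real.log (D k)) := by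
  rw [← lintegral_divergence_predictDensity F G H e π hh hD hint hval]
  have hf := measurable_channelDensity F G H e n
  refine lintegral_infoDensity_eq hf
    (channelDensity_pos F G H e n) (channelDensity_le_one F G H e n)
    (measurable_predictDensity hh) (predictDensity_pos hD) ?_
  have hr := measurable_receivedBefore F G H e n
  have hm : Measurable fun ω : M × (ℕ → ℝ) => (ω.1, receivedBefore F G H e n ω) :=
    measurable_fst.prodMk hr
  have h1 : (jointLaw π).map (receivedBefore F G H e n) = volume.withDensity fun y =>
      ENNReal.ofReal (∫ w, channelDensity F G H e n (w, y) ∂π) := by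
    rw [← map_snd_withDensity hf (channelDensity_pos F G H e n) (channelDensity_le_one F G H e n),
      ← map_message_outputs, Measure.map_map measurable_snd hm]
    rfl
  have hpair : Measurable fun y : Fin n → ℝ => ((), y) := by fun_prop
  have hinn : Measurable fun z : Unit × (Fin n → ℝ) => (z.1, innov h n z) :=
    measurable_fst.prodMk (measurable_innov hh n)
  have hinn' : Measurable fun ω => innov h n ((), receivedBefore F G H e n ω) :=
    (measurable_innov hh n).comp (hpair.comp hr)
  have h2 : ((jointLaw π).map (receivedBefore F G H e n)).map (fun y => ((), y)) =
      ((Measure.dirac ()).prod volume).withDensity fun z =>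
        ENNReal.ofReal (gaussDensity D (innov h n z)) := by
    refine eq_withDensity_of_map_innov (h := h) hh
      (g := fun z => ENNReal.ofReal (gaussDensity D z.2))
      (measurable_gaussDensity.comp measurable_snd).ennreal_ofReal ?_
    rw [Measure.map_map hinn hpair, Measure.map_map (hinn.comp hpair) hr,
      ← prod_withDensity_right measurable_gaussDensity.ennreal_ofReal,
      ← pi_gaussianReal_eq_withDensity hD, ← hlaw, Measure.dirac_prod,
      Measure.map_map hpair hinn']
    rfl
  have h3 : (jointLaw π).map (receivedBefore F G H e n) =
      volume.withDensity fun y => ENNReal.ofReal (predictDensity h D y) := by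
    have h4 := congrArg (Measure.map Prod.snd) h2
    rw [Measure.map_map measurable_snd hpair] at h4
    refine Eq.trans ?_ (h4.trans ?_)
    · exact Measure.map_id.symm
    · have hg : Measurable fun z : Unit × (Fin n → ℝ) =>
          ENNReal.ofReal (gaussDensity D (innov h n z)) :=
        (measurable_gaussDensity.comp (measurable_innov hh n)).ennreal_ofReal
      ext s hs
      rw [Measure.map_apply measurable_snd hs, withDensity_apply _ (measurable_snd hs),
        withDensity_apply _ hs, Measure.dirac_prod, setLIntegral_map (measurable_snd hs) hg hpair]
      rfl
  rw [h1] at h3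
  have hgm : Measurable fun y => ENNReal.ofReal (∫ w, channelDensity F G H e n (w, y) ∂π) :=
    (measurable_integral_section hf).ennreal_ofReal
  have hqm : Measurable fun y => ENNReal.ofReal (predictDensity h D y) :=
    (measurable_predictDensity hh).ennreal_ofReal
  refine ((withDensity_eq_iff_of_sigmaFinite hgm.aemeasurable hqm.aemeasurable).1 h3).mono
    fun y hy => ?_
  exact (ENNReal.ofReal_eq_ofReal_iff (integral_section_pos hf (channelDensity_pos F G H e n)
    (channelDensity_le_one F G H e n) y).le (gaussDensity_pos hD _).le).1 hy

end predict

end FeedbackChannel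

namespace FeedbackChannel

open Filter Topology

/-! ### Square-integrable random variables as vectors -/

section toL2

variable {Ω : Type*} [MeasurableSpace Ω] {μ : Measure Ω} {f g : Ω → ℝ}

open scoped Classical in
/-- The class of `f` in `L²`, or zero if `f` is not square-integrable. -/
noncomputable def toL2 (μ : Measure Ω) (f : Ω → ℝ) : Lp ℝ 2 μ :=
  if h : MemLp f 2 μ then h.toLp f else 0

theorem toL2_eq (h : MemLp f 2 μ) : toL2 μ f = h.toLp f := dif_pos h

theorem inner_toL2 (hf : MemLp f 2 μ) (hg : MemLp g 2 μ) :
    inner ℝ (toL2 μ f) (toL2 μ g) = ∫ a, f a * g a ∂μ := by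
  rw [toL2_eq hf, toL2_eq hg, L2.inner_def]
  refine integral_congr_ae ?_
  filter_upwards [hf.coeFn_toLp, hg.coeFn_toLp] with a h1 h2
  rw [h1, h2]
  exact mul_comm _ _

theorem toL2_add (hf : MemLp f 2 μ) (hg : MemLp g 2 μ) :
    toL2 μ (fun a => f a + g a) = toL2 μ f + toL2 μ g := by
  have h : MemLp (fun a => f a + g a) 2 μ := hf.add hg
  rw [toL2_eq hf, toL2_eq hg, toL2_eq h]
  rfl

theorem toL2_const_mul (c : ℝ) (hf : MemLp f 2 μ) :
    toL2 μ (fun a => c * f a) = c • toL2 μ f := by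
  rw [toL2_eq hf, toL2_eq (hf.const_mul c)]
  rfl

theorem toL2_zero : toL2 μ (fun _ => (0 : ℝ)) = 0 := by
  rw [toL2_eq MemLp.zero']
  rfl

theorem memLp_sum_mul {ι : Type*} (s : Finset ι) (w : ι → ℝ) {f : ι → Ω → ℝ}
    (hf : ∀ i, MemLp (f i) 2 μ) : MemLp (fun a => ∑ i ∈ s, w i * f i a) 2 μ :=
  memLp_finsetSum s fun i _ => (hf i).const_mul (w i)

theorem toL2_sum_mul {ι : Type*} (s : Finset ι) (w : ι → ℝ) {f : ι → Ω → ℝ}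
    (hf : ∀ i, MemLp (f i) 2 μ) :
    toL2 μ (fun a => ∑ i ∈ s, w i * f i a) = ∑ i ∈ s, w i • toL2 μ (f i) := by
  classical
  induction s using Finset.induction_on with
  | empty => simpa using toL2_zero
  | insert i s hi ih =>
    simp only [Finset.sum_insert hi]
    rw [toL2_add ((hf i).const_mul _) (memLp_sum_mul s w hf), ih, toL2_const_mul _ (hf i)]

theorem toL2_dotProduct {m : ℕ} (w : Fin m → ℝ) {f : Ω → Fin m → ℝ}
    (hf : ∀ i, MemLp (fun a => f a i) 2 μ) :
    toL2 μ (fun a => w ⬝ᵥ f a) = comb w fun i => toL2 μ fun a => f a i :=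
  toL2_sum_mul Finset.univ w hf

theorem memLp_dotProduct {m : ℕ} (w : Fin m → ℝ) {f : Ω → Fin m → ℝ}
    (hf : ∀ i, MemLp (fun a => f a i) 2 μ) : MemLp (fun a => w ⬝ᵥ f a) 2 μ :=
  memLp_sum_mul Finset.univ w hf

end toL2

/-! ### The converse -/

section converse

variable {m : ℕ} (F : Matrix (Fin m) (Fin m) ℝ) (G H : Fin m → ℝ)
  {M : Type} [MeasurableSpace M] (e : Encoder M) (π : Measure M) [IsProbabilityMeasure π]

theorem noiseState_succ_apply (u : ℕ → ℝ) (k : ℕ) (i : Fin m) :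
    noiseState F G u (k + 1) i = F i ⬝ᵥ noiseState F G u k + G i * u k := by
  rw [noiseState, Pi.add_apply, Pi.smul_apply, smul_eq_mul, mul_comm (u k)]
  rfl

theorem memLp_noiseState (k : ℕ) : ∀ i,
    MemLp (fun ω : M × (ℕ → ℝ) => noiseState F G ω.2 k i) 2 (jointLaw π) := by
  induction k with
  | zero => exact fun i => MemLp.zero'
  | succ k ih =>
    intro i
    simp only [noiseState_succ_apply]
    exact (memLp_dotProduct (F i) ih).add ((memLp_noise π k).const_mul _)

theorem noise_congr {u u' : ℕ → ℝ} {k : ℕ} (h : ∀ j ≤ k, u j = u' j) :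
    noise F G H u k = noise F G H u' k := by
  rw [noise, noise, noiseState_congr fun j hj => h j (le_of_lt hj), h k le_rfl]

theorem sent_congr (w : M) {u u' : ℕ → ℝ} {k : ℕ} (h : ∀ j < k, u j = u' j) :
    sent F G H e k (w, u) = sent F G H e k (w, u') := by
  induction k using Nat.strong_induction_on with
  | _ k ih =>
    rw [sent_eq, sent_eq]
    have h1 : ∀ i : Fin k, sent F G H e i (w, u) = sent F G H e i (w, u') := fun i =>
      ih i i.2 fun j hj => h j (hj.trans i.2)
    congr 3
    · ext i
      exact h1 i
    · ext i
      rw [received, received, h1]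
      congr 1
      exact noise_congr F G H fun j hj => h j (lt_of_le_of_lt hj i.2)

theorem sent_extendZero {j k : ℕ} (hj : j ≤ k) (ω : M × (ℕ → ℝ)) :
    sent F G H e j ω = sent F G H e j (ω.1, extendZero fun i : Fin k => ω.2 i) := by
  refine sent_congr F G H e ω.1 fun i hi => ?_
  simp [extendZero, lt_of_lt_of_le hi hj]

theorem memLp_of_lintegral_sq {Ω : Type*} [MeasurableSpace Ω] {μ : Measure Ω} {f : Ω → ℝ}
    (hf : Measurable f) (h : ∫⁻ a, ENNReal.ofReal (f a ^ 2) ∂μ ≠ ∞) : MemLp f 2 μ :=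
  (memLp_two_iff_integrable_sq hf.aestronglyMeasurable).2
    ((lintegral_ofReal_ne_top_iff_integrable (hf.pow_const 2).aestronglyMeasurable
      (ae_of_all _ fun a => sq_nonneg (f a))).1 h)

theorem lintegral_sq_eq {Ω : Type*} [MeasurableSpace Ω] {μ : Measure Ω} {f : Ω → ℝ}
    (h : MemLp f 2 μ) :
    ∫⁻ a, ENNReal.ofReal (f a ^ 2) ∂μ = ENNReal.ofReal (∫ a, f a ^ 2 ∂μ) :=
  (ofReal_integral_eq_lintegral_ofReal h.integrable_sq (ae_of_all _ fun a => sq_nonneg (f a))).symm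

/-- The linear predictor with coefficients `a`. -/
def linearPredictor (a : ∀ k : ℕ, Fin k → ℝ) (k : ℕ) (z : Unit × (Fin k → ℝ)) : ℝ :=
  ∑ j, a k j * z.2 j

theorem measurable_linearPredictor (a : ∀ k : ℕ, Fin k → ℝ) (k : ℕ) :
    Measurable (linearPredictor a k) := by
  unfold linearPredictor
  fun_prop

/-- The information conveyed by an encoder is bounded by the objective at some feasible
sequence of covariances. -/
theorem exists_feasible_info_le {n : ℕ} {R : ℝ} (hR : 0 ≤ R) {A : (ℕ → ℝ≥0∞) → Prop}
    (hA : IsConstraint n R A) (hpow : A (power F G H e π)) :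
    ∃ p ∈ feasible F G H R A, info F G H e π n ≤
      ENNReal.ofReal (1 / 2 * ∑ k ∈ Finset.range n, Real.log (covY F G H p k)) := by
  have hle := hA.le _ hpow
  have hsent : ∀ k < n, MemLp (sent F G H e k) 2 (jointLaw π) := fun k hk =>
    memLp_of_lintegral_sq (measurable_sent F G H e k)
      (ne_top_of_le_ne_top ENNReal.ofReal_ne_top (hle k hk))
  -- After the horizon the symbols may fail to be square-integrable; they are replaced by zero,
  -- which leaves the outputs before time `n` unchanged.
  let X : ℕ → M × (ℕ → ℝ) → ℝ := fun k ω => if k < n then sent F G H e k ω else 0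
  let Y : ℕ → M × (ℕ → ℝ) → ℝ := fun k ω => X k ω + H ⬝ᵥ noiseState F G ω.2 k + ω.2 k
  have hXn : ∀ k, k < n → X k = sent F G H e k := fun k hk => funext fun ω => if_pos hk
  have hX0 : ∀ k, ¬ k < n → X k = fun _ => 0 := fun k hk => funext fun ω => if_neg hk
  have hX : ∀ k, MemLp (X k) 2 (jointLaw π) := fun k => by
    by_cases hk : k < n
    · rw [hXn k hk]
      exact hsent k hk
    · rw [hX0 k hk]
      exact MemLp.zero'
  have hXm : ∀ k, Measurable (X k) := fun k => by
    by_cases hk : k < n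
    · rw [hXn k hk]
      exact measurable_sent F G H e k
    · rw [hX0 k hk]
      exact measurable_const
  have hS := fun k => memLp_noiseState F G π k
  have hU := fun k => memLp_noise (M := M) π k
  have hHS : ∀ k, MemLp (fun ω : M × (ℕ → ℝ) => H ⬝ᵥ noiseState F G ω.2 k) 2 (jointLaw π) :=
    fun k => memLp_dotProduct H (hS k)
  have hXS : ∀ k, MemLp (fun ω => X k ω + H ⬝ᵥ noiseState F G ω.2 k) 2 (jointLaw π) :=
    fun k => (hX k).add (hHS k)
  have hY : ∀ k, MemLp (Y k) 2 (jointLaw π) := fun k => (hXS k).add (hU k)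
  -- The encoder may be nonlinear: the hypotheses to be checked are linear identities and
  -- orthogonality relations in `L²`.
  have hpred := exists_prediction (E := Lp ℝ 2 (jointLaw π)) (F := F) (G := G) (H := H)
    (x := fun k => toL2 _ (X k)) (u := fun k => toL2 _ fun ω => ω.2 k)
    (y := fun k => toL2 _ (Y k)) (S := fun k i => toL2 _ fun ω => noiseState F G ω.2 k i)
    ?_ ?_ ?_ ?_ ?_ ?_
  rotate_left
  · ext1 i
    exact toL2_zero
  · intro k i
    simp only [noiseState_succ_apply]
    rw [toL2_add (memLp_dotProduct (F i) (hS k)) ((hU k).const_mul _), toL2_dotProduct _ (hS k),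
      toL2_const_mul _ (hU k)]
  · intro k
    simp only [Y]
    rw [toL2_add (hXS k) (hU k), toL2_add (hX k) (hHS k), toL2_dotProduct _ (hS k)]
  · intro k
    rw [inner_toL2 (hU k) (hU k), ← integral_noise_sq π k]
    simp only [sq]
  · intro k j hj
    rw [inner_toL2 (hU j) (hU k)]
    exact integral_mul_noise π k (φ := fun z => z.2 ⟨j, hj⟩) (by fun_prop)
  · intro k j hj
    rw [inner_toL2 (hX j) (hU k)]
    -- For `j ≤ k` the symbol `x_j` is a function of the message and the noise before time `k`, so
    -- it is independent of `u_k`.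
    have hφ : Measurable fun z : M × (Fin k → ℝ) => X j (z.1, extendZero z.2) :=
      (hXm j).comp (measurable_fst.prodMk (measurable_pi_lambda _ fun i =>
        (measurable_extendZero i).comp measurable_snd))
    have h := integral_mul_noise π k hφ
    refine Eq.trans (integral_congr_ae (ae_of_all _ fun ω => ?_)) h
    simp only [X]
    rw [sent_extendZero F G H e hj]
  obtain ⟨p, hp1, hp2, hp3⟩ := hpred
  choose a ha using hp3
  have hpX : ∀ k, (p k).2 ≤ ∫ ω, X k ω ^ 2 ∂(jointLaw π) := fun k => by
    have h := hp2 k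
    rw [inner_toL2 (hX k) (hX k)] at h
    simpa only [sq] using h
  have hpower : ∀ k < n, ENNReal.ofReal (p k).2 ≤ power F G H e π k := fun k hk => by
    rw [power, lintegral_sq_eq (hsent k hk), ← hXn k hk]
    exact ENNReal.ofReal_le_ofReal (hpX k)
  refine ⟨p, ⟨hp1, fun k => ?_, hA.mono _ _ hpower hpow⟩, ?_⟩
  · by_cases hk : k < n
    · exact (ENNReal.ofReal_le_ofReal_iff hR).1 ((hpower k hk).trans (hle k hk))
    · refine (hpX k).trans ?_
      rw [hX0 k hk]
      simpa using hR
  have hrec : ∀ k < n, ∀ ω, received F G H e k ω = Y k ω := fun k hk ω => by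
    simp only [Y, hXn k hk, received, noise]
    ring
  let D : Fin n → ℝ≥0 := fun k => ⟨covY F G H p k, zero_le_one.trans (one_le_innovVar _ _ _)⟩
  have hD : ∀ k, D k ≠ 0 := fun k h => by
    have h1 : 1 ≤ covY F G H p k := one_le_innovVar _ _ _
    have h2 : covY F G H p k = 0 := congrArg NNReal.toReal h
    linarith
  have hneg : ∀ k, MemLp (fun ω => -1 * ∑ j, a k j * Y j ω) 2 (jointLaw π) := fun k =>
    (memLp_sum_mul Finset.univ (a k) fun j : Fin k => hY j).const_mul _
  have hε : ∀ k, MemLp (fun ω => Y k ω + -1 * ∑ j, a k j * Y j ω) 2 (jointLaw π) := fun k =>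
    (hY k).add (hneg k)
  have hinn : ∀ (k : Fin n) (ω : M × (ℕ → ℝ)), innov (linearPredictor a) n
      ((), receivedBefore F G H e n ω) k = Y k ω + -1 * ∑ j, a k j * Y j ω := fun k ω => by
    rw [innov, linearPredictor, neg_one_mul, ← sub_eq_add_neg]
    congr 1
    · exact hrec k k.2 ω
    · refine Finset.sum_congr rfl fun j _ => ?_
      rw [← hrec j (j.2.trans k.2)]
      rfl
  have hint : ∀ k : Fin n, ∫ ω, (Y k ω + -1 * ∑ j, a k j * Y j ω) ^ 2 ∂(jointLaw π) =
      (D k : ℝ) := fun k => by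
    have h := ha k
    have h2 : toL2 (jointLaw π) (fun ω => Y k ω + -1 * ∑ j, a k j * Y j ω) =
        toL2 (jointLaw π) (Y k) - ∑ j, a k j • toL2 (jointLaw π) (Y j) := by
      rw [toL2_add (hY k) (hneg k), toL2_const_mul _
        (memLp_sum_mul Finset.univ (a k) fun j : Fin k => hY j),
        toL2_sum_mul Finset.univ (a k) fun j : Fin k => hY j, neg_one_smul, sub_eq_add_neg]
    rw [← h2, inner_toL2 (hε k) (hε k)] at h
    simp only [sq]
    exact h
  have hfin := info_le F G H e π (n := n) (D := D) (measurable_linearPredictor a) hD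
    (fun k => by simpa only [hinn] using (hε k).integrable_sq)
    (fun k => by simpa only [hinn] using hint k)
  refine hfin.trans (le_of_eq ?_)
  rw [Finset.sum_range]
  rfl

end converse

end FeedbackChannel

namespace FeedbackChannel

open Filter Topology

/-! ### The linear scheme: prediction errors as vectors -/

section scheme

variable {E : Type*} [NormedAddCommGroup E] [InnerProductSpace ℝ E] {m : ℕ}
  {F : Matrix (Fin m) (Fin m) ℝ} {G H : Fin m → ℝ} {X : ℕ → Fin m → ℝ} {V : ℕ → ℝ≥0}
  {u v ε : ℕ → E} {σ : ℕ → Fin m → E}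

variable (hσ0 : σ 0 = 0) (hε : ∀ k, ε k = comb (X k) (σ k) + v k + comb H (σ k) + u k)
  (hσ : ∀ k i, σ (k + 1) i = comb (F i) (σ k) + G i • u k - Gam F G H X V k i • ε k)

include hσ0 hε hσ

/-- The errors at time `k` are combinations of `u_j` and `v_j` with `j < k`. The vector `o` is
arbitrary, so the statement serves both for later noise or message components and, with the constant
function one, for zero means. -/
theorem inner_error_eq_zero {o : E} {k : ℕ} (hu : ∀ j < k, inner ℝ (u j) o = (0 : ℝ))
    (hv : ∀ j < k, inner ℝ (v j) o = (0 : ℝ)) (i : Fin m) : inner ℝ (σ k i) o = (0 : ℝ) := by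
  induction k generalizing i with
  | zero => simp [hσ0]
  | succ k ih =>
    have h1 := ih (fun j hj => hu j (hj.trans k.lt_succ_self))
      (fun j hj => hv j (hj.trans k.lt_succ_self))
    have h2 : ∀ w : Fin m → ℝ, inner ℝ (comb w (σ k)) o = (0 : ℝ) := fun w => by
      rw [inner_comb_left]
      simp [dotProduct, h1]
    rw [hσ, hε]
    simp only [inner_sub_left, inner_add_left, real_inner_smul_left, h2, hu k k.lt_succ_self,
      hv k k.lt_succ_self]
    ring

theorem inner_innovation_eq_zero {o : E} {k : ℕ} (hu : ∀ j ≤ k, inner ℝ (u j) o = (0 : ℝ))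
    (hv : ∀ j ≤ k, inner ℝ (v j) o = (0 : ℝ)) : inner ℝ (ε k) o = (0 : ℝ) := by
  have h1 := inner_error_eq_zero hσ0 hε hσ (fun j hj => hu j (le_of_lt hj))
    (fun j hj => hv j (le_of_lt hj))
  have h2 : ∀ w : Fin m → ℝ, inner ℝ (comb w (σ k)) o = (0 : ℝ) := fun w => by
    rw [inner_comb_left]
    simp [dotProduct, h1]
  rw [hε]
  simp only [inner_add_left, h2, hu k le_rfl, hv k le_rfl]
  ring

variable {n : ℕ} (hu : ∀ k, inner ℝ (u k) (u k) = (1 : ℝ))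
  (huu : ∀ k, ∀ j < k, inner ℝ (u j) (u k) = (0 : ℝ)) (huv : ∀ j k, inner ℝ (u j) (v k) = (0 : ℝ))
  (hv : ∀ k < n, inner ℝ (v k) (v k) = (V k : ℝ))
  (hvv : ∀ k, ∀ j < k, inner ℝ (v j) (v k) = (0 : ℝ))

include huu huv

theorem inner_error_noise (k : ℕ) (i : Fin m) : inner ℝ (σ k i) (u k) = (0 : ℝ) :=
  inner_error_eq_zero hσ0 hε hσ (huu k) (fun j _ => by rw [real_inner_comm, huv]) i

omit huu in
include hvv in
theorem inner_error_message (k : ℕ) (i : Fin m) : inner ℝ (σ k i) (v k) = (0 : ℝ) :=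
  inner_error_eq_zero hσ0 hε hσ (fun j _ => huv j k) (hvv k) i

omit huu in
include hvv in
theorem inner_error_input (k : ℕ) :
    (fun i => inner ℝ (σ k i) (comb (X k) (σ k) + v k)) = gramMatrix (σ k) *ᵥ X k := by
  ext i
  rw [inner_add_right, inner_error_message hσ0 hε hσ huv hvv, add_zero, inner_comb_right,
    dotProduct_comm]
  simp only [mulVec, gramMatrix_apply, real_inner_comm]

omit huu in
include hv hvv in
theorem inner_input_self {k : ℕ} (hk : k < n) :
    inner ℝ (comb (X k) (σ k) + v k) (comb (X k) (σ k) + v k) =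
      X k ⬝ᵥ (gramMatrix (σ k) *ᵥ X k) + (V k : ℝ) := by
  have h : inner ℝ (comb (X k) (σ k)) (v k) = (0 : ℝ) := by
    rw [inner_comb_left]
    simp [dotProduct, inner_error_message hσ0 hε hσ huv hvv]
  rw [inner_add_add_self, inner_comb_comb, real_inner_comm (comb (X k) (σ k)) (v k), h, hv k hk]
  ring

include hu hv hvv

/-- The two claims are proved by one induction: the covariance at time `k` identifies `Γ_k` as the
regression coefficient on the innovation, and this gives both the next covariance and the
orthogonality to the innovation just used. -/
theorem gramMatrix_error {k : ℕ} (hk : k ≤ n) :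
    gramMatrix (σ k) = Sig F G H X V k ∧
      ∀ i, ∀ j < k, inner ℝ (σ k i) (ε j) = (0 : ℝ) := by
  induction k with
  | zero =>
    refine ⟨?_, fun i j hj => absurd hj (Nat.not_lt_zero j)⟩
    ext i j
    simp [gramMatrix_apply, hσ0, Sig]
  | succ k ih =>
    obtain ⟨hg, ho⟩ := ih (Nat.le_of_succ_le hk)
    have hσu := inner_error_noise hσ0 hε hσ huu huv k
    have hξu : inner ℝ (comb (X k) (σ k) + v k) (u k) = (0 : ℝ) := by
      rw [inner_add_left, inner_comb_left, real_inner_comm, huv]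
      simp [dotProduct, hσu]
    have hc := inner_error_input hσ0 hε hσ huv hvv k
    have hq := inner_input_self hσ0 hε hσ huv hv hvv (Nat.lt_of_succ_le hk)
    rw [hg] at hc hq
    have hY : inner ℝ (ε k) (ε k) = Yseq F G H X V k := by
      rw [hε, inner_innovation_self (hu k) hσu hξu, hc, hq, hg]
      exact innovVar_toCov X V k
    have hY0 : Yseq F G H X V k ≠ 0 := ne_of_gt (zero_lt_one.trans_le (one_le_Yseq X V k))
    have hΓ : ∀ i, inner ℝ (ε k) (comb (F i) (σ k) + G i • u k) / inner ℝ (ε k) (ε k) =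
        Gam F G H X V k i := fun i => by
      rw [real_inner_comm, hY, div_eq_iff hY0, hε,
        inner_prediction_innovation (hu k) hσu hξu, hc, hg, ← mulVec_add, ← Yseq_smul_Gam X V k,
        Pi.smul_apply, smul_eq_mul, mul_comm]
    have hσ' : σ (k + 1) = fun i => comb (F i) (σ k) + G i • u k -
        (inner ℝ (ε k) (comb (F i) (σ k) + G i • u k) / inner ℝ (ε k) (ε k)) • ε k := by
      ext1 i
      rw [hσ, hΓ]
    constructor
    · rw [hσ', hε, gramMatrix_step (hu k) hσu hξu, hc, hq, hg]
      exact (Sig_succ_eq_covStep X V k).symm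
    · intro i j hj
      -- Earlier innovations are handled by induction and causality, the latest one by the choice of
      -- the gain.
      rcases Nat.lt_succ_iff_lt_or_eq.1 hj with hj | rfl
      · have h1 : ∀ w : Fin m → ℝ, inner ℝ (comb w (σ k)) (ε j) = (0 : ℝ) := fun w => by
          rw [inner_comb_left]
          simp [dotProduct, ho _ j hj]
        have h2 : inner ℝ (u k) (ε j) = (0 : ℝ) := by
          rw [real_inner_comm]
          exact inner_innovation_eq_zero hσ0 hε hσ (fun i hi => huu k i (lt_of_le_of_lt hi hj))
            (fun i _ => by rw [real_inner_comm, huv])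
        have h3 : inner ℝ (v k) (ε j) = (0 : ℝ) := by
          rw [real_inner_comm]
          exact inner_innovation_eq_zero hσ0 hε hσ (fun i _ => huv i k)
            (fun i hi => hvv k i (lt_of_le_of_lt hi hj))
        rw [hσ, hε k]
        simp only [inner_sub_left, inner_add_left, real_inner_smul_left, h1, h2, h3]
        ring
      · rw [hσ, inner_sub_left, real_inner_smul_left, hY, ← hΓ i,
          real_inner_comm (comb (F i) (σ j) + G i • u j) (ε j), hY, div_mul_cancel₀ _ hY0, sub_self]

theorem inner_innovation_scheme {k : ℕ} (hk : k < n) :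
    inner ℝ (ε k) (ε k) = Yseq F G H X V k := by
  have hσu := inner_error_noise hσ0 hε hσ huu huv k
  have hξu : inner ℝ (comb (X k) (σ k) + v k) (u k) = (0 : ℝ) := by
    rw [inner_add_left, inner_comb_left, real_inner_comm, huv]
    simp [dotProduct, hσu]
  have hg := (gramMatrix_error hσ0 hε hσ hu huu huv hv hvv hk.le).1
  have hc := inner_error_input hσ0 hε hσ huv hvv k
  have hq := inner_input_self hσ0 hε hσ huv hv hvv hk
  rw [hg] at hc hq
  rw [hε, inner_innovation_self (hu k) hσu hξu, hc, hq, hg]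
  exact innovVar_toCov X V k

theorem inner_innovation_innovation {k j : ℕ} (hk : k < n) (hj : j < k) :
    inner ℝ (ε k) (ε j) = (0 : ℝ) := by
  have h1 : ∀ w : Fin m → ℝ, inner ℝ (comb w (σ k)) (ε j) = (0 : ℝ) := fun w => by
    rw [inner_comb_left]
    simp [dotProduct, (gramMatrix_error hσ0 hε hσ hu huu huv hv hvv hk.le).2 _ j hj]
  have h2 : inner ℝ (u k) (ε j) = (0 : ℝ) := by
    rw [real_inner_comm]
    exact inner_innovation_eq_zero hσ0 hε hσ (fun i hi => huu k i (lt_of_le_of_lt hi hj))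
      (fun i _ => by rw [real_inner_comm, huv])
  have h3 : inner ℝ (v k) (ε j) = (0 : ℝ) := by
    rw [real_inner_comm]
    exact inner_innovation_eq_zero hσ0 hε hσ (fun i _ => huv i k)
      (fun i hi => hvv k i (lt_of_le_of_lt hi hj))
  rw [hε k]
  simp only [inner_add_left, h1, h2, h3]
  ring

end scheme

/-! ### The linear encoder -/

section encoder

variable {m : ℕ} (F : Matrix (Fin m) (Fin m) ℝ) (G H : Fin m → ℝ) (X : ℕ → Fin m → ℝ)
  (V : ℕ → ℝ≥0)

/-- The innovation `(X_k + H) s̃_k + v_k + u_k` for the estimation error `s`. -/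
def innovation (s : Fin m → ℝ) (v u : ℕ → ℝ) (k : ℕ) : ℝ :=
  X k ⬝ᵥ s + v k + H ⬝ᵥ s + u k

/-- The estimation error of the linear scheme. -/
noncomputable def errState (v u : ℕ → ℝ) : ℕ → Fin m → ℝ
  | 0 => 0
  | k + 1 => F *ᵥ errState v u k + u k • G -
      innovation H X (errState v u k) v u k • Gam F G H X V k

/-- The estimate of the state from the outputs. -/
noncomputable def estimate (y : ℕ → ℝ) : ℕ → Fin m → ℝ
  | 0 => 0
  | k + 1 => F *ᵥ estimate y k + (y k - H ⬝ᵥ estimate y k) • Gam F G H X V k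

theorem estimate_congr {y y' : ℕ → ℝ} {k : ℕ} (h : ∀ j < k, y j = y' j) :
    estimate F G H X V y k = estimate F G H X V y' k := by
  induction k with
  | zero => rfl
  | succ k ih =>
    rw [estimate, estimate, ih fun j hj => h j (hj.trans k.lt_succ_self), h k k.lt_succ_self]

theorem errState_congr {v v' u u' : ℕ → ℝ} {k : ℕ} (hv : ∀ j < k, v j = v' j)
    (hu : ∀ j < k, u j = u' j) : errState F G H X V v u k = errState F G H X V v' u' k := by
  induction k with
  | zero => rfl
  | succ k ih =>
    rw [errState, errState, innovation, innovation,
      ih (fun j hj => hv j (hj.trans k.lt_succ_self)) (fun j hj => hu j (hj.trans k.lt_succ_self)),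
      hv k k.lt_succ_self, hu k k.lt_succ_self]

theorem continuous_estimate {α : Type*} [TopologicalSpace α] {y : α → ℕ → ℝ}
    (hy : ∀ j, Continuous fun a => y a j) (k : ℕ) :
    Continuous fun a => estimate F G H X V (y a) k := by
  induction k with
  | zero => exact continuous_const
  | succ k ih =>
    have := hy k
    simp only [estimate]
    fun_prop

theorem continuous_extendZero {k : ℕ} (j : ℕ) :
    Continuous fun y : Fin k → ℝ => extendZero y j := by
  unfold extendZero
  split_ifs
  · exact continuous_apply _
  · exact continuous_const

/-- The feedback code of the linear scheme: `X_k s̃_k + v_k` as a function of the message `v`,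
the past symbols and the past outputs. -/
noncomputable def linearCode (n k : ℕ) (z : (Fin n → ℝ) × (Fin k → ℝ) × (Fin k → ℝ)) : ℝ :=
  X k ⬝ᵥ (noiseState (F - vecMulVec G H) G
    (fun j => extendZero z.2.2 j - extendZero z.2.1 j) k -
      estimate F G H X V (extendZero z.2.2) k) + extendZero z.1 k

theorem continuous_linearCode (n k : ℕ) : Continuous (linearCode F G H X V n k) := by
  have h1 : ∀ j, Continuous fun z : (Fin n → ℝ) × (Fin k → ℝ) × (Fin k → ℝ) =>
      extendZero z.2.2 j := fun j => (continuous_extendZero j).comp (by fun_prop)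
  have h2 : ∀ j, Continuous fun z : (Fin n → ℝ) × (Fin k → ℝ) × (Fin k → ℝ) =>
      extendZero z.2.1 j := fun j => (continuous_extendZero j).comp (by fun_prop)
  have h3 : Continuous fun z : (Fin n → ℝ) × (Fin k → ℝ) × (Fin k → ℝ) =>
      extendZero z.1 k := (continuous_extendZero k).comp (by fun_prop)
  have h4 := continuous_estimate F G H X V
    (y := fun z : (Fin n → ℝ) × (Fin k → ℝ) × (Fin k → ℝ) => extendZero z.2.2) h1 k
  have h5 := continuous_noiseState (F := F - vecMulVec G H) (G := G) (k := k)
    (u := fun z : (Fin n → ℝ) × (Fin k → ℝ) × (Fin k → ℝ) =>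
      fun j => extendZero z.2.2 j - extendZero z.2.1 j) fun j _ => (h1 j).sub (h2 j)
  unfold linearCode
  exact (Continuous.dotProduct continuous_const (h5.sub h4)).add h3

/-- The encoder of the linear scheme. -/
noncomputable def linearEncoder (n : ℕ) : Encoder (Fin n → ℝ) where
  f := linearCode F G H X V n
  measurable_f k := (continuous_linearCode F G H X V n k).measurable

variable {n : ℕ} (ω : (Fin n → ℝ) × (ℕ → ℝ))

/-- The estimation error as a random variable. -/
noncomputable def errAt (k : ℕ) : Fin m → ℝ := errState F G H X V (extendZero ω.1) ω.2 k

/-- The innovation as a random variable. -/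
noncomputable def innovAt (k : ℕ) : ℝ :=
  innovation H X (errAt F G H X V ω k) (extendZero ω.1) ω.2 k

/-- The encoder knows its own past symbols, so it recovers the noise `y - x` and from it the exact
state `s_k`; the estimate uses the outputs only. -/
theorem sent_linearEncoder_aux (k : ℕ) :
    sent F G H (linearEncoder F G H X V n) k ω = X k ⬝ᵥ (noiseState F G ω.2 k -
      estimate F G H X V (fun j => received F G H (linearEncoder F G H X V n) j ω) k) +
      extendZero ω.1 k := by
  rw [sent_eq]
  change linearCode F G H X V n k _ = _
  rw [linearCode]
  congr 3
  · rw [← noiseState_received F G H (linearEncoder F G H X V n) k ω]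
    refine noiseState_congr fun j hj => ?_
    simp [extendZero, hj, decodedInput_received]
  · refine estimate_congr F G H X V fun j hj => ?_
    simp [extendZero, hj]

/-- The output differs from its prediction `H ŝ_k` by the innovation `(X_k + H) s̃_k + v_k + u_k`,
so state minus estimate satisfies the recursion of `errState`. -/
theorem noiseState_sub_estimate (k : ℕ) :
    noiseState F G ω.2 k -
      estimate F G H X V (fun j => received F G H (linearEncoder F G H X V n) j ω) k =
      errAt F G H X V ω k := by
  induction k with
  | zero => simp [noiseState, estimate, errAt, errState]
  | succ k ih =>
    have h1 : received F G H (linearEncoder F G H X V n) k ω = X k ⬝ᵥ errAt F G H X V ω k +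
        extendZero ω.1 k + (H ⬝ᵥ noiseState F G ω.2 k + ω.2 k) := by
      rw [received, sent_linearEncoder_aux, ih, noise]
    have h2 : noiseState F G ω.2 k = errAt F G H X V ω k +
        estimate F G H X V (fun j => received F G H (linearEncoder F G H X V n) j ω) k := by
      rw [← ih, sub_add_cancel]
    rw [noiseState, estimate, h1]
    change _ = F *ᵥ errAt F G H X V ω k + ω.2 k • G -
      innovation H X (errAt F G H X V ω k) (extendZero ω.1) ω.2 k • Gam F G H X V k
    rw [h2, mulVec_add, dotProduct_add, innovation]
    module

theorem sent_linearEncoder (k : ℕ) :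
    sent F G H (linearEncoder F G H X V n) k ω =
      X k ⬝ᵥ errAt F G H X V ω k + extendZero ω.1 k := by
  rw [sent_linearEncoder_aux, noiseState_sub_estimate]

/-- The predictor of the outputs in the linear scheme. -/
noncomputable def linearSchemePredictor (k : ℕ) (z : Unit × (Fin k → ℝ)) : ℝ :=
  H ⬝ᵥ estimate F G H X V (extendZero z.2) k

theorem measurable_linearSchemePredictor (k : ℕ) :
    Measurable (linearSchemePredictor F G H X V k) := by
  have h := continuous_estimate F G H X V (y := fun z : Unit × (Fin k → ℝ) => extendZero z.2)
    (fun j => (continuous_extendZero j).comp continuous_snd) k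
  exact (Continuous.dotProduct continuous_const h).measurable

theorem estimate_receivedBefore (k : ℕ) :
    estimate F G H X V (extendZero (receivedBefore F G H (linearEncoder F G H X V n) k ω)) k =
      estimate F G H X V (fun j => received F G H (linearEncoder F G H X V n) j ω) k := by
  refine estimate_congr F G H X V fun j hj => ?_
  simp [extendZero, hj, receivedBefore]

theorem innov_linearSchemePredictor (N : ℕ) (k : Fin N) :
    innov (linearSchemePredictor F G H X V) N
      ((), receivedBefore F G H (linearEncoder F G H X V n) N ω) k =
      innovAt F G H X V ω k := by
  have h := estimate_receivedBefore F G H X V ω k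
  have h2 := noiseState_sub_estimate F G H X V ω k
  change received F G H (linearEncoder F G H X V n) k ω - H ⬝ᵥ estimate F G H X V
    (extendZero (receivedBefore F G H (linearEncoder F G H X V n) k ω)) k = _
  rw [h, received, sent_linearEncoder, noise, innovAt, innovation, ← h2, dotProduct_sub H]
  ring

end encoder

end FeedbackChannel

namespace FeedbackChannel

open Filter Topology

/-! ### Linearity of the linear scheme -/

section linear

variable {m : ℕ} (F : Matrix (Fin m) (Fin m) ℝ) (G H : Fin m → ℝ) (X : ℕ → Fin m → ℝ)
  (V : ℕ → ℝ≥0)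

/-- The gains are deterministic, so the errors are linear in the pair `(v, u)`; this is the source
of joint Gaussianity. -/
theorem errState_add (v v' u u' : ℕ → ℝ) (k : ℕ) :
    errState F G H X V (v + v') (u + u') k =
      errState F G H X V v u k + errState F G H X V v' u' k := by
  induction k with
  | zero => simp [errState]
  | succ k ih =>
    simp only [errState, innovation, ih, mulVec_add, dotProduct_add, Pi.add_apply]
    module

theorem errState_smul (c : ℝ) (v u : ℕ → ℝ) (k : ℕ) :
    errState F G H X V (c • v) (c • u) k = c • errState F G H X V v u k := by
  induction k with
  | zero => simp [errState]
  | succ k ih =>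
    simp only [errState, innovation, ih, mulVec_smul, dotProduct_smul, Pi.smul_apply, smul_eq_mul]
    module

theorem extendZero_add {k : ℕ} (y y' : Fin k → ℝ) :
    extendZero (y + y') = extendZero y + extendZero y' := by
  ext j
  by_cases hj : j < k <;> simp [extendZero, hj]

theorem extendZero_smul {k : ℕ} (c : ℝ) (y : Fin k → ℝ) :
    extendZero (c • y) = c • extendZero y := by
  ext j
  by_cases hj : j < k <;> simp [extendZero, hj]

/-- The estimation error as a linear map of the message and the noise over the horizon `n`. -/
noncomputable def errLinear (n k : ℕ) : (Fin n → ℝ) × (Fin n → ℝ) →L[ℝ] (Fin m → ℝ) :=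
  LinearMap.toContinuousLinearMap
    { toFun := fun z => errState F G H X V (extendZero z.1) (extendZero z.2) k
      map_add' := fun z z' => by
        rw [Prod.fst_add, Prod.snd_add, extendZero_add, extendZero_add, errState_add]
      map_smul' := fun c z => by
        rw [Prod.smul_fst, Prod.smul_snd, extendZero_smul, extendZero_smul, errState_smul]
        rfl }

/-- The innovation as a linear map of the message and the noise over the horizon `n`. -/
noncomputable def innovLinear (n k : ℕ) : (Fin n → ℝ) × (Fin n → ℝ) →L[ℝ] ℝ :=
  LinearMap.toContinuousLinearMap
    { toFun := fun z => innovation H X (errState F G H X V (extendZero z.1) (extendZero z.2) k)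
        (extendZero z.1) (extendZero z.2) k
      map_add' := fun z z' => by
        simp only [Prod.fst_add, Prod.snd_add, extendZero_add, errState_add, innovation,
          dotProduct_add, Pi.add_apply]
        ring
      map_smul' := fun c z => by
        simp only [Prod.smul_fst, Prod.smul_snd, extendZero_smul, errState_smul, innovation,
          dotProduct_smul, Pi.smul_apply, smul_eq_mul, RingHom.id_apply]
        ring }

variable {n : ℕ} (ω : (Fin n → ℝ) × (ℕ → ℝ))

theorem errAt_eq_errLinear {k : ℕ} (hk : k ≤ n) :
    errAt F G H X V ω k = errLinear F G H X V n k (ω.1, fun i : Fin n => ω.2 i) := by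
  refine errState_congr F G H X V (fun _ _ => rfl) fun j hj => ?_
  simp [extendZero, hj.trans_le hk]

theorem innovAt_eq_innovLinear {k : ℕ} (hk : k < n) :
    innovAt F G H X V ω k = innovLinear F G H X V n k (ω.1, fun i : Fin n => ω.2 i) := by
  have h := errAt_eq_errLinear F G H X V ω hk.le
  have h2 : ω.2 k = extendZero (fun i : Fin n => ω.2 i) k := by simp [extendZero, hk]
  rw [innovAt, h, innovation, h2]
  rfl

theorem errAt_succ_apply (k : ℕ) (i : Fin m) :
    errAt F G H X V ω (k + 1) i =
      F i ⬝ᵥ errAt F G H X V ω k + G i * ω.2 k + -Gam F G H X V k i * innovAt F G H X V ω k := by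
  change (F *ᵥ errAt F G H X V ω k + ω.2 k • G -
    innovAt F G H X V ω k • Gam F G H X V k) i = _
  simp only [Pi.sub_apply, Pi.add_apply, Pi.smul_apply, smul_eq_mul]
  change F i ⬝ᵥ errAt F G H X V ω k + _ - _ = _
  ring

end linear

/-! ### The Gaussian message -/

section gaussianMessage

/-- The law of the message `v`: independent centered Gaussians with variances `V`. -/
noncomputable def gaussMessage (n : ℕ) (V : ℕ → ℝ≥0) : Measure (Fin n → ℝ) :=
  Measure.pi fun i : Fin n => gaussianReal 0 (V i)

instance (n : ℕ) (V : ℕ → ℝ≥0) : IsProbabilityMeasure (gaussMessage n V) := by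
  unfold gaussMessage
  infer_instance

theorem isGaussian_pi {n : ℕ} (D : Fin n → ℝ≥0) :
    IsGaussian (Measure.pi fun i => gaussianReal 0 (D i)) := by
  have h1 : iIndepFun (fun (i : Fin n) (w : Fin n → ℝ) => w i)
      (Measure.pi fun i => gaussianReal 0 (D i)) :=
    iIndepFun_pi (X := fun _ x => x) fun i => aemeasurable_id
  have h2 : ∀ i, HasGaussianLaw (fun w : Fin n → ℝ => w i)
      (Measure.pi fun i => gaussianReal 0 (D i)) := fun i => by
    have h3 := (measurePreserving_eval (fun i => gaussianReal 0 (D i)) i)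
    have h4 : HasLaw (fun w : Fin n → ℝ => w i) (gaussianReal 0 (D i))
      (Measure.pi fun i => gaussianReal 0 (D i)) := ⟨h3.measurable.aemeasurable, h3.map_eq⟩
    exact h4.hasGaussianLaw
  have h5 := (iIndepFun.hasGaussianLaw h2 h1).isGaussian_map
  rwa [show (fun (w : Fin n → ℝ) (i : Fin n) => w i) = id from rfl, Measure.map_id] at h5

variable {n : ℕ} {V : ℕ → ℝ≥0}

theorem hasGaussianLaw_message_noise :
    HasGaussianLaw (fun ω : (Fin n → ℝ) × (ℕ → ℝ) => (ω.1, fun i : Fin n => ω.2 i))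
      (jointLaw (gaussMessage n V)) := by
  have h1 : (jointLaw (gaussMessage n V)).map (fun ω => (ω.1, fun i : Fin n => ω.2 i)) =
      (gaussMessage n V).prod (Measure.pi fun _ : Fin n => gaussianReal 0 1) := by
    have : (fun ω : (Fin n → ℝ) × (ℕ → ℝ) => (ω.1, fun i : Fin n => ω.2 i)) =
      Prod.map id fun (u : ℕ → ℝ) (i : Fin n) => u i := rfl
    rw [this, jointLaw, ← Measure.map_prod_map _ _ measurable_id (by fun_prop), Measure.map_id,
      map_whiteNoise_restrict]
  have h2 : IsGaussian (gaussMessage n V) := isGaussian_pi _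
  have h3 := isGaussian_pi fun _ : Fin n => (1 : ℝ≥0)
  constructor
  rw [h1]
  infer_instance

theorem hasLaw_message (i : Fin n) :
    HasLaw (fun ω : (Fin n → ℝ) × (ℕ → ℝ) => ω.1 i) (gaussianReal 0 (V i))
      (jointLaw (gaussMessage n V)) := by
  refine ⟨by fun_prop, ?_⟩
  have h : (fun ω : (Fin n → ℝ) × (ℕ → ℝ) => ω.1 i) = (fun w : Fin n → ℝ => w i) ∘ Prod.fst := rfl
  rw [h, ← Measure.map_map (measurable_pi_apply i) measurable_fst, map_fst_jointLaw]
  exact (measurePreserving_eval (fun i : Fin n => gaussianReal 0 (V i)) i).map_eq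

theorem memLp_message (k : ℕ) :
    MemLp (fun ω : (Fin n → ℝ) × (ℕ → ℝ) => extendZero ω.1 k) 2 (jointLaw (gaussMessage n V)) := by
  by_cases hk : k < n
  · simp only [extendZero, hk, dif_pos]
    have h := memLp_id_gaussianReal' (μ := 0) (v := V k) 2 (by simp)
    have h2 := hasLaw_message (V := V) (⟨k, hk⟩ : Fin n)
    rw [← h2.map_eq] at h
    exact (memLp_map_measure_iff aestronglyMeasurable_id h2.aemeasurable).1 h
  · simp only [extendZero, hk, dif_neg, not_false_eq_true]
    exact MemLp.zero'

theorem integral_message (k : ℕ) :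
    ∫ ω, extendZero ω.1 k ∂(jointLaw (gaussMessage n V)) = 0 := by
  by_cases hk : k < n
  · simp only [extendZero, hk, dif_pos]
    rw [(hasLaw_message (V := V) (⟨k, hk⟩ : Fin n)).integral_eq]
    exact integral_id_gaussianReal
  · simp [extendZero, hk]

theorem integral_message_sq {k : ℕ} (hk : k < n) :
    ∫ ω, extendZero ω.1 k * extendZero ω.1 k ∂(jointLaw (gaussMessage n V)) = V k := by
  simp only [extendZero, hk, dif_pos]
  have h2 := hasLaw_message (V := V) (⟨k, hk⟩ : Fin n)
  have h := integral_map h2.aemeasurable (f := fun x : ℝ => x * x) (by fun_prop)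
  rw [← h, h2.map_eq]
  simp only [← sq]
  exact integral_sq_gaussianReal (V k)

theorem integral_message_mul_message {j k : ℕ} (hjk : j < k) :
    ∫ ω, extendZero ω.1 j * extendZero ω.1 k ∂(jointLaw (gaussMessage n V)) = 0 := by
  by_cases hk : k < n
  · have hj := hjk.trans hk
    have h1 : IndepFun (fun w : Fin n → ℝ => w ⟨j, hj⟩) (fun w => w ⟨k, hk⟩) (gaussMessage n V) :=
      (iIndepFun_pi (X := fun _ x => x) (μ := fun i : Fin n => gaussianReal 0 (V i))
        fun i => aemeasurable_id).indepFun (by simpa using hjk.ne)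
    have h2 := h1.integral_fun_mul_eq_mul_integral
      (measurable_pi_apply _).aestronglyMeasurable (measurable_pi_apply _).aestronglyMeasurable
    have h3 : ∫ w : Fin n → ℝ, w ⟨j, hj⟩ ∂(gaussMessage n V) = 0 :=
      (integral_comp_eval (μ := fun i : Fin n => gaussianReal 0 (V i)) (f := fun x : ℝ => x)
        (by fun_prop)).trans integral_id_gaussianReal
    rw [h3, zero_mul] at h2
    have h4 := integral_map (μ := jointLaw (gaussMessage n V)) (φ := Prod.fst)
      measurable_fst.aemeasurable
      (f := fun w : Fin n → ℝ => w ⟨j, hj⟩ * w ⟨k, hk⟩) (by fun_prop)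
    rw [map_fst_jointLaw, h2] at h4
    simp only [extendZero, hk, hj, dif_pos]
    exact h4.symm
  · simp [extendZero, hk]

theorem integral_noise_mul_message (j k : ℕ) :
    ∫ ω, ω.2 j * extendZero ω.1 k ∂(jointLaw (gaussMessage n V)) = 0 := by
  have h := integral_mul_noise (gaussMessage n V) j (φ := fun z => extendZero z.1 k)
    ((measurable_extendZero k).comp measurable_fst)
  simpa only [mul_comm] using h

end gaussianMessage

end FeedbackChannel

namespace FeedbackChannel

open Filter Topology

/-! ### The linear scheme with a Gaussian message -/

section achievability

variable {m : ℕ} (F : Matrix (Fin m) (Fin m) ℝ) (G H : Fin m → ℝ) (X : ℕ → Fin m → ℝ)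
  (V : ℕ → ℝ≥0) (n : ℕ)

theorem memLp_innovAt_of_memLp_errAt {k : ℕ}
    (h : ∀ i, MemLp (fun ω => errAt F G H X V ω k i) 2 (jointLaw (gaussMessage n V))) :
    MemLp (fun ω => innovAt F G H X V ω k) 2 (jointLaw (gaussMessage n V)) :=
  (((memLp_dotProduct (X k) h).add (memLp_message k)).add (memLp_dotProduct H h)).add
    (memLp_noise _ k)

theorem memLp_errAt (k : ℕ) (i : Fin m) :
    MemLp (fun ω => errAt F G H X V ω k i) 2 (jointLaw (gaussMessage n V)) := by
  induction k generalizing i with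
  | zero => exact MemLp.zero'
  | succ k ih =>
    simp only [errAt_succ_apply]
    exact ((memLp_dotProduct (F i) ih).add ((memLp_noise _ k).const_mul (G i))).add
      ((memLp_innovAt_of_memLp_errAt F G H X V n ih).const_mul _)

theorem memLp_innovAt (k : ℕ) :
    MemLp (fun ω => innovAt F G H X V ω k) 2 (jointLaw (gaussMessage n V)) :=
  memLp_innovAt_of_memLp_errAt F G H X V n (memLp_errAt F G H X V n k)

/-- The estimation errors as elements of `L²`. -/
noncomputable def errVec (k : ℕ) (i : Fin m) : Lp ℝ 2 (jointLaw (gaussMessage n V)) :=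
  toL2 _ fun ω => errAt F G H X V ω k i

/-- The innovations as elements of `L²`. -/
noncomputable def innovVec (k : ℕ) : Lp ℝ 2 (jointLaw (gaussMessage n V)) :=
  toL2 _ fun ω => innovAt F G H X V ω k

/-- The driving noise as elements of `L²`. -/
noncomputable def noiseVec (k : ℕ) : Lp ℝ 2 (jointLaw (gaussMessage n V)) :=
  toL2 _ fun ω => ω.2 k

/-- The message as elements of `L²`. -/
noncomputable def messageVec (k : ℕ) : Lp ℝ 2 (jointLaw (gaussMessage n V)) :=
  toL2 _ fun ω => extendZero ω.1 k

theorem errVec_zero : errVec F G H X V n 0 = 0 := by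
  ext1 i
  exact toL2_zero

theorem innovVec_eq (k : ℕ) : innovVec F G H X V n k = comb (X k) (errVec F G H X V n k) +
    messageVec V n k + comb H (errVec F G H X V n k) + noiseVec V n k := by
  have h := memLp_errAt F G H X V n k
  have h1 := memLp_dotProduct (X k) h
  have h2 := memLp_message (n := n) (V := V) k
  have h3 := memLp_dotProduct H h
  have h4 := memLp_noise (gaussMessage n V) k
  have e : innovVec F G H X V n k = toL2 _ fun ω => X k ⬝ᵥ errAt F G H X V ω k +
    extendZero ω.1 k + H ⬝ᵥ errAt F G H X V ω k + ω.2 k := rfl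
  have h5 : MemLp (fun ω => X k ⬝ᵥ errAt F G H X V ω k + extendZero ω.1 k) 2
    (jointLaw (gaussMessage n V)) := h1.add h2
  have h6 : MemLp (fun ω => X k ⬝ᵥ errAt F G H X V ω k + extendZero ω.1 k +
    H ⬝ᵥ errAt F G H X V ω k) 2 (jointLaw (gaussMessage n V)) := h5.add h3
  rw [e, toL2_add h6 h4, toL2_add h5 h3, toL2_add h1 h2,
    toL2_dotProduct _ h, toL2_dotProduct _ h]
  rfl

theorem errVec_succ (k : ℕ) (i : Fin m) : errVec F G H X V n (k + 1) i =
    comb (F i) (errVec F G H X V n k) + G i • noiseVec V n k -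
      Gam F G H X V k i • innovVec F G H X V n k := by
  have h := memLp_errAt F G H X V n k
  have h1 := memLp_dotProduct (F i) h
  have h2 := (memLp_noise (gaussMessage n V) k).const_mul (G i)
  have h3 := (memLp_innovAt F G H X V n k).const_mul (-Gam F G H X V k i)
  have e : errVec F G H X V n (k + 1) i = toL2 _ fun ω => F i ⬝ᵥ errAt F G H X V ω k +
      G i * ω.2 k + -Gam F G H X V k i * innovAt F G H X V ω k := by
    rw [errVec]
    simp only [errAt_succ_apply]
  have h4 : MemLp (fun ω : (Fin n → ℝ) × (ℕ → ℝ) => (F i ⬝ᵥ errAt F G H X V ω k) + G i * ω.2 k) 2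
    (jointLaw (gaussMessage n V)) := h1.add h2
  rw [e, toL2_add h4 h3, toL2_add h1 h2, toL2_dotProduct _ h,
    toL2_const_mul _ (memLp_noise (gaussMessage n V) k), toL2_const_mul _ (memLp_innovAt F G H X V n k), neg_smul,
    ← sub_eq_add_neg]
  rfl

theorem inner_noiseVec_self (k : ℕ) : inner ℝ (noiseVec V n k) (noiseVec V n k) = (1 : ℝ) := by
  rw [noiseVec, inner_toL2 (memLp_noise (gaussMessage n V) k) (memLp_noise (gaussMessage n V) k),
    ← integral_noise_sq (gaussMessage n V) k]
  simp only [sq]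

theorem inner_noiseVec_noiseVec (k : ℕ) :
    ∀ j < k, inner ℝ (noiseVec V n j) (noiseVec V n k) = (0 : ℝ) := fun j hj => by
  rw [noiseVec, noiseVec, inner_toL2 (memLp_noise (gaussMessage n V) j)
    (memLp_noise (gaussMessage n V) k)]
  exact integral_mul_noise (gaussMessage n V) k (φ := fun z => z.2 ⟨j, hj⟩) (by fun_prop)

theorem inner_noiseVec_messageVec (j k : ℕ) :
    inner ℝ (noiseVec V n j) (messageVec V n k) = (0 : ℝ) := by
  rw [noiseVec, messageVec, inner_toL2 (memLp_noise (gaussMessage n V) j) (memLp_message k)]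
  exact integral_noise_mul_message j k

theorem inner_messageVec_self : ∀ k < n,
    inner ℝ (messageVec V n k) (messageVec V n k) = (V k : ℝ) := fun k hk => by
  rw [messageVec, inner_toL2 (memLp_message k) (memLp_message k)]
  exact integral_message_sq hk

theorem inner_messageVec_messageVec (k : ℕ) :
    ∀ j < k, inner ℝ (messageVec V n j) (messageVec V n k) = (0 : ℝ) := fun j hj => by
  rw [messageVec, messageVec, inner_toL2 (memLp_message j) (memLp_message k)]
  exact integral_message_mul_message hj

variable {F G H X V n}

theorem inner_noiseVec_one (k : ℕ) :
    inner ℝ (noiseVec V n k) (toL2 _ fun _ => (1 : ℝ)) = (0 : ℝ) := by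
  rw [noiseVec, inner_toL2 (memLp_noise (gaussMessage n V) k) (memLp_const 1)]
  simpa using integral_noise (gaussMessage n V) k

theorem inner_messageVec_one (k : ℕ) :
    inner ℝ (messageVec V n k) (toL2 _ fun _ => (1 : ℝ)) = (0 : ℝ) := by
  rw [messageVec, inner_toL2 (memLp_message k) (memLp_const 1)]
  simpa using integral_message (n := n) (V := V) k

/-- The mean is the inner product with the constant function one, which is orthogonal to all noise
and message components. -/
theorem integral_errAt (k : ℕ) (i : Fin m) :
    ∫ ω, errAt F G H X V ω k i ∂(jointLaw (gaussMessage n V)) = 0 := by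
  have h := inner_error_eq_zero (errVec_zero F G H X V n) (innovVec_eq F G H X V n)
    (errVec_succ F G H X V n) (o := toL2 _ fun _ => (1 : ℝ)) (k := k)
    (fun j _ => inner_noiseVec_one j) (fun j _ => inner_messageVec_one j) i
  rw [errVec, inner_toL2 (memLp_errAt F G H X V n k i) (memLp_const 1)] at h
  simpa using h

theorem integral_innovAt (k : ℕ) :
    ∫ ω, innovAt F G H X V ω k ∂(jointLaw (gaussMessage n V)) = 0 := by
  have h := inner_innovation_eq_zero (errVec_zero F G H X V n) (innovVec_eq F G H X V n)
    (errVec_succ F G H X V n) (o := toL2 _ fun _ => (1 : ℝ)) (k := k)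
    (fun j _ => inner_noiseVec_one j) (fun j _ => inner_messageVec_one j)
  rw [innovVec, inner_toL2 (memLp_innovAt F G H X V n k) (memLp_const 1)] at h
  simpa using h

theorem integral_innovAt_sq {k : ℕ} (hk : k < n) :
    ∫ ω, innovAt F G H X V ω k ^ 2 ∂(jointLaw (gaussMessage n V)) = Yseq F G H X V k := by
  have h := inner_innovation_scheme (errVec_zero F G H X V n) (innovVec_eq F G H X V n)
    (errVec_succ F G H X V n) (inner_noiseVec_self V n) (inner_noiseVec_noiseVec V n)
    (inner_noiseVec_messageVec V n) (inner_messageVec_self V n) (inner_messageVec_messageVec V n) hk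
  rw [innovVec, inner_toL2 (memLp_innovAt F G H X V n k) (memLp_innovAt F G H X V n k)] at h
  simpa only [sq] using h

theorem integral_innovAt_mul_innovAt {j k : ℕ} (hk : k < n) (hj : j < k) :
    ∫ ω, innovAt F G H X V ω k * innovAt F G H X V ω j ∂(jointLaw (gaussMessage n V)) = 0 := by
  have h := inner_innovation_innovation (errVec_zero F G H X V n) (innovVec_eq F G H X V n)
    (errVec_succ F G H X V n) (inner_noiseVec_self V n) (inner_noiseVec_noiseVec V n)
    (inner_noiseVec_messageVec V n) (inner_messageVec_self V n) (inner_messageVec_messageVec V n)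
    hk hj
  rwa [innovVec, innovVec, inner_toL2 (memLp_innovAt F G H X V n k)
    (memLp_innovAt F G H X V n j)] at h

theorem integral_errAt_mul_innovAt {j k : ℕ} (hk : k ≤ n) (hj : j < k) (i : Fin m) :
    ∫ ω, errAt F G H X V ω k i * innovAt F G H X V ω j ∂(jointLaw (gaussMessage n V)) = 0 := by
  have h := (gramMatrix_error (errVec_zero F G H X V n) (innovVec_eq F G H X V n)
    (errVec_succ F G H X V n) (inner_noiseVec_self V n) (inner_noiseVec_noiseVec V n)
    (inner_noiseVec_messageVec V n) (inner_messageVec_self V n) (inner_messageVec_messageVec V n)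
    hk).2 i j hj
  rwa [errVec, innovVec, inner_toL2 (memLp_errAt F G H X V n k i)
    (memLp_innovAt F G H X V n j)] at h

theorem power_linearEncoder {k : ℕ} (hk : k < n) :
    power F G H (linearEncoder F G H X V n) (gaussMessage n V) k = inputPower F G H X V k := by
  have he := memLp_dotProduct (X k) (memLp_errAt F G H X V n k)
  have hm := memLp_message (n := n) (V := V) k
  have h := inner_input_self (errVec_zero F G H X V n) (innovVec_eq F G H X V n)
    (errVec_succ F G H X V n)
    (inner_noiseVec_messageVec V n) (inner_messageVec_self V n) (inner_messageVec_messageVec V n) hk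
  rw [(gramMatrix_error (errVec_zero F G H X V n) (innovVec_eq F G H X V n)
    (errVec_succ F G H X V n) (inner_noiseVec_self V n) (inner_noiseVec_noiseVec V n)
    (inner_noiseVec_messageVec V n) (inner_messageVec_self V n) (inner_messageVec_messageVec V n)
    hk.le).1] at h
  have h2 : comb (X k) (errVec F G H X V n k) + messageVec V n k =
      toL2 _ fun ω => X k ⬝ᵥ errAt F G H X V ω k + extendZero ω.1 k := by
    rw [toL2_add he hm, toL2_dotProduct _ (memLp_errAt F G H X V n k)]
    rfl
  have h3 : MemLp (fun ω => X k ⬝ᵥ errAt F G H X V ω k + extendZero ω.1 k) 2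
    (jointLaw (gaussMessage n V)) := he.add hm
  rw [h2, inner_toL2 h3 h3] at h
  rw [inputPower, ← h, power]
  simp only [sent_linearEncoder]
  rw [lintegral_sq_eq h3]
  simp only [sq]

end achievability

end FeedbackChannel

namespace FeedbackChannel

open Filter Topology

/-! ### Laws in the linear scheme -/

section laws

variable {m : ℕ} (F : Matrix (Fin m) (Fin m) ℝ) (G H : Fin m → ℝ) (X : ℕ → Fin m → ℝ)
  (V : ℕ → ℝ≥0) (n : ℕ)

/-- `Y_k` as a nonnegative real number. -/
noncomputable def outputVarNN (k : ℕ) : ℝ≥0 :=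
  ⟨Yseq F G H X V k, zero_le_one.trans (one_le_Yseq X V k)⟩

theorem hasGaussianLaw_innovAt :
    HasGaussianLaw (fun ω (k : Fin n) => innovAt F G H X V ω k) (jointLaw (gaussMessage n V)) := by
  have h := hasGaussianLaw_message_noise.map_fun (P := jointLaw (gaussMessage n V))
    (ContinuousLinearMap.pi fun k : Fin n => innovLinear F G H X V n k)
  have e : (fun (ω : (Fin n → ℝ) × (ℕ → ℝ)) (k : Fin n) => innovAt F G H X V ω k) = fun ω =>
      ContinuousLinearMap.pi (fun k : Fin n => innovLinear F G H X V n k)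
        (ω.1, fun i : Fin n => ω.2 i) := by
    ext ω k
    exact innovAt_eq_innovLinear F G H X V ω k.2
  rwa [e]

theorem hasGaussianLaw_errAt_innovAt {k : ℕ} (hk : k ≤ n) :
    HasGaussianLaw (fun ω => (fun i => errAt F G H X V ω k i,
      fun j : Fin k => innovAt F G H X V ω j)) (jointLaw (gaussMessage n V)) := by
  have h := hasGaussianLaw_message_noise.map_fun (P := jointLaw (gaussMessage n V))
    ((errLinear F G H X V n k).prod
      (ContinuousLinearMap.pi fun j : Fin k => innovLinear F G H X V n j))
  have e : (fun ω : (Fin n → ℝ) × (ℕ → ℝ) => (fun i => errAt F G H X V ω k i,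
      fun j : Fin k => innovAt F G H X V ω j)) = fun ω =>
      (errLinear F G H X V n k).prod
        (ContinuousLinearMap.pi fun j : Fin k => innovLinear F G H X V n j)
        (ω.1, fun i : Fin n => ω.2 i) := by
    ext1 ω
    refine Prod.ext (errAt_eq_errLinear F G H X V ω hk) ?_
    ext j
    exact innovAt_eq_innovLinear F G H X V ω (j.2.trans_le hk)
  rwa [e]

/-- The innovations are jointly Gaussian, centered and uncorrelated, hence independent. -/
theorem map_innovAt :
    (jointLaw (gaussMessage n V)).map (fun ω (k : Fin n) => innovAt F G H X V ω k) =
      Measure.pi fun k : Fin n => gaussianReal 0 (outputVarNN F G H X V k) := by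
  have hg := hasGaussianLaw_innovAt F G H X V n
  have hL := fun k : ℕ => memLp_innovAt F G H X V n k
  have hcov : ∀ j k : Fin n, k < j →
      cov[fun ω => innovAt F G H X V ω j, fun ω => innovAt F G H X V ω k;
        jointLaw (gaussMessage n V)] = 0 := fun j k hjk => by
    rw [covariance_eq_sub (hL j) (hL k), integral_innovAt, zero_mul, sub_zero]
    exact integral_innovAt_mul_innovAt j.2 hjk
  have hind := hg.iIndepFun_of_covariance_eq_zero (X := fun (k : Fin n) ω => innovAt F G H X V ω k)
    fun j k hjk => by
      rcases lt_or_gt_of_ne hjk with h | h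
      · rw [covariance_comm]
        exact hcov k j h
      · exact hcov j k h
  rw [(iIndepFun_iff_map_fun_eq_pi_map fun k : Fin n => (hL k).1.aemeasurable).1 hind]
  congr 1
  ext1 k
  rw [(hg.eval k).map_eq_gaussianReal, integral_innovAt,
    variance_of_integral_eq_zero (hL k).1.aemeasurable (integral_innovAt _),
    integral_innovAt_sq k.2]
  congr 1
  exact Real.toNNReal_coe (r := outputVarNN F G H X V k)

theorem info_linearEncoder :
    info F G H (linearEncoder F G H X V n) (gaussMessage n V) n =
      ENNReal.ofReal (1 / 2 * ∑ k ∈ Finset.range n, Real.log (Yseq F G H X V k)) := by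
  have h := info_eq F G H (linearEncoder F G H X V n) (gaussMessage n V)
    (measurable_linearSchemePredictor F G H X V)
    (D := fun k : Fin n => outputVarNN F G H X V k)
    (fun k => ?_) (fun k => ?_) (fun k => ?_) ?_
  · rw [h, Finset.sum_range]
    rfl
  · exact ne_of_gt (zero_lt_one.trans_le (one_le_Yseq (F := F) (G := G) (H := H) X V k) :
      (0 : ℝ≥0) < outputVarNN F G H X V k)
  · simp only [innov_linearSchemePredictor]
    exact (memLp_innovAt F G H X V n k).integrable_sq
  · simp only [innov_linearSchemePredictor]
    exact integral_innovAt_sq k.2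
  · rw [← map_innovAt]
    congr 1
    ext ω k
    exact innov_linearSchemePredictor F G H X V ω n k

/-- The error is uncorrelated with the earlier innovations and jointly Gaussian with them, hence
independent of them; the outputs before time `k` are a measurable function of those innovations. -/
theorem indepFun_errAt_receivedBefore {k : ℕ} (hk : k ≤ n) :
    IndepFun (fun ω => errAt F G H X V ω k)
      (receivedBefore F G H (linearEncoder F G H X V n) k) (jointLaw (gaussMessage n V)) := by
  have h1 := (hasGaussianLaw_errAt_innovAt F G H X V n hk).indepFun_of_covariance_eval
    (X := fun i ω => errAt F G H X V ω k i) (Y := fun (j : Fin k) ω => innovAt F G H X V ω j)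
    fun i j => by
      rw [covariance_eq_sub (memLp_errAt F G H X V n k i) (memLp_innovAt F G H X V n j),
        integral_errAt, zero_mul, sub_zero]
      exact integral_errAt_mul_innovAt hk j.2 i
  obtain ⟨S, hS, hSi⟩ := exists_leftInverse_innov (M := Unit)
    (measurable_linearSchemePredictor F G H X V) k
  have h2 := h1.comp measurable_id (ψ := fun e => S ((), e)) (hS.comp (by fun_prop))
  have h3 : receivedBefore F G H (linearEncoder F G H X V n) k =
      (fun e => S ((), e)) ∘ fun ω (j : Fin k) => innovAt F G H X V ω j := by
    ext1 ω
    have h4 : (fun j : Fin k => innovAt F G H X V ω j) = innov (linearSchemePredictor F G H X V) k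
      ((), receivedBefore F G H (linearEncoder F G H X V n) k ω) := by
      ext j
      exact (innov_linearSchemePredictor F G H X V ω k j).symm
    rw [Function.comp_apply, h4, hSi]
  rw [h3]
  exact h2

theorem integrable_errAt (k : ℕ) :
    Integrable (fun ω => errAt F G H X V ω k) (jointLaw (gaussMessage n V)) :=
  Integrable.of_eval fun i => (memLp_errAt F G H X V n k i).integrable (by norm_num)

theorem measurable_errAt (k : ℕ) :
    Measurable fun ω : (Fin n → ℝ) × (ℕ → ℝ) => errAt F G H X V ω k := by
  have h1 : Measurable fun ω : (Fin n → ℝ) × (ℕ → ℝ) => noiseState F G ω.2 k :=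
    measurable_noiseState fun j _ => measurable_noise_coord j
  have h2 : Measurable fun ω => estimate F G H X V
      (extendZero (receivedBefore F G H (linearEncoder F G H X V n) k ω)) k :=
    (continuous_estimate F G H X V continuous_extendZero k).measurable.comp
      (measurable_receivedBefore F G H (linearEncoder F G H X V n) k)
  have h3 := h1.sub h2
  simp only [estimate_receivedBefore] at h3
  simp only [← noiseState_sub_estimate F G H X V]
  exact h3

/-- The state is the estimate, measurable with respect to the past outputs, plus an error that is
independent of them and has mean zero. -/
theorem stateEstimate_linearEncoder {k : ℕ} (hk : k ≤ n) :
    stateEstimate F G H (linearEncoder F G H X V n) (gaussMessage n V) k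
      =ᵐ[jointLaw (gaussMessage n V)] fun ω => estimate F G H X V
        (fun j => received F G H (linearEncoder F G H X V n) j ω) k := by
  set μ := jointLaw (gaussMessage n V)
  set e := linearEncoder F G H X V n
  have hr := measurable_receivedBefore F G H e k
  have hm := hr.comap_le
  have h0 : (fun ω : (Fin n → ℝ) × (ℕ → ℝ) => noiseState F G ω.2 k) =
      (fun ω => errAt F G H X V ω k) +
        fun ω => estimate F G H X V (fun j => received F G H e j ω) k := by
    ext1 ω
    rw [Pi.add_apply, ← noiseState_sub_estimate F G H X V ω k, sub_add_cancel]
  have hi : Integrable (fun ω : (Fin n → ℝ) × (ℕ → ℝ) => noiseState F G ω.2 k) μ :=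
    Integrable.of_eval fun i => (memLp_noiseState F G (gaussMessage n V) k i).integrable (by norm_num)
  have hie := integrable_errAt F G H X V n k
  have his : Integrable (fun ω => estimate F G H X V (fun j => received F G H e j ω) k) μ := by
    have := hi.sub hie
    rw [h0] at this
    simpa using this
  have h1 := condExp_add hie his (MeasurableSpace.comap (receivedBefore F G H e k) inferInstance)
  have hsm : StronglyMeasurable[MeasurableSpace.comap (receivedBefore F G H e k) inferInstance]
      fun ω => estimate F G H X V (fun j => received F G H e j ω) k := by
    have h2 : Measurable fun y : Fin k → ℝ => estimate F G H X V (extendZero y) k :=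
      (continuous_estimate F G H X V continuous_extendZero k).measurable
    have h3 := h2.comp (comap_measurable (receivedBefore F G H e k))
    have h4 : (fun y : Fin k → ℝ => estimate F G H X V (extendZero y) k) ∘
        receivedBefore F G H e k =
        fun ω => estimate F G H X V (fun j => received F G H e j ω) k := by
      ext1 ω
      exact estimate_receivedBefore F G H X V ω k
    rw [h4] at h3
    exact h3.stronglyMeasurable
  have hsf : StronglyMeasurable[MeasurableSpace.comap (fun ω => errAt F G H X V ω k) inferInstance]
      fun ω : (Fin n → ℝ) × (ℕ → ℝ) => errAt F G H X V ω k :=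
    (comap_measurable _).stronglyMeasurable
  have h5 := condExp_indep_eq (measurable_errAt F G H X V n k).comap_le hm hsf
    (indepFun_errAt_receivedBefore F G H X V n hk)
  have h6 : ∫ ω, errAt F G H X V ω k ∂μ = 0 := by
    ext i
    rw [eval_integral fun i => (memLp_errAt F G H X V n k i).integrable (by norm_num)]
    exact integral_errAt k i
  rw [condExp_of_stronglyMeasurable hm hsm his] at h1
  rw [stateEstimate, h0]
  filter_upwards [h1, h5] with ω h7 h8
  rw [h7, Pi.add_apply, h8, h6, zero_add]

theorem sent_linearEncoder_ae (k : Fin n) :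
    sent F G H (linearEncoder F G H X V n) k =ᵐ[jointLaw (gaussMessage n V)]
      fun ω => X k ⬝ᵥ estimationError F G H (linearEncoder F G H X V n) (gaussMessage n V) k ω +
        ω.1 k := by
  filter_upwards [stateEstimate_linearEncoder F G H X V n k.2.le] with ω h
  rw [sent_linearEncoder, estimationError, h, noiseState_sub_estimate]
  simp [extendZero]

end laws

end FeedbackChannel

namespace FeedbackChannel

open Filter Topology

/-! ### Relabelling messages -/

section comap

variable {m : ℕ} (F : Matrix (Fin m) (Fin m) ℝ) (G H : Fin m → ℝ)
  {M M' : Type} [MeasurableSpace M] [MeasurableSpace M'] (e : Encoder M) {φ : M' → M}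
  (hφ : Measurable φ)

/-- The encoder that sends the code of the message `φ w` for the message `w`. -/
def Encoder.comap : Encoder M' where
  f k z := e.f k (φ z.1, z.2)
  measurable_f k := (e.measurable_f k).comp ((hφ.comp measurable_fst).prodMk measurable_snd)

theorem sent_comap (k : ℕ) (ω : M' × (ℕ → ℝ)) :
    sent F G H (e.comap hφ) k ω = sent F G H e k (φ ω.1, ω.2) := by
  induction k using Nat.strong_induction_on with
  | _ k ih =>
    rw [sent_eq, sent_eq]
    simp only [received]
    rw [show (fun i : Fin k => sent F G H (e.comap hφ) i ω) =
      fun i : Fin k => sent F G H e i (φ ω.1, ω.2) from funext fun i => ih i i.2]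
    rw [show (fun i : Fin k => sent F G H (e.comap hφ) i ω + noise F G H ω.2 i) =
      fun i : Fin k => sent F G H e i (φ ω.1, ω.2) + noise F G H ω.2 i from
        funext fun i => by rw [ih i i.2]]
    rfl

theorem decodedInput_comap (w : M') (y : ℕ → ℝ) (k : ℕ) :
    decodedInput (e.comap hφ) w y k = decodedInput e (φ w) y k := by
  induction k using Nat.strong_induction_on with
  | _ k ih =>
    rw [decodedInput, decodedInput]
    change e.f k (φ w, _, _) = _
    congr 3
    ext i
    exact ih i i.2

theorem channelDensity_comap (n : ℕ) (w : M') (y : Fin n → ℝ) :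
    channelDensity F G H (e.comap hφ) n (w, y) = channelDensity F G H e n (φ w, y) := by
  have h : innov (channelShift F G H (e.comap hφ)) n (w, y) =
      innov (channelShift F G H e) n (φ w, y) := by
    ext k
    simp only [innov, channelShift, decodedInput_comap]
  rw [channelDensity, channelDensity, h]

theorem power_comap (π : Measure M') [IsProbabilityMeasure π] (k : ℕ) :
    power F G H (e.comap hφ) π k = power F G H e (π.map φ) k := by
  have h : (jointLaw π).map (Prod.map φ id) = jointLaw (π.map φ) := by
    rw [jointLaw, jointLaw, ← Measure.map_prod_map _ _ hφ measurable_id, Measure.map_id]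
  rw [power, power, ← h, lintegral_map ((measurable_sent F G H e k).pow_const 2).ennreal_ofReal
    (hφ.prodMap measurable_id)]
  simp only [sent_comap]
  rfl

/-- Information depends on the message only through the law of the codeword label, so `φ` need not
be injective: repeated samples do no harm. -/
theorem info_comap (π : Measure M') (n : ℕ) :
    info F G H (e.comap hφ) π n = info F G H e (π.map φ) n := by
  have h := measurable_channelDensity F G H e n
  have h1 : ∀ y, ∫ w, channelDensity F G H (e.comap hφ) n (w, y) ∂π =
      ∫ w, channelDensity F G H e n (w, y) ∂(π.map φ) := fun y => by
    have h' : Measurable fun w => channelDensity F G H e n (w, y) := h.comp measurable_prodMk_right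
    rw [integral_map hφ.aemeasurable h'.aestronglyMeasurable]
    simp only [channelDensity_comap]
  have h2 : ∀ y, ∫ w, channelDensity F G H (e.comap hφ) n (w, y) *
        Real.log (channelDensity F G H (e.comap hφ) n (w, y)) ∂π =
      ∫ w, channelDensity F G H e n (w, y) *
        Real.log (channelDensity F G H e n (w, y)) ∂(π.map φ) := fun y => by
    have h' : Measurable fun w => channelDensity F G H e n (w, y) := h.comp measurable_prodMk_right
    have h2 : Measurable fun w => channelDensity F G H e n (w, y) *
      Real.log (channelDensity F G H e n (w, y)) := h'.mul h'.log
    rw [integral_map hφ.aemeasurable h2.aestronglyMeasurable]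
    simp only [channelDensity_comap]
  simp only [info, infoDensity, h1, h2]

end comap

/-! ### Empirical averages -/

section empirical

instance isProbabilityMeasure_uniformMessage (N : ℕ) [NeZero N] :
    IsProbabilityMeasure (uniformMessage N) := by
  unfold uniformMessage
  exact isProbabilityMeasure_uniformOn Set.finite_univ Set.univ_nonempty

theorem integral_uniformMessage (N : ℕ) [NeZero N] (g : Fin N → ℝ) :
    ∫ i, g i ∂(uniformMessage N) = (∑ i, g i) / N := by
  rw [integral_fintype Integrable.of_finite, Finset.sum_div]
  refine Finset.sum_congr rfl fun i _ => ?_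
  rw [measureReal_def, uniformMessage, uniformOn_univ]
  simp [div_eq_inv_mul]

variable {M : Type*} [MeasurableSpace M] (γ : Measure M) [IsProbabilityMeasure γ]

theorem ae_tendsto_average {g : M → ℝ} (hg : Measurable g) (hi : Integrable g γ) :
    ∀ᵐ a ∂(Measure.infinitePi fun _ : ℕ => γ),
      Tendsto (fun N : ℕ => (∑ i ∈ Finset.range N, g (a i)) / N) atTop (𝓝 (∫ w, g w ∂γ)) := by
  have hp := fun i : ℕ => measurePreserving_eval_infinitePi (fun _ : ℕ => γ) i
  have h0 : ∫ a : ℕ → M, g (a 0) ∂(Measure.infinitePi fun _ : ℕ => γ) = ∫ w, g w ∂γ := by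
    have h := integral_map (μ := Measure.infinitePi fun _ : ℕ => γ) (f := g)
      (hp 0).measurable.aemeasurable hg.aestronglyMeasurable
    rw [(hp 0).map_eq] at h
    exact h.symm
  have h1 : Integrable (fun a : ℕ → M => g (a 0)) (Measure.infinitePi fun _ : ℕ => γ) :=
    (hp 0).integrable_comp_of_integrable hi
  have h2 : iIndepFun (fun (i : ℕ) (a : ℕ → M) => g (a i)) (Measure.infinitePi fun _ : ℕ => γ) :=
    iIndepFun_infinitePi fun _ => hg
  have h3 : ∀ i : ℕ, IdentDistrib (fun a : ℕ → M => g (a i)) (fun a => g (a 0))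
      (Measure.infinitePi fun _ : ℕ => γ) (Measure.infinitePi fun _ : ℕ => γ) := fun i => by
    have h : IdentDistrib (fun a : ℕ → M => a i) (fun a => a 0)
        (Measure.infinitePi fun _ : ℕ => γ) (Measure.infinitePi fun _ : ℕ => γ) :=
      ⟨(hp i).measurable.aemeasurable, (hp 0).measurable.aemeasurable,
        (hp i).map_eq.trans (hp 0).map_eq.symm⟩
    exact h.comp hg
  have h4 := strong_law_ae_real (fun (i : ℕ) (a : ℕ → M) => g (a i)) h1
    (fun i j hij => h2.indepFun hij) h3
  rwa [h0] at h4

/-- The strong law holds for each `y` outside a null set of samples depending on `y`; Fubini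
exchanges the quantifiers, so that one sample sequence serves almost all outputs. -/
theorem ae_ae_tendsto_average {B : Type*} [MeasurableSpace B] {lam : Measure B} [SFinite lam]
    {ψ : M × B → ℝ} (hψ : Measurable ψ) (hi : ∀ y, Integrable (fun w => ψ (w, y)) γ) :
    ∀ᵐ a ∂(Measure.infinitePi fun _ : ℕ => γ), ∀ᵐ y ∂lam,
      Tendsto (fun N : ℕ => (∑ i ∈ Finset.range N, ψ (a i, y)) / N) atTop
        (𝓝 (∫ w, ψ (w, y) ∂γ)) := by
  have h1 : ∀ N : ℕ, Measurable fun z : (ℕ → M) × B =>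
      (∑ i ∈ Finset.range N, ψ (z.1 i, z.2)) / (N : ℝ) := fun N =>
    (Finset.measurable_sum _ fun i _ => hψ.comp
      (((measurable_pi_apply i).comp measurable_fst).prodMk measurable_snd)).div_const _
  have h2 : Measurable fun z : (ℕ → M) × B => ∫ w, ψ (w, z.2) ∂γ :=
    (measurable_integral_section (π := γ) hψ).comp measurable_snd
  have h3 := measurableSet_tendsto_fun (l := atTop) h1 h2
  rw [Measure.ae_ae_comm h3]
  exact ae_of_all _ fun y => ae_tendsto_average γ (hψ.comp measurable_prodMk_right) (hi y)

/-- If the mean is positive, the factor `c < 1` turns convergence into an eventual inequality. If it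
is zero, `g` vanishes at all samples almost surely. -/
theorem ae_eventually_mul_average_le {g : M → ℝ} (hg : Measurable g) (hi : Integrable g γ)
    (h0 : ∀ w, 0 ≤ g w) {c : ℝ} (hc : c < 1) :
    ∀ᵐ a ∂(Measure.infinitePi fun _ : ℕ => γ), ∀ᶠ N : ℕ in atTop,
      c * ((∑ i ∈ Finset.range N, g (a i)) / N) ≤ ∫ w, g w ∂γ := by
  rcases (integral_nonneg h0 : 0 ≤ ∫ w, g w ∂γ).eq_or_lt with h | h
  · have h1 := (integral_eq_zero_iff_of_nonneg h0 hi).1 h.symm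
    have h2 : ∀ᵐ a ∂(Measure.infinitePi fun _ : ℕ => γ), ∀ i : ℕ, g (a i) = 0 :=
      ae_all_iff.2 fun i =>
        (measurePreserving_eval_infinitePi (fun _ : ℕ => γ) i).quasiMeasurePreserving.ae h1
    filter_upwards [h2] with a ha
    refine Eventually.of_forall fun N => ?_
    simp [ha, ← h]
  · filter_upwards [ae_tendsto_average γ hg hi] with a ha
    have h1 : c * ∫ w, g w ∂γ < ∫ w, g w ∂γ := by nlinarith
    exact ((ha.const_mul c).eventually_lt_const h1).mono fun N hN => hN.le

end empirical

end FeedbackChannel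

namespace FeedbackChannel

open Filter Topology

/-! ### Limits of messages -/

section limits

variable {m : ℕ} (F : Matrix (Fin m) (Fin m) ℝ) (G H : Fin m → ℝ)
  {M : Type} [MeasurableSpace M] (e : Encoder M) (π : Measure M) [IsProbabilityMeasure π] (n : ℕ)

theorem info_le_of_tendsto {π' : ℕ → Measure M} [∀ j, IsProbabilityMeasure (π' j)] {B : ℝ≥0∞}
    (hB : ∀ᶠ j in atTop, info F G H e (π' j) n ≤ B)
    (hlim : ∀ᵐ y, Tendsto (fun j => ∫ w, channelDensity F G H e n (w, y) ∂(π' j)) atTop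
      (𝓝 (∫ w, channelDensity F G H e n (w, y) ∂π)))
    (hlim' : ∀ᵐ y, Tendsto (fun j => ∫ w, channelDensity F G H e n (w, y) *
        Real.log (channelDensity F G H e n (w, y)) ∂(π' j)) atTop
      (𝓝 (∫ w, channelDensity F G H e n (w, y) *
        Real.log (channelDensity F G H e n (w, y)) ∂π))) :
    info F G H e π n ≤ B := by
  have hf := measurable_channelDensity F G H e n
  refine (lintegral_infoDensity_le_liminf (fun _ => hf) hf (channelDensity_pos F G H e n)
    (channelDensity_le_one F G H e n) hlim hlim').trans ?_
  exact (liminf_le_liminf hB).trans_eq (liminf_const B)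

theorem integral_map_uniformMessage (N : ℕ) [NeZero N] (a : ℕ → M) {g : M → ℝ}
    (hg : Measurable g) : ∫ w, g w ∂((uniformMessage N).map fun i : Fin N => a i) =
      (∑ i ∈ Finset.range N, g (a i)) / N := by
  rw [integral_map (measurable_of_finite _).aemeasurable hg.aestronglyMeasurable,
    integral_uniformMessage, Finset.sum_range]

/-- A bound for the information carried by empirical measures of samples of a message holds for
the message itself. -/
theorem info_le_of_empirical {B : ℝ≥0∞}
    (hB : ∀ᵐ a ∂(Measure.infinitePi fun _ : ℕ => π), ∀ᶠ N : ℕ in atTop,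
      info F G H e ((uniformMessage (N + 1)).map fun i : Fin (N + 1) => a i) n ≤ B) :
    info F G H e π n ≤ B := by
  have hf := measurable_channelDensity F G H e n
  have h0 := channelDensity_pos F G H e n
  have h1 := channelDensity_le_one F G H e n
  have hfl : Measurable fun z => channelDensity F G H e n z *
    Real.log (channelDensity F G H e n z) := hf.mul hf.log
  have h2 := ae_ae_tendsto_average π (lam := volume) hf
    fun y => integrable_section hf h0 h1 y
  have h3 := ae_ae_tendsto_average π (lam := volume) hfl
    fun y => integrable_section_mul_log hf h0 h1 y
  obtain ⟨a, haB, ha2, ha3⟩ := (hB.and (h2.and h3)).exists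
  have : ∀ N : ℕ, IsProbabilityMeasure
      ((uniformMessage (N + 1)).map fun i : Fin (N + 1) => a i) := fun N =>
    Measure.isProbabilityMeasure_map (measurable_of_finite _).aemeasurable
  refine info_le_of_tendsto F G H e π n haB ?_ ?_
  · filter_upwards [ha2] with y hy
    have h : ∀ N : ℕ, ∫ w, channelDensity F G H e n (w, y)
        ∂((uniformMessage (N + 1)).map fun i : Fin (N + 1) => a i) =
        (∑ i ∈ Finset.range (N + 1), channelDensity F G H e n (a i, y)) / ((N + 1 : ℕ) : ℝ) :=
      fun N => integral_map_uniformMessage (N + 1) a (hf.comp measurable_prodMk_right)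
    simp only [h]
    exact hy.comp (tendsto_add_atTop_nat 1)
  · filter_upwards [ha3] with y hy
    have h : ∀ N : ℕ, ∫ w, channelDensity F G H e n (w, y) *
        Real.log (channelDensity F G H e n (w, y))
        ∂((uniformMessage (N + 1)).map fun i : Fin (N + 1) => a i) =
        (∑ i ∈ Finset.range (N + 1), channelDensity F G H e n (a i, y) *
          Real.log (channelDensity F G H e n (a i, y))) / ((N + 1 : ℕ) : ℝ) :=
      fun N => integral_map_uniformMessage (N + 1) a (hfl.comp measurable_prodMk_right)
    simp only [h]
    exact hy.comp (tendsto_add_atTop_nat 1)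

theorem continuous_channelDensity [TopologicalSpace M] (he : ∀ k, Continuous (e.f k))
    (y : Fin n → ℝ) : Continuous fun w => channelDensity F G H e n (w, y) := by
  have h : ∀ k : Fin n, Continuous fun w => innov (channelShift F G H e) n (w, y) k := fun k =>
    continuous_const.sub (continuous_channelShift F G H e he k fun i => y (Fin.castLE k.2.le i))
  have hg : Continuous fun x => gaussianPDFReal 0 1 x := by
    unfold gaussianPDFReal
    fun_prop
  unfold channelDensity gaussDensity
  exact continuous_finsetProd _ fun k _ => hg.comp (h k)

end limits

-- Contraction of the message

section scaling

variable {m : ℕ} (F : Matrix (Fin m) (Fin m) ℝ) (G H : Fin m → ℝ) {n : ℕ}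
  (e : Encoder (Fin n → ℝ)) (π : Measure (Fin n → ℝ)) [IsProbabilityMeasure π]

/-- The code is continuous in the message, so the density at `t • w` converges to that at `w` as `t
→ 1`; with the integrands bounded by one, dominated convergence and lower semicontinuity of
information apply. -/
theorem info_le_of_scaled (he : ∀ k, Continuous (e.f k)) {B : ℝ≥0∞}
    (hB : ∀ t : ℝ, 0 < t → t < 1 → info F G H e (π.map fun w => t • w) n ≤ B) :
    info F G H e π n ≤ B := by
  obtain ⟨t, -, ht1, ht⟩ := exists_seq_strictMono_tendsto' (zero_lt_one (α := ℝ))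
  have hs : ∀ j, Measurable fun w : Fin n → ℝ => t j • w := fun j => measurable_const_smul (t j)
  have : ∀ j, IsProbabilityMeasure (π.map fun w => t j • w) := fun j =>
    Measure.isProbabilityMeasure_map (hs j).aemeasurable
  have hf := measurable_channelDensity F G H e n
  have h0 := channelDensity_pos F G H e n
  have h1 := channelDensity_le_one F G H e n
  have hc : ∀ (g : (Fin n → ℝ) → ℝ), Continuous g → (∀ w, |g w| ≤ 1) →
      Tendsto (fun j => ∫ w, g w ∂(π.map fun w => t j • w)) atTop (𝓝 (∫ w, g w ∂π)) := by
    intro g hg hg1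
    have h : ∀ j, ∫ w, g w ∂(π.map fun w => t j • w) = ∫ w, g (t j • w) ∂π := fun j =>
      integral_map (hs j).aemeasurable hg.aestronglyMeasurable
    simp only [h]
    refine tendsto_integral_of_dominated_convergence (fun _ => 1)
      (fun j => (hg.comp (continuous_const_smul (t j))).aestronglyMeasurable)
      (integrable_const 1) (fun j => ae_of_all _ fun w => hg1 _) (ae_of_all _ fun w => ?_)
    have h2 := (hg.tendsto ((1 : ℝ) • w)).comp (ht.smul_const w)
    rw [one_smul] at h2
    exact h2
  have hcf := continuous_channelDensity F G H e n he
  refine info_le_of_tendsto F G H e π n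
    (Eventually.of_forall fun j => hB (t j) (ht1 j).1 (ht1 j).2) ?_ ?_
  · refine ae_of_all _ fun y => hc _ (hcf y) fun w => ?_
    rw [abs_of_pos (h0 _)]
    exact h1 _
  · refine ae_of_all _ fun y => hc _ ((hcf y).mul ((hcf y).log fun w => (h0 _).ne')) fun w => ?_
    exact abs_mul_log_le_one (h0 _) (h1 _)

end scaling

/-! ### The power of the linear scheme for arbitrary messages -/

section linearPower

variable {m : ℕ} (F : Matrix (Fin m) (Fin m) ℝ) (G H : Fin m → ℝ) (X : ℕ → Fin m → ℝ)
  (V : ℕ → ℝ≥0) (n : ℕ)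

/-- The sent symbol as a linear map of the message and the noise over the horizon `n`. -/
noncomputable def sentLinear (k : ℕ) : (Fin n → ℝ) × (Fin n → ℝ) →L[ℝ] ℝ :=
  LinearMap.toContinuousLinearMap
    { toFun := fun z => X k ⬝ᵥ errLinear F G H X V n k z + extendZero z.1 k
      map_add' := fun z z' => by
        rw [map_add, Prod.fst_add, extendZero_add, dotProduct_add, Pi.add_apply]
        ring
      map_smul' := fun c z => by
        rw [map_smul, Prod.smul_fst, extendZero_smul, dotProduct_smul, Pi.smul_apply, smul_eq_mul,
          smul_eq_mul, smul_eq_mul, RingHom.id_apply]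
        ring }

variable {n}

theorem sent_eq_sentLinear {k : ℕ} (hk : k ≤ n) (ω : (Fin n → ℝ) × (ℕ → ℝ)) :
    sent F G H (linearEncoder F G H X V n) k ω =
      sentLinear F G H X V n k (ω.1, fun i : Fin n => ω.2 i) := by
  rw [sent_linearEncoder, errAt_eq_errLinear F G H X V ω hk]
  rfl

theorem lintegral_sq_const_add {Ω : Type*} [MeasurableSpace Ω] {μ : Measure Ω}
    [IsProbabilityMeasure μ] {f : Ω → ℝ} (hf : MemLp f 2 μ) (h0 : ∫ a, f a ∂μ = 0) (c : ℝ) :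
    ∫⁻ a, ENNReal.ofReal ((c + f a) ^ 2) ∂μ = ENNReal.ofReal (c ^ 2 + ∫ a, f a ^ 2 ∂μ) := by
  have hi := hf.integrable one_le_two
  rw [lintegral_sq_eq (f := fun a => c + f a) ((memLp_const c).add hf)]
  simp only [add_sq]
  have hi2 : Integrable (fun a => c ^ 2 + 2 * c * f a) μ :=
    (integrable_const _).add (hi.const_mul _)
  rw [integral_add hi2 hf.integrable_sq, integral_add (integrable_const _) (hi.const_mul _), integral_const_mul, h0]
  simp

/-- The cross term vanishes because the noise is centered, whatever the message value `w`. -/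
theorem lintegral_linear_sq (L : (Fin n → ℝ) × (Fin n → ℝ) →L[ℝ] ℝ) (w : Fin n → ℝ) :
    ∫⁻ v, ENNReal.ofReal (L (w, v) ^ 2) ∂(Measure.pi fun _ : Fin n => gaussianReal 0 1) =
      ENNReal.ofReal (L (w, 0) ^ 2 +
        ∫ v, L (0, v) ^ 2 ∂(Measure.pi fun _ : Fin n => gaussianReal 0 1)) := by
  set ν := Measure.pi fun _ : Fin n => gaussianReal 0 1 with hν
  have hG : IsGaussian ν := isGaussian_pi fun _ : Fin n => (1 : ℝ≥0)
  have hid := IsGaussian.memLp_id ν 2 (by simp)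
  let L' : (Fin n → ℝ) →L[ℝ] ℝ := L.comp (ContinuousLinearMap.inr ℝ (Fin n → ℝ) (Fin n → ℝ))
  have hL' : MemLp (fun v => L (0, v)) 2 ν := L'.comp_memLp' hid
  have hi : Integrable (fun v => v) ν := hid.integrable (by norm_num)
  have hmean : ∫ v, L (0, v) ∂ν = 0 := by
    have h := L'.integral_comp_comm hi
    have h2 : ∫ v, v ∂ν = 0 := by
      ext i
      rw [eval_integral fun i => hi.eval i]
      exact (integral_comp_eval (μ := fun _ : Fin n => gaussianReal 0 1) (f := fun x : ℝ => x)
        (by fun_prop)).trans integral_id_gaussianReal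
    rw [h2, map_zero] at h
    exact h
  have hdec : (fun v => ENNReal.ofReal (L (w, v) ^ 2)) =
      fun v => ENNReal.ofReal ((L (w, 0) + L (0, v)) ^ 2) := by
    ext v
    rw [← map_add, Prod.mk_add_mk, add_zero, zero_add]
  rw [hdec, lintegral_sq_const_add hL' hmean]

/-- Message and noise contribute separately to the power, even for a message law that is neither
Gaussian nor centered. Replacing the message law thus affects only the second moment of one linear
functional. -/
theorem power_linearEncoder_eq (π : Measure (Fin n → ℝ)) [IsProbabilityMeasure π] {k : ℕ}
    (hk : k ≤ n) (hi : Integrable (fun w => sentLinear F G H X V n k (w, 0) ^ 2) π) :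
    power F G H (linearEncoder F G H X V n) π k =
      ENNReal.ofReal (∫ w, sentLinear F G H X V n k (w, 0) ^ 2 ∂π +
        ∫ v, sentLinear F G H X V n k (0, v) ^ 2
          ∂(Measure.pi fun _ : Fin n => gaussianReal 0 1)) := by
  set L := sentLinear F G H X V n k
  have hr : (0 : ℝ) ≤ ∫ v, L (0, v) ^ 2 ∂(Measure.pi fun _ : Fin n => gaussianReal 0 1) :=
    integral_nonneg fun v => sq_nonneg _
  rw [power, jointLaw, lintegral_prod _
    ((measurable_sent F G H _ k).pow_const 2).ennreal_ofReal.aemeasurable]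
  have h1 : ∀ w, ∫⁻ u, ENNReal.ofReal (sent F G H (linearEncoder F G H X V n) k (w, u) ^ 2)
      ∂whiteNoise = ENNReal.ofReal (L (w, 0) ^ 2 +
        ∫ v, L (0, v) ^ 2 ∂(Measure.pi fun _ : Fin n => gaussianReal 0 1)) := fun w => by
    rw [← lintegral_linear_sq, ← map_whiteNoise_restrict, lintegral_map (by fun_prop) (by fun_prop)]
    simp only [sent_eq_sentLinear F G H X V hk]
    rfl
  simp only [h1]
  have h2 : Integrable (fun w => L (w, 0) ^ 2 +
      ∫ v, L (0, v) ^ 2 ∂(Measure.pi fun _ : Fin n => gaussianReal 0 1)) π :=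
    hi.add (integrable_const _)
  rw [← ofReal_integral_eq_lintegral_ofReal h2
    (ae_of_all _ fun w => add_nonneg (sq_nonneg _) hr), integral_add hi (integrable_const _)]
  simp

/-- The uniform messages carry at least the information of the linear scheme. -/
theorem info_linearEncoder_le {A : (ℕ → ℝ≥0∞) → Prop}
    (hA : ∀ p p' : ℕ → ℝ≥0∞, (∀ k < n, p k ≤ p' k) → A p' → A p)
    (hpow : A (power F G H (linearEncoder F G H X V n) (gaussMessage n V))) {B : ℝ≥0∞}
    (hB : ∀ N, 0 < N → ∀ e : Encoder (Fin N), A (power F G H e (uniformMessage N)) →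
      info F G H e (uniformMessage N) n ≤ B) :
    info F G H (linearEncoder F G H X V n) (gaussMessage n V) n ≤ B := by
  have hG : IsGaussian (gaussMessage n V) := isGaussian_pi fun i : Fin n => V i
  have hid := IsGaussian.memLp_id (gaussMessage n V) 2 (by simp)
  let l : ℕ → (Fin n → ℝ) →L[ℝ] ℝ := fun k =>
    (sentLinear F G H X V n k).comp (ContinuousLinearMap.inl ℝ (Fin n → ℝ) (Fin n → ℝ))
  have hl : ∀ k, Integrable (fun w => l k w ^ 2) (gaussMessage n V) := fun k =>
    ((l k).comp_memLp' hid).integrable_sq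
  have hlm : ∀ k, Measurable fun w => l k w ^ 2 := fun k => (l k).measurable.pow_const 2
  -- Contracting by `t < 1` leaves the slack in the power constraint that the empirical averages
  -- need.
  refine info_le_of_scaled F G H _ _ (continuous_linearCode F G H X V n) fun t ht0 ht1 => ?_
  have hs : Measurable fun w : Fin n → ℝ => t • w := measurable_const_smul t
  have : IsProbabilityMeasure ((gaussMessage n V).map fun w => t • w) :=
    Measure.isProbabilityMeasure_map hs.aemeasurable
  have hint : ∀ k, ∫ w, l k w ^ 2 ∂((gaussMessage n V).map fun w => t • w) =
      t ^ 2 * ∫ w, l k w ^ 2 ∂(gaussMessage n V) := fun k => by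
    rw [integral_map hs.aemeasurable (hlm k).aestronglyMeasurable, ← integral_const_mul]
    simp only [map_smul, smul_eq_mul, mul_pow]
  have hlt : ∀ k, Integrable (fun w => l k w ^ 2) ((gaussMessage n V).map fun w => t • w) :=
    fun k => by
      rw [integrable_map_measure (hlm k).aestronglyMeasurable hs.aemeasurable]
      have : (fun w => l k w ^ 2) ∘ (fun w : Fin n → ℝ => t • w) = fun w => t ^ 2 * l k w ^ 2 := by
        ext w
        simp [mul_pow]
      rw [this]
      exact (hl k).const_mul _
  refine info_le_of_empirical F G H _ _ n ?_
  -- The factor `t ^ 2 < 1` is the slack in the law of large numbers for samples of the contracted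
  -- message.
  have hev : ∀ᵐ a ∂(Measure.infinitePi fun _ : ℕ => (gaussMessage n V).map fun w => t • w),
      ∀ k : ℕ, ∀ᶠ N : ℕ in atTop, t ^ 2 * ((∑ i ∈ Finset.range N, l k (a i) ^ 2) / N) ≤
        ∫ w, l k w ^ 2 ∂((gaussMessage n V).map fun w => t • w) :=
    ae_all_iff.2 fun k => ae_eventually_mul_average_le _ (hlm k) (hlt k) (fun w => sq_nonneg _)
      (by nlinarith)
  filter_upwards [hev] with a ha
  have ha2 : ∀ᶠ N : ℕ in atTop, ∀ k ∈ Finset.range n,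
      t ^ 2 * ((∑ i ∈ Finset.range N, l k (a i) ^ 2) / N) ≤
        ∫ w, l k w ^ 2 ∂((gaussMessage n V).map fun w => t • w) :=
    (Filter.eventually_all_finset _).2 fun k _ => ha k
  filter_upwards [(tendsto_add_atTop_nat 1).eventually ha2] with N hN
  have hφ : Measurable fun i : Fin (N + 1) => a i := measurable_of_finite _
  have hp : IsProbabilityMeasure ((uniformMessage (N + 1)).map fun i : Fin (N + 1) => a i) :=
    Measure.isProbabilityMeasure_map hφ.aemeasurable
  rw [← info_comap F G H (linearEncoder F G H X V n) hφ]
  refine hB (N + 1) N.succ_pos _ (hA _ _ (fun k hk => ?_) hpow)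
  rw [power_comap, power_linearEncoder_eq F G H X V _ hk.le (hl k),
    power_linearEncoder_eq F G H X V _ hk.le ?_]
  · refine ENNReal.ofReal_le_ofReal (add_le_add_left ?_ _)
    have h1 := hN k (Finset.mem_range.2 hk)
    -- The mean under the contracted law is `t ^ 2` times the original one, so cancelling `t ^ 2`
    -- bounds the empirical second moment by that of the uncontracted Gaussian message.
    rw [hint k] at h1
    have h2 := integral_map_uniformMessage (N + 1) a (hlm k)
    exact h2.trans_le (le_of_mul_le_mul_left h1 (by positivity))
  · exact (integrable_map_measure (hlm k).aestronglyMeasurable hφ.aemeasurable).2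
      Integrable.of_finite

end linearPower

end FeedbackChannel

namespace FeedbackChannel

open Filter Topology

/-! ### The capacity -/

section capacity

variable {m : ℕ} (F : Matrix (Fin m) (Fin m) ℝ) (G H : Fin m → ℝ) {n : ℕ}

theorem objective_eq (X : ℕ → Fin m → ℝ) (V : ℕ → ℝ≥0) : objective F G H n X V =
    ENNReal.ofReal (1 / 2 * ∑ k ∈ Finset.range n, Real.log (Yseq F G H X V k)) /
      ENNReal.ofReal (Real.log 2) / n := by
  rcases Nat.eq_zero_or_pos n with rfl | hn
  · simp [objective]
  have hn' : (0 : ℝ) < n := Nat.cast_pos.2 hn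
  rw [← ENNReal.ofReal_div_of_pos (Real.log_pos one_lt_two), ← ENNReal.ofReal_natCast n,
    ← ENNReal.ofReal_div_of_pos hn', objective]
  congr 1
  simp only [Real.logb]
  rw [← Finset.sum_div]
  field_simp

variable {R : ℝ} {A : (ℕ → ℝ≥0∞) → Prop}

/-- The capacity under a constraint is the value of the optimization problem, is the same for
uniform messages, and is attained by the linear scheme. -/
theorem capacity_eq_of_isConstraint (hR : 0 ≤ R) (hA : IsConstraint n R A) :
    capacity F G H n A =
        (⨆ (X : ℕ → Fin m → ℝ) (V : ℕ → ℝ≥0) (_ : A (inputPower F G H X V)),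
          objective F G H n X V) ∧
      uniformCapacity F G H n A = capacity F G H n A ∧
      ∃ (X : ℕ → Fin m → ℝ) (V : ℕ → ℝ≥0),
        A (inputPower F G H X V) ∧
        objective F G H n X V = capacity F G H n A ∧
        A (power F G H (linearEncoder F G H X V n) (gaussMessage n V)) ∧
        rate F G H n (gaussMessage n V) (linearEncoder F G H X V n) = capacity F G H n A := by
  obtain ⟨X, V, hXV, hopt⟩ := exists_optimal F G H hR hA
  have hpow : A (power F G H (linearEncoder F G H X V n) (gaussMessage n V)) :=
    hA.mono _ _ (fun k hk => (power_linearEncoder hk).le) hXV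
  have hrate : rate F G H n (gaussMessage n V) (linearEncoder F G H X V n) =
      objective F G H n X V := by
    rw [rate_eq_info, info_linearEncoder, objective_eq]
  have hup : capacity F G H n A ≤ objective F G H n X V := by
    refine iSup_le fun M => iSup_le fun _ => iSup_le fun π => iSup_le fun _ => iSup_le fun e =>
      iSup_le fun he => ?_
    -- Converse: the information is bounded by the objective at some feasible covariance sequence,
    -- hence by its maximum.
    obtain ⟨p, hp, hle⟩ := exists_feasible_info_le F G H e π hR hA he
    rw [rate_eq_info, objective_eq]
    gcongr
    refine hle.trans (ENNReal.ofReal_le_ofReal ?_)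
    have := hopt p hp
    linarith
  have hlow : objective F G H n X V ≤ capacity F G H n A := by
    rw [← hrate]
    exact le_iSup_of_le (Fin n → ℝ) <| le_iSup_of_le inferInstance <|
      le_iSup_of_le (gaussMessage n V) <| le_iSup_of_le inferInstance <|
      le_iSup_of_le (linearEncoder F G H X V n) <| le_iSup_of_le hpow le_rfl
  have heq := le_antisymm hlow hup
  refine ⟨le_antisymm (hup.trans ?_) ?_, le_antisymm ?_ ?_, X, V, hXV, heq, hpow,
    hrate.trans heq⟩
  · exact le_iSup_of_le X <| le_iSup_of_le V <| le_iSup_of_le hXV le_rfl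
  · refine iSup_le fun X' => iSup_le fun V' => iSup_le fun h => ?_
    rw [← heq, objective_eq, objective_eq]
    refine ENNReal.div_le_div_right (ENNReal.div_le_div_right (ENNReal.ofReal_le_ofReal ?_) _) _
    have := sum_log_Yseq_le hR hA hopt h
    linarith
  · refine iSup_le fun N => iSup_le fun hN => iSup_le fun e => iSup_le fun he => ?_
    have : NeZero N := ⟨hN.ne'⟩
    exact le_iSup_of_le (Fin N) <| le_iSup_of_le inferInstance <|
      le_iSup_of_le (uniformMessage N) <| le_iSup_of_le inferInstance <|
      le_iSup_of_le e <| le_iSup_of_le he le_rfl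
  -- The supremum is first taken in nats; division by `log 2` and by `n` commutes with it.
  · set S : ℝ≥0∞ := ⨆ (N : ℕ) (_ : 0 < N) (e : Encoder (Fin N))
      (_ : A (power F G H e (uniformMessage N))), info F G H e (uniformMessage N) n
    have hS : info F G H (linearEncoder F G H X V n) (gaussMessage n V) n ≤ S :=
      info_linearEncoder_le F G H X V hA.mono hpow fun N hN e he =>
        le_iSup_of_le N <| le_iSup_of_le hN <| le_iSup_of_le e <| le_iSup_of_le he le_rfl
    rw [← heq, ← hrate, rate_eq_info]
    refine (ENNReal.div_le_div_right (ENNReal.div_le_div_right hS _) _).trans_eq ?_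
    simp only [S, uniformCapacity, ENNReal.iSup_div]
    refine iSup_congr fun N => iSup_congr fun hN => iSup_congr fun e => iSup_congr fun he => ?_
    have : NeZero N := ⟨hN.ne'⟩
    exact (rate_eq_info F G H e (uniformMessage N) n).symm

end capacity

end FeedbackChannel

theorem mainTheorem3 {m : ℕ} (F : Matrix (Fin m) (Fin m) ℝ) (G H : Fin m → ℝ)
    (n : ℕ) (hn : 0 < n) (P : ℝ) (hP : 0 ≤ P) :
    -- the two forms of the recursion agree
    (∀ (X : ℕ → Fin m → ℝ) (V : ℕ → ℝ≥0) (k : ℕ),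
      Sig F G H X V (k + 1) =
        F * Sig F G H X V k * Fᵀ + vecMulVec G G
          - Yseq F G H X V k • vecMulVec (Gam F G H X V k) (Gam F G H X V k)) ∧
    -- the average constraint, and the constraint at every time
    ∀ A : (ℕ → ℝ≥0∞) → Prop, A = AveragePower n P ∨ A = SymbolPower n P →
      -- the capacity is the value of the optimization problem
      capacity F G H n A =
        (⨆ (X : ℕ → Fin m → ℝ) (V : ℕ → ℝ≥0) (_ : A (inputPower F G H X V)),
          objective F G H n X V) ∧
      -- uniformly distributed messages from finite sets give the same value
      uniformCapacity F G H n A = capacity F G H n A ∧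
      -- the capacity is achieved with the message `W = v`, by symbols `x_k = X_k s̃_k + v_k`
      ∃ (X : ℕ → Fin m → ℝ) (V : ℕ → ℝ≥0) (e : Encoder (Fin n → ℝ)),
        A (inputPower F G H X V) ∧
        objective F G H n X V = capacity F G H n A ∧
        (∀ k : Fin n,
          sent F G H e k =ᵐ[jointLaw (Measure.pi fun i : Fin n => gaussianReal 0 (V i))]
            fun ω => X k ⬝ᵥ estimationError F G H e
              (Measure.pi fun i : Fin n => gaussianReal 0 (V i)) k ω + ω.1 k) ∧
        A (power F G H e (Measure.pi fun i : Fin n => gaussianReal 0 (V i))) ∧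
        rate F G H n (Measure.pi fun i : Fin n => gaussianReal 0 (V i)) e =
          capacity F G H n A := by
  refine ⟨fun X V k => Sig_succ X V k, fun A hA => ?_⟩
  obtain ⟨R, hR, hAR⟩ : ∃ R : ℝ, 0 ≤ R ∧ IsConstraint n R A := by
    rcases hA with rfl | rfl
    · exact ⟨n * P, by positivity, isConstraint_averagePower hn⟩
    · exact ⟨P, hP, isConstraint_symbolPower⟩
  obtain ⟨h1, h2, X, V, h3, h4, h5, h6⟩ := capacity_eq_of_isConstraint F G H hR hAR
  exact ⟨h1, h2, X, V, linearEncoder F G H X V n, h3, h4,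
    fun k => sent_linearEncoder_ae F G H X V n k, h5, h6⟩
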